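/- Let $p>2$ be a prime and write $H^i(\cdot)=H^i(\cdot,\mathbb F_p)$ for continuous cohomology. Let $G$ be a finitely presented pro-$p$ group which is not pro-$p$ free, and put $d=\dim H^1(G)$, $r=\dim H^2(G)$. Suppose $H^1(G)=U\oplus V$ with $U\cup U=0$ and $U\cup V=H^2(G)$ (i.e. the products $u\cup v$ span $H^2(G)$), and put $c=\dim V$. Assume $c\ge 2$ and $r<(d-c)(c-1)$. Notation. Let $F$ be the free pro-$p$ group on $x_1,\dots,x_d$, and let $\varphi:F\to\mathbb F_p\langle\langle X_1,\dots,X_d\rangle\rangle^\times$, $x_i\mapsto 1+X_i$, be the Magnus embedding. Monomials are ordered by: $X_\alpha>X_\beta$ if $\deg X_\alpha<\deg X_\beta$, or if the degrees are equal and $X_\alpha$ is lexicographically larger, where $X_1<\dots<X_d$. The highest term $\widehat x$ of $x\in F$, $x\ne1$, is the largest monomial with nonzero coefficient in $\varphi(x)-1$. A family of monomials is combinatorially free if no member is a submonomial (factor of consecutive letters) of a different member, and no nontrivial proper prefix of a member equals a nontrivial proper suffix of a member (the same or another one). A Forré presentation of $G$ consists of a continuous surjection $\pi:F\to G$ and elements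 $\rho_1,\dots,\rho_r\in F$ that generate $\ker\pi$ as a closed normal subgroup, such that $\widehat{\rho_i}=X_{t(i)}X_{s(i)}$ with $s(i)\le c<t(i)$ and with pairwise distinct pairs $(s(i),t(i))$. Then $G$ has a Forré presentation, and for every Forré presentation $(\pi,\rho_1,\dots,\rho_r)$ of $G$ the following hold. (a) There are indices $1<i_0\le c<j_0\le d$ such that the family consisting of $\widehat{\rho_1},\dots,\widehat{\rho_r}$ and the monomials $X_{j_0}X_{i_0}^nX_1$, $n\ge1$, is combinatorially free, and there are elements $y_n\in F$ ($n\ge 1$) with $\widehat{y_n}=X_{j_0}X_{i_0}^nX_1$. (b) For all indices $1<i_0\le c<j_0\le d$ for which this family is combinatorially free, and all $y_n\in F$ ($n\ge1$) with $\widehat{y_n}=X_{j_0}X_{i_0}^nX_1$, let $\Gamma$ be the quotient of $F$ by the closed normal subgroup generated by $\rho_1,\dots,\rho_r$ and all $y_n$, $n\ge1$. Then $\Gamma$ is a quotient of $G$ (compatibly with $\pi$), and: (i) $\Gamma$ has cohomological dimension $2$; (ii) $\dim H^2(\Gamma)=\infty$; (iii) with $I$ the augmentation ideal of the completed group algebra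 $\mathbb F_p[[\Gamma]]$, all $I^n/I^{n+1}$ are finite-dimensional and $$\sum_{n\ge0}\dim_{\mathbb F_p}(I^n/I^{n+1})\,t^n=\Big(1-dt+rt^2+t^3\sum_{n\ge0}t^n\Big)^{-1}.$$ -/

import Mathlib

namespace ProP

open Finset

/-- Noncommutative formal power series over `R` in `d` variables: functions that give the
coefficient of each word (monomial) in the variables. The letter `i : Fin d` stands for the
variable usually written `X_{i+1}`. -/
def NCSeries (R : Type*) (d : ℕ) : Type _ := List (Fin d) → R

namespace NCSeries

variable {R : Type*} [CommRing R] {d : ℕ}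

instance : AddCommGroup (NCSeries R d) := inferInstanceAs (AddCommGroup (List (Fin d) → R))

instance : One (NCSeries R d) := ⟨fun w => if w = [] then 1 else 0⟩

instance : Mul (NCSeries R d) :=
  ⟨fun f g w => ∑ i ∈ range (w.length + 1), f (w.take i) * g (w.drop i)⟩

/-- The variable `X_i`. -/
def X (R : Type*) [CommRing R] {d : ℕ} (i : Fin d) : NCSeries R d :=
  fun w => if w = [i] then 1 else 0

@[ext]
theorem ext {R : Type*} {d : ℕ} {f g : NCSeries R d} (h : ∀ w, f w = g w) : f = g := funext h

theorem add_apply (f g : NCSeries R d) (w : List (Fin d)) : (f + g) w = f w + g w := rfl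

theorem sub_apply (f g : NCSeries R d) (w : List (Fin d)) : (f - g) w = f w - g w := rfl

theorem zero_apply (w : List (Fin d)) : (0 : NCSeries R d) w = 0 := rfl

theorem one_apply (w : List (Fin d)) : (1 : NCSeries R d) w = if w = [] then 1 else 0 := rfl

theorem mul_apply (f g : NCSeries R d) (w : List (Fin d)) :
    (f * g) w = ∑ i ∈ range (w.length + 1), f (w.take i) * g (w.drop i) := rfl

theorem mul_nil (f g : NCSeries R d) : (f * g) [] = f [] * g [] := by
  simp [mul_apply]

/-- The series `∑ f(a w) w`, obtained from `f` by removing an initial letter `a`. -/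
def shift (a : Fin d) (f : NCSeries R d) : NCSeries R d := fun v => f (a :: v)

theorem shift_apply {R : Type*} {d : ℕ} (a : Fin d) (f : NCSeries R d) (v : List (Fin d)) :
    shift a f v = f (a :: v) := rfl

theorem mul_cons (f g : NCSeries R d) (a : Fin d) (w : List (Fin d)) :
    (f * g) (a :: w) = f [] * g (a :: w) + (shift a f * g) w := by
  rw [mul_apply, mul_apply, List.length_cons, sum_range_succ']
  simp [add_comm, shift_apply]

theorem mul_assoc_apply (w : List (Fin d)) :
    ∀ f g h : NCSeries R d, (f * g * h) w = (f * (g * h)) w := by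
  induction w with
  | nil => intro f g h; simp [mul_nil, mul_assoc]
  | cons a w ih =>
    intro f g h
    have key : ∀ v, shift a (f * g) v = f [] * shift a g v + (shift a f * g) v :=
      fun v => mul_cons f g a v
    rw [mul_cons, mul_cons f, mul_cons g, ← ih, mul_nil, mul_apply _ h, mul_apply _ h,
      mul_apply _ h]
    simp only [key, add_mul, sum_add_distrib, mul_add, mul_sum, mul_assoc, add_assoc]

instance : Ring (NCSeries R d) :=
  { (inferInstance : AddCommGroup (NCSeries R d)),
    (inferInstance : One (NCSeries R d)),
    (inferInstance : Mul (NCSeries R d)) with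
    mul_assoc := fun f g h => ext fun w => mul_assoc_apply w f g h
    one_mul := fun f => by
      ext w
      cases w with
      | nil => simp [mul_nil, one_apply]
      | cons a w => simp [one_apply, mul_apply]
    mul_one := fun f => by
      ext w
      rw [mul_apply, sum_range_succ, sum_eq_zero]
      · simp [one_apply]
      · intro i hi
        have : w.drop i ≠ [] := by
          simpa using hi
        simp [one_apply, this]
    left_distrib := fun f g h => by
      ext w; simp [mul_apply, add_apply, mul_add, sum_add_distrib]
    right_distrib := fun f g h => by
      ext w; simp [mul_apply, add_apply, add_mul, sum_add_distrib]
    zero_mul := fun f => by ext w; simp [mul_apply, zero_apply]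
    mul_zero := fun f => by ext w; simp [mul_apply, zero_apply]
    zsmul := fun n f => n • f
    zsmul_zero' := fun f => zero_zsmul f
    zsmul_succ' := fun n f => SubNegMonoid.zsmul_succ' n f
    zsmul_neg' := fun n f => SubNegMonoid.zsmul_neg' n f
    neg_add_cancel := fun f => neg_add_cancel f }

/-- The constant coefficient. -/
def constCoeff : NCSeries R d →+* R where
  toFun f := f []
  map_one' := by simp [one_apply]
  map_mul' := mul_nil
  map_zero' := rfl
  map_add' _ _ := rfl

theorem charP (p : ℕ) [CharP R p] : CharP (NCSeries R d) p where
  cast_eq_zero_iff n := by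
    constructor
    · intro h
      have := congrArg (constCoeff (R := R) (d := d)) h
      simpa [CharP.cast_eq_zero_iff R p] using this
    · intro h
      have hn : ((n : R)) = 0 := (CharP.cast_eq_zero_iff R p n).2 h
      have : (n : NCSeries R d) = n • (1 : NCSeries R d) := by simp
      rw [this]
      ext w
      have hw : (n • (1 : NCSeries R d)) w = n • ((1 : NCSeries R d) w) := by
        clear this hn h
        induction n with
        | zero => simp [zero_apply]
        | succ n ih => rw [succ_nsmul, succ_nsmul, add_apply, ih]
      rw [hw, nsmul_eq_mul, hn, zero_mul, zero_apply]

theorem pow_apply_of_length_lt (y : NCSeries R d) (hy : y [] = 0) (m : ℕ) :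
    ∀ w : List (Fin d), w.length < m → (y ^ m) w = 0 := by
  induction m with
  | zero => intro w hw; omega
  | succ m ih =>
    intro w hw
    rw [pow_succ', mul_apply]
    refine sum_eq_zero fun i hi => ?_
    rcases Nat.eq_zero_or_pos i with rfl | hi0
    · simp [hy]
    · by_cases hw0 : w = []
      · subst hw0; simp [hy]
      · have := List.length_pos_iff.2 hw0
        rw [ih _ (by rw [List.length_drop]; omega), mul_zero]

/-- The inverse `∑ (-X_i)^k` of `1 + X_i`. -/
def geom (R : Type*) [CommRing R] {d : ℕ} (i : Fin d) : NCSeries R d :=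
  fun w => if ∀ a ∈ w, a = i then (-1) ^ w.length else 0

theorem X_apply (i : Fin d) (w : List (Fin d)) :
    X R i w = if w = [i] then 1 else 0 := rfl

theorem geom_apply (i : Fin d) (w : List (Fin d)) :
    geom R i w = if ∀ a ∈ w, a = i then (-1) ^ w.length else 0 := rfl

/-- The unit `1 + X_i`. -/
def oneAddX (R : Type*) [CommRing R] {d : ℕ} (i : Fin d) : (NCSeries R d)ˣ where
  val := 1 + X R i
  inv := geom R i
  val_inv := by
    ext w
    cases w with
    | nil => simp [mul_nil, add_apply, one_apply, X_apply, geom_apply]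
    | cons a w =>
      have : shift a (1 + X R i) = if a = i then 1 else 0 := by
        ext v
        split_ifs with h <;> simp [shift_apply, add_apply, one_apply, zero_apply, X_apply, h]
      rw [mul_cons, this]
      by_cases h : a = i
      · simp [add_apply, one_apply, X_apply, h, geom_apply, pow_succ]
        split_ifs <;> simp
      · simp [add_apply, one_apply, X_apply, geom_apply, h, zero_apply]
  inv_val := by
    ext w
    induction w with
    | nil => simp [mul_nil, add_apply, one_apply, X_apply, geom_apply]
    | cons a w ih =>
      have hs : shift a (geom R i) = if a = i then -geom R i else 0 := by
        ext v
        split_ifs with h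
        · change _ = -(geom R i v)
          simp only [shift_apply, geom_apply, List.forall_mem_cons, h, true_and, List.length_cons]
          split_ifs <;> simp [pow_succ]
        · simp [shift_apply, geom_apply, h, zero_apply]
      rw [mul_cons, hs]
      by_cases h : a = i
      · rw [if_pos h, neg_mul]
        change _ + -((geom R i * (1 + X R i)) w) = _
        rw [ih]
        simp [add_apply, one_apply, X_apply, geom_apply, h]
      · simp [add_apply, one_apply, X_apply, h, zero_apply]

/-- The Magnus homomorphism `x_i ↦ 1 + X_i` on the abstract free group. -/
def freeMagnus (R : Type*) [CommRing R] (d : ℕ) : FreeGroup (Fin d) →* (NCSeries R d)ˣ :=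
  FreeGroup.lift (oneAddX R)

theorem freeMagnus_nil (g : FreeGroup (Fin d)) :
    (freeMagnus R d g : NCSeries R d) [] = 1 := by
  have h : (Units.map (constCoeff (R := R) (d := d)).toMonoidHom).comp (freeMagnus R d) = 1 := by
    ext i
    change constCoeff ((FreeGroup.lift (oneAddX R) (FreeGroup.of i)).val) = 1
    rw [FreeGroup.lift_apply_of]
    change (1 + X R i : NCSeries R d) [] = 1
    simp [add_apply, one_apply, X_apply]
  exact congrArg Units.val (DFunLike.congr_fun h g)

end NCSeries

/-- The normal subgroups of `p`-power index in the free group on `d` letters. -/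
def PIndex (p d : ℕ) : Type :=
  {N : Subgroup (FreeGroup (Fin d)) // N.Normal ∧ ∃ k : ℕ, N.index = p ^ k}

namespace PIndex

variable {p d : ℕ}

instance (N : PIndex p d) : N.1.Normal := N.2.1

/-- The finite `p`-group quotient attached to `N`, with the discrete topology. -/
abbrev Quot (N : PIndex p d) : Type := FreeGroup (Fin d) ⧸ N.1

instance (N : PIndex p d) : TopologicalSpace N.Quot := ⊥

instance (N : PIndex p d) : DiscreteTopology N.Quot := ⟨rfl⟩

end PIndex

/-- The compatible families in the product of all finite `p`-group quotients of the free group. -/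
def freeProPSubgroup (p d : ℕ) : Subgroup ((N : PIndex p d) → N.Quot) where
  carrier := {x | ∀ (N M : PIndex p d) (h : N.1 ≤ M.1),
    QuotientGroup.map N.1 M.1 (MonoidHom.id _) h (x N) = x M}
  mul_mem' hx hy N M h := by
    rw [Pi.mul_apply, map_mul, hx N M h, hy N M h, Pi.mul_apply]
  one_mem' N M h := by rw [Pi.one_apply, map_one, Pi.one_apply]
  inv_mem' hx N M h := by rw [Pi.inv_apply, map_inv, hx N M h, Pi.inv_apply]

/-- The free pro-`p` group on `d` generators: the pro-`p` completion of the free group on `d`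
letters, with the inverse limit topology. -/
abbrev FreeProP (p d : ℕ) : Type := freeProPSubgroup p d

namespace FreeProP

variable {p d : ℕ}

open NCSeries

theorem freeMagnus_eq_of_inv_mul {n : ℕ} {g h : FreeGroup (Fin d)}
    (H : ∀ w : List (Fin d), w.length ≤ n →
      (freeMagnus (ZMod p) d (g⁻¹ * h) : NCSeries (ZMod p) d) w = (1 : NCSeries (ZMod p) d) w)
    (w : List (Fin d)) (hw : w.length ≤ n) :
    (freeMagnus (ZMod p) d g : NCSeries (ZMod p) d) w =
      (freeMagnus (ZMod p) d h : NCSeries (ZMod p) d) w := by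
  have h1 : h = g * (g⁻¹ * h) := by group
  conv_rhs => rw [h1, map_mul, Units.val_mul, mul_apply]
  conv_lhs => rw [← mul_one (freeMagnus (ZMod p) d g : NCSeries (ZMod p) d), mul_apply]
  refine sum_congr rfl fun i _ => ?_
  rw [H _ (by rw [List.length_drop]; omega)]

/-- The elements of the free group whose Magnus series is `1` up to degree `n`. -/
def truncKer (p d n : ℕ) : Subgroup (FreeGroup (Fin d)) where
  carrier := {g | ∀ w : List (Fin d), w.length ≤ n →
    (freeMagnus (ZMod p) d g : NCSeries (ZMod p) d) w = (1 : NCSeries (ZMod p) d) w}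
  one_mem' := by intro w _; simp
  mul_mem' {g h} hg hh := by
    intro w hw
    rw [← freeMagnus_eq_of_inv_mul (g := g) (n := n) (by simpa using hh) w hw]
    exact hg w hw
  inv_mem' {g} hg := by
    intro w hw
    have := freeMagnus_eq_of_inv_mul (p := p) (g := g⁻¹) (h := 1) (n := n)
      (by simpa using hg) w hw
    simpa using this

theorem mem_truncKer {n : ℕ} {g : FreeGroup (Fin d)} : g ∈ truncKer p d n ↔
    ∀ w : List (Fin d), w.length ≤ n →
      (freeMagnus (ZMod p) d g : NCSeries (ZMod p) d) w = (1 : NCSeries (ZMod p) d) w := Iff.rfl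

instance (n : ℕ) : (truncKer p d n).Normal where
  conj_mem g hg a := by
    intro w hw
    have := freeMagnus_eq_of_inv_mul (p := p) (g := a) (h := a * g) (n := n)
      (by rw [inv_mul_cancel_left]; exact hg)
    rw [map_mul, Units.val_mul, mul_apply]
    rw [show (1 : NCSeries (ZMod p) d) = (freeMagnus (ZMod p) d a : NCSeries (ZMod p) d) *
      (freeMagnus (ZMod p) d a⁻¹ : NCSeries (ZMod p) d) by simp, mul_apply]
    refine sum_congr rfl fun i _ => ?_
    rw [this _ (by rw [List.length_take]; omega)]

theorem truncKer_index (p d n : ℕ) [Fact p.Prime] :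
    ∃ k : ℕ, (truncKer p d n).index = p ^ k := by
  have hfin : Finite (FreeGroup (Fin d) ⧸ truncKer p d n) := by
    have : Finite {w : List (Fin d) // w.length ≤ n} :=
      (List.finite_length_le (Fin d) n).to_subtype
    refine Finite.of_injective (β := {w : List (Fin d) // w.length ≤ n} → ZMod p)
      (fun q w => (freeMagnus (ZMod p) d q.out : NCSeries (ZMod p) d) w.1) ?_
    intro q q' h
    rw [← q.out_eq', ← q'.out_eq']
    refine QuotientGroup.eq.2 fun w hw => ?_
    rw [map_mul, Units.val_mul, mul_apply]
    rw [show (1 : NCSeries (ZMod p) d) =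
      (freeMagnus (ZMod p) d q.out⁻¹ : NCSeries (ZMod p) d) *
      (freeMagnus (ZMod p) d q.out : NCSeries (ZMod p) d) by simp, mul_apply]
    refine sum_congr rfl fun i _ => ?_
    rw [show (freeMagnus (ZMod p) d q.out : NCSeries (ZMod p) d) (w.drop i) =
      (freeMagnus (ZMod p) d q'.out : NCSeries (ZMod p) d) (w.drop i) from
      congrFun h ⟨w.drop i, by rw [List.length_drop]; omega⟩]
  have hp : IsPGroup p (FreeGroup (Fin d) ⧸ truncKer p d n) := by
    intro q
    obtain ⟨g, rfl⟩ := QuotientGroup.mk_surjective q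
    refine ⟨n + 1, ?_⟩
    rw [← QuotientGroup.mk_pow, QuotientGroup.eq_one_iff]
    intro w hw
    have := charP (R := ZMod p) (d := d) p
    have h1 : (freeMagnus (ZMod p) d (g ^ p ^ (n + 1)) : NCSeries (ZMod p) d) =
        1 + ((freeMagnus (ZMod p) d g : NCSeries (ZMod p) d) - 1) ^ p ^ (n + 1) := by
      rw [sub_pow_char_pow_of_commute _ _ (Commute.one_right _)]
      simp
    rw [h1, NCSeries.add_apply, pow_apply_of_length_lt, add_zero]
    · rw [NCSeries.sub_apply, freeMagnus_nil]; simp [one_apply]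
    · exact (lt_of_le_of_lt hw (Nat.lt_succ_self n)).trans
        (Nat.lt_pow_self (Fact.out : p.Prime).one_lt)
  obtain ⟨k, hk⟩ := IsPGroup.iff_card.1 hp
  exact ⟨k, hk⟩

/-- `truncKer p d n` as an index of the inverse system. -/
def truncIndex (p d n : ℕ) [Fact p.Prime] : PIndex p d :=
  ⟨truncKer p d n, inferInstance, truncKer_index p d n⟩

/-- The coefficient of `w` in the Magnus series of `x`, read off from any element of the abstract
free group that is congruent to `x` modulo the series of order greater than the length of `w`. -/
noncomputable def magnusCoeff [Fact p.Prime] (x : FreeProP p d) : NCSeries (ZMod p) d :=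
  fun w => (freeMagnus (ZMod p) d (x.1 (truncIndex p d w.length)).out : NCSeries (ZMod p) d) w

theorem magnusCoeff_eq [Fact p.Prime] (x : FreeProP p d) (n : ℕ) (g : FreeGroup (Fin d))
    (hg : x.1 (truncIndex p d n) = QuotientGroup.mk g) (w : List (Fin d)) (hw : w.length ≤ n) :
    magnusCoeff x w = (freeMagnus (ZMod p) d g : NCSeries (ZMod p) d) w := by
  have hle : (truncIndex p d n).1 ≤ (truncIndex p d w.length).1 :=
    fun a ha v hv => ha v (hv.trans hw)
  have h1 := x.2 (truncIndex p d n) (truncIndex p d w.length) hle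
  rw [hg] at h1
  refine freeMagnus_eq_of_inv_mul (n := w.length) ?_ w le_rfl
  have h2 : (QuotientGroup.mk (x.1 (truncIndex p d w.length)).out :
      (truncIndex p d w.length).Quot) = QuotientGroup.mk g := by
    rw [QuotientGroup.out_eq', ← h1]; rfl
  exact QuotientGroup.eq.1 h2

/-- The Magnus homomorphism from the free pro-`p` group to noncommutative series over `𝔽_p`,
`x_i ↦ 1 + X_i` (see `magnus_of`). -/
noncomputable def magnus [Fact p.Prime] : FreeProP p d →* NCSeries (ZMod p) d where
  toFun := magnusCoeff
  map_one' := by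
    ext w
    rw [magnusCoeff_eq 1 w.length 1 rfl w le_rfl]; simp
  map_mul' x y := by
    ext w
    obtain ⟨g, hg⟩ := QuotientGroup.mk_surjective (x.1 (truncIndex p d w.length))
    obtain ⟨h, hh⟩ := QuotientGroup.mk_surjective (y.1 (truncIndex p d w.length))
    rw [magnusCoeff_eq (x * y) w.length (g * h)
      (by rw [QuotientGroup.mk_mul, hg, hh]; rfl) w le_rfl, map_mul, Units.val_mul,
      mul_apply, mul_apply]
    refine sum_congr rfl fun i _ => ?_
    rw [magnusCoeff_eq x w.length g hg.symm _ (by rw [List.length_take]; omega),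
      magnusCoeff_eq y w.length h hh.symm _ (by rw [List.length_drop]; omega)]

/-- The free generators `x_1, …, x_d`. -/
def of (i : Fin d) : FreeProP p d :=
  ⟨fun _ => QuotientGroup.mk (FreeGroup.of i), fun _ _ _ => rfl⟩

theorem magnus_of [Fact p.Prime] (i : Fin d) :
    magnus (of i : FreeProP p d) = 1 + X (ZMod p) i := by
  ext w
  change magnusCoeff _ w = _
  rw [magnusCoeff_eq (of i) w.length (FreeGroup.of i) rfl w le_rfl, freeMagnus,
    FreeGroup.lift_apply_of]
  rfl

end FreeProP

/-- `G` is a pro-`p` group: a profinite group all of whose open normal subgroups have `p`-power index. -/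
structure IsProP (p : ℕ) (G : Type*) [Group G] [TopologicalSpace G] : Prop where
  isTopologicalGroup : IsTopologicalGroup G
  compactSpace : CompactSpace G
  t2Space : T2Space G
  totallyDisconnectedSpace : TotallyDisconnectedSpace G
  index_eq : ∀ N : Subgroup G, N.Normal → IsOpen (N : Set G) → ∃ k : ℕ, N.index = p ^ k

/-- The closed normal subgroup generated by `S`. -/
def closedNormalClosure {F : Type*} [Group F] [TopologicalSpace F] [IsTopologicalGroup F]
    (S : Set F) : Subgroup F :=
  (Subgroup.normalClosure S).topologicalClosure

instance {F : Type*} [Group F] [TopologicalSpace F] [IsTopologicalGroup F] (S : Set F) :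
    (closedNormalClosure S).Normal :=
  Subgroup.is_normal_topologicalClosure _

/-- `G` is finitely presented as a pro-`p` group. -/
def IsFinitelyPresentedProP (p : ℕ) (G : Type*) [Group G] [TopologicalSpace G] : Prop :=
  ∃ (n : ℕ) (π : FreeProP p n →* G) (S : Set (FreeProP p n)),
    Continuous π ∧ Function.Surjective π ∧ S.Finite ∧ π.ker = closedNormalClosure S

/-- `G` is a free pro-`p` group of finite rank. (A finitely generated pro-`p` group that is pro-`p`
free has finite rank.) -/
def IsFreeProPOfFiniteRank (p : ℕ) (G : Type*) [Group G] [TopologicalSpace G] : Prop :=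
  ∃ n : ℕ, Nonempty (FreeProP p n ≃ₜ* G)

section Cohomology

variable (p : ℕ) (G : Type*) [Group G]

/-- The inhomogeneous coboundary for trivial coefficients `𝔽_p`. -/
def coboundary (n : ℕ) :
    ((Fin n → G) → ZMod p) →ₗ[ZMod p] ((Fin (n + 1) → G) → ZMod p) where
  toFun f g := f (fun i => g i.succ) +
    ∑ j : Fin (n + 1), (-1) ^ ((j : ℕ) + 1) * f (Fin.contractNth j (· * ·) g)
  map_add' f f' := by
    ext g; simp [mul_add, sum_add_distrib, add_add_add_comm]
  map_smul' a f := by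
    ext g; simp [mul_add, mul_sum, mul_left_comm]

theorem coboundary_apply (n : ℕ) (f : (Fin n → G) → ZMod p) (g : Fin (n + 1) → G) :
    coboundary p G n f g = f (fun i => g i.succ) +
      ∑ j : Fin (n + 1), (-1) ^ ((j : ℕ) + 1) * f (Fin.contractNth j (· * ·) g) := rfl

variable [TopologicalSpace G]

/-- Continuous `n`-cochains `G^n → 𝔽_p`, where `𝔽_p` is discrete. -/
def cochains (n : ℕ) : Submodule (ZMod p) ((Fin n → G) → ZMod p) where
  carrier := {f | IsLocallyConstant f}
  add_mem' hf hg := IsLocallyConstant.add hf hg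
  zero_mem' := IsLocallyConstant.const 0
  smul_mem' a _ hf := hf.comp (a * ·)

/-- Continuous `n`-cocycles. -/
def cocycles (n : ℕ) : Submodule (ZMod p) ((Fin n → G) → ZMod p) :=
  cochains p G n ⊓ LinearMap.ker (coboundary p G n)

/-- Coboundaries of continuous cochains. -/
def coboundaries : (n : ℕ) → Submodule (ZMod p) ((Fin n → G) → ZMod p)
  | 0 => ⊥
  | n + 1 => (cochains p G n).map (coboundary p G n)

/-- The continuous cohomology group `Hⁿ(G, 𝔽_p)`. -/
abbrev Cohomology (n : ℕ) : Type _ :=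
  cocycles p G n ⧸ (coboundaries p G n).submoduleOf (cocycles p G n)

/-- The cohomological dimension: the least `n`, possibly `∞`, such that `Hⁱ(G, 𝔽_p) = 0` for all
`i > n`. -/
noncomputable def cohomologicalDimension : ℕ∞ :=
  sInf {n : ℕ∞ | ∀ i : ℕ, n < i → Subsingleton (Cohomology p G i)}

theorem coboundaries_one : coboundaries p G 1 = ⊥ := by
  rw [eq_bot_iff]
  rintro _ ⟨f, -, rfl⟩
  rw [Submodule.mem_bot]
  ext g
  rw [coboundary_apply, Fin.sum_univ_one, Subsingleton.elim (fun i : Fin 0 => g i.succ) (Fin.contractNth 0 (· * ·) g)]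
  simp

variable {p G}

theorem cocycles_one_map_mul (χ : cocycles p G 1) (a b : G) :
    χ.1 (fun _ => a * b) = χ.1 (fun _ => a) + χ.1 (fun _ => b) := by
  have h := congrFun (LinearMap.mem_ker.1 χ.2.2) ![a, b]
  rw [coboundary_apply, Fin.sum_univ_two, Pi.zero_apply] at h
  have h0 : (fun i : Fin 1 => (![a, b] : Fin 2 → G) i.succ) = fun _ => b := by
    ext i; fin_cases i; rfl
  have h1 : Fin.contractNth (0 : Fin 2) (· * ·) ![a, b] = fun _ => a * b := by
    ext i; fin_cases i; rfl
  have h2 : Fin.contractNth (1 : Fin 2) (· * ·) ![a, b] = fun _ => a := by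
    ext i; fin_cases i; rfl
  rw [h0, h1, h2] at h
  simp at h
  linear_combination -h

/-- The cup product of two continuous `1`-cocycles, `(g, h) ↦ χ(g) ψ(h)`. -/
def cupCocycle (χ ψ : cocycles p G 1) : cocycles p G 2 :=
  ⟨fun g => χ.1 (fun _ => g 0) * ψ.1 (fun _ => g 1), by
    refine ⟨?_, ?_⟩
    · have h1 : IsLocallyConstant fun g : Fin 2 → G => χ.1 (fun _ => g 0) :=
        IsLocallyConstant.comp_continuous χ.2.1 (by fun_prop)
      have h2 : IsLocallyConstant fun g : Fin 2 → G => ψ.1 (fun _ => g 1) :=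
        IsLocallyConstant.comp_continuous ψ.2.1 (by fun_prop)
      exact IsLocallyConstant.mul h1 h2
    · refine LinearMap.mem_ker.2 (funext fun g => ?_)
      rw [coboundary_apply, Fin.sum_univ_three, Pi.zero_apply]
      have e1 : Fin.contractNth (0 : Fin 3) (· * ·) g = ![g 0 * g 1, g 2] := by
        ext i; fin_cases i <;> rfl
      have e2 : Fin.contractNth (1 : Fin 3) (· * ·) g = ![g 0, g 1 * g 2] := by
        ext i; fin_cases i <;> rfl
      have e3 : Fin.contractNth (2 : Fin 3) (· * ·) g = ![g 0, g 1] := by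
        ext i; fin_cases i <;> rfl
      rw [e1, e2, e3]
      have f1 : (0 : Fin 2).succ = (1 : Fin 3) := rfl
      have f2 : (1 : Fin 2).succ = (2 : Fin 3) := rfl
      simp only [f1, f2, Matrix.cons_val_zero, Matrix.cons_val_one, cocycles_one_map_mul]
      simp
      ring⟩

/-- The cup product on cocycles with values in `H²`. -/
def cupAux : cocycles p G 1 →ₗ[ZMod p] cocycles p G 1 →ₗ[ZMod p] Cohomology p G 2 :=
  LinearMap.compr₂
    (LinearMap.mk₂ (ZMod p) cupCocycle
      (fun _ _ _ => Subtype.ext (funext fun _ => add_mul _ _ _))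
      (fun _ _ _ => Subtype.ext (funext fun _ => mul_assoc _ _ _))
      (fun _ _ _ => Subtype.ext (funext fun _ => mul_add _ _ _))
      (fun _ _ _ => Subtype.ext (funext fun _ => mul_left_comm _ _ _)))
    (Submodule.mkQ _)

theorem coboundaries_one_le_ker {M : Type*} [AddCommGroup M] [Module (ZMod p) M]
    (f : cocycles p G 1 →ₗ[ZMod p] M) :
    (coboundaries p G 1).submoduleOf (cocycles p G 1) ≤ LinearMap.ker f := by
  intro x hx
  have h : x = 0 := by
    have hx' : x.1 ∈ coboundaries p G 1 := hx
    rw [coboundaries_one, Submodule.mem_bot] at hx'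
    exact Subtype.ext hx'
  rw [h]
  exact Submodule.zero_mem _

/-- The cup product, second argument in `H¹`. -/
def cupSnd : cocycles p G 1 →ₗ[ZMod p] Cohomology p G 1 →ₗ[ZMod p] Cohomology p G 2 :=
  LinearMap.flip (Submodule.liftQ ((coboundaries p G 1).submoduleOf (cocycles p G 1))
    (LinearMap.flip (cupAux (p := p) (G := G))) (coboundaries_one_le_ker _))

variable (p G)

/-- The cup product `H¹ × H¹ → H²`. -/
def cup : Cohomology p G 1 →ₗ[ZMod p] Cohomology p G 1 →ₗ[ZMod p] Cohomology p G 2 :=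
  Submodule.liftQ ((coboundaries p G 1).submoduleOf (cocycles p G 1)) cupSnd
    (coboundaries_one_le_ker _)

theorem cup_mk (χ ψ : cocycles p G 1) :
    cup p G (Submodule.Quotient.mk χ) (Submodule.Quotient.mk ψ) =
      Submodule.Quotient.mk (cupCocycle χ ψ) := rfl

end Cohomology

section GroupAlgebra

variable (p : ℕ) (G : Type*) [Group G] [TopologicalSpace G]

/-- The completed group algebra `𝔽_p⟦G⟧`, the inverse limit of the group algebras `𝔽_p[G/N]` over
the open normal subgroups `N`. -/
def CompletedGroupAlgebra : Subalgebra (ZMod p)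
    ((N : OpenNormalSubgroup G) → MonoidAlgebra (ZMod p) (G ⧸ N.toSubgroup)) where
  carrier := {f | ∀ (N M : OpenNormalSubgroup G) (h : N.toSubgroup ≤ M.toSubgroup),
    MonoidAlgebra.mapDomainAlgHom (ZMod p) (ZMod p)
      (QuotientGroup.map N.toSubgroup M.toSubgroup (MonoidHom.id G) h) (f N) = f M}
  mul_mem' hf hg N M h := by rw [Pi.mul_apply, map_mul, hf N M h, hg N M h, Pi.mul_apply]
  add_mem' hf hg N M h := by rw [Pi.add_apply, map_add, hf N M h, hg N M h, Pi.add_apply]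
  algebraMap_mem' a N M h := by rw [Pi.algebraMap_apply, AlgHom.commutes, Pi.algebraMap_apply]

/-- The augmentation ideal of `𝔽_p⟦G⟧`: the elements with augmentation zero. (By compatibility the
augmentation can be computed at any `N`.) -/
noncomputable def augmentationIdeal : Ideal (CompletedGroupAlgebra p G) :=
  ⨅ N : OpenNormalSubgroup G, RingHom.ker
    ((MonoidAlgebra.lift (ZMod p) (ZMod p) (G ⧸ N.toSubgroup) 1).toRingHom.comp
      ((Pi.evalRingHom _ N).comp (CompletedGroupAlgebra p G).val.toRingHom))

/-- The filtration of `𝔽_p⟦G⟧` by the powers of the augmentation ideal. -/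
noncomputable def augmentationFiltration (n : ℕ) : Submodule (ZMod p) (CompletedGroupAlgebra p G) :=
  (augmentationIdeal p G ^ n).restrictScalars (ZMod p)

/-- The `n`-th piece of the associated graded algebra of `𝔽_p⟦G⟧`. -/
abbrev GradedPiece (n : ℕ) : Type _ :=
  augmentationFiltration p G n ⧸
    (augmentationFiltration p G (n + 1)).submoduleOf (augmentationFiltration p G n)

/-- The Poincaré series `∑ dim(gr_n) tⁿ` of `𝔽_p⟦G⟧`. -/
noncomputable def poincareSeries : PowerSeries ℚ :=
  PowerSeries.mk fun n => (Module.finrank (ZMod p) (GradedPiece p G n) : ℚ)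

end GroupAlgebra

section Words

variable {d : ℕ}

/-- The order on monomials: `u < v` if `u` has larger degree than `v`, or both have the same degree
and `u` precedes `v` lexicographically, with `X_1 < ⋯ < X_d`. -/
def WordLT (u v : List (Fin d)) : Prop :=
  v.length < u.length ∨ (u.length = v.length ∧ List.Lex (· < ·) u v)

/-- `w` is the highest term of the series `Z`. -/
def IsHighestTerm {R : Type*} [CommRing R] (Z : NCSeries R d) (w : List (Fin d)) : Prop :=
  Z w ≠ 0 ∧ ∀ v, Z v ≠ 0 → v ≠ w → WordLT v w

/-- `w` is the highest term of the element `x` of the free pro-`p` group, i.e. the highest term of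
the series `φ(x) - 1`, with `φ` the Magnus homomorphism. -/
def HasHighestTerm {p : ℕ} [Fact p.Prime] (x : FreeProP p d) (w : List (Fin d)) : Prop :=
  IsHighestTerm (FreeProP.magnus x - 1) w

/-- A family of monomials is combinatorially free if no member is a submonomial of another one and
no proper nonempty prefix of a member is a proper suffix of a member (the same one or another). -/
structure CombinatoriallyFree {ι : Type*} (m : ι → List (Fin d)) : Prop where
  not_infix : ∀ i j, i ≠ j → ¬ m i <:+: m j
  no_overlap : ∀ i j, ∀ a b a' b' : List (Fin d), a ≠ [] → b ≠ [] → a' ≠ [] → b' ≠ [] →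
    m i = a ++ b → m j = a' ++ b' → a ≠ b'

/-- The monomial `X_{j₀} X_{i₀}^n X_1`. -/
def extraTerm (i₀ j₀ : Fin d) (n : ℕ) : List (Fin d) :=
  j₀ :: (List.replicate n i₀ ++ [⟨0, j₀.pos⟩])

/-- The family of the monomials `X_{t(i)} X_{s(i)}`, `1 ≤ i ≤ r`, and `X_{j₀} X_{i₀}^n X_1`,
`n ≥ 1`. -/
def termFamily {r : ℕ} (s t : Fin r → Fin d) (i₀ j₀ : Fin d) : Fin r ⊕ ℕ+ → List (Fin d) :=
  Sum.elim (fun i => [t i, s i]) (fun n => extraTerm i₀ j₀ n)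

end Words

/-- `π` and `ρ` present `G` as the quotient of the free pro-`p` group on `d` generators by the
relations `ρ_1, …, ρ_r`, and the highest term of `ρ_i` is `X_{t(i)} X_{s(i)}` with
`s(i) ≤ c < t(i)` (letters are counted from `0` in the code) and pairwise distinct
`(s(i), t(i))`. -/
structure IsForrePresentation {p : ℕ} [Fact p.Prime] {G : Type*} [Group G] [TopologicalSpace G]
    {d r : ℕ} (c : ℕ) (π : FreeProP p d →* G) (ρ : Fin r → FreeProP p d)
    (s t : Fin r → Fin d) : Prop where
  continuous : Continuous π
  surjective : Function.Surjective π
  ker_eq : π.ker = closedNormalClosure (Set.range ρ)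
  highestTerm : ∀ i, HasHighestTerm (ρ i) [t i, s i]
  s_lt : ∀ i, (s i : ℕ) < c
  le_t : ∀ i, c ≤ (t i : ℕ)
  injective : Function.Injective fun i => (s i, t i)

/-- The group `Γ = F / ⟨ρ_1, …, ρ_r, x_n, n ≥ 1⟩^Nor`. -/
abbrev CutQuotient {p d r : ℕ} (ρ : Fin r → FreeProP p d) (x : ℕ+ → FreeProP p d) : Type :=
  FreeProP p d ⧸ closedNormalClosure (Set.range ρ ∪ Set.range x)

end ProP

/-! The argument is carried out on the dual side. A locally constant function on the free pro-`p`
group F is the same as a smooth functional on 𝔽_p⟨⟨X⟩⟩, i.e. one that kills all series of high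
order, restricted along the Magnus map φ (`smoothDual_eq_zero`, `exists_smoothDual`). If Γ = F/R
with R generated by relations ρ_k, the space C(Γ) of locally constant functions becomes the space
`relDual ρ` of smooth functionals killing the two-sided ideal generated by the series Z_k = φ(ρ_k) -
1.

The combinatorial heart is `CombinatoriallyFree.exists_extension`, a dual form of the diamond lemma.
If the highest terms m_k of the Z_k are combinatorially free, one may prescribe the values of a
functional on normal words (those without a factor m_k) and on all products x Z_k y, subject only to
the evident compatibility for two disjoint relations in a word. A word x m_k y is rewritten through
smaller words, and since occurrences never overlap, no other ambiguity arises. This has three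
consequences.

Vanishing: Fox derivatives define a complex 0 → 𝔽_p → C(Γ) → C(Γ)^d → C(Γ)^(K) → 0 of Γ-modules.
Exactness is formal except for surjectivity at the end, which is the extension lemma
(`resolutionTwo_surjective`). The terms after 𝔽_p are acyclic, so cohomology vanishes above degree 2
(`IsPresentation.cohomologyVanishes`).

Infinite H²: functionals with l(f Z_j g) = δ_jk f(1) g(1), where (1) denotes the constant term,
restrict to functions on F that are additive along R and separate the relations. They transgress to
independent classes (`exists_primitive`, `not_finite_cohomology_two`).

Poincaré series: functionals killing the relations take arbitrary values on normal words, so the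
normal words of length n give a basis of I^n/I^(n+1). A letter followed by a normal word is either
normal or begins with exactly one m_k, which yields the recursion behind the formula.

For the existence of a Forré presentation, take generators dual to a basis of H¹ adapted to V ⊕ U.
Minus the coefficient of X_i X_j then transgresses to χ_i ∪ χ_j. Among the products of U with V a
basis of H² is chosen greedily from the top of the lexicographic order, and kernel elements dual to
it have the chosen pairs as highest terms; U ∪ U = 0 disposes of words in two U-letters. Finally,
the bound on r leaves a pair (i₀, j₀) unused, and iterated commutators of x_{j₀} with x_{i₀}, then
with x_1, supply the y_n. -/

namespace ProP

open Finset

namespace NCSeries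

/-! ### Noncommutative series: monomials, Fox derivatives and the order filtration. -/

section Algebra

variable {R : Type*} [CommRing R] {d : ℕ}

instance : Module R (NCSeries R d) := inferInstanceAs (Module R (List (Fin d) → R))

theorem smul_apply (c : R) (f : NCSeries R d) (w : List (Fin d)) : (c • f) w = c * f w := rfl

theorem sum_apply {ι : Type*} (s : Finset ι) (f : ι → NCSeries R d) (w : List (Fin d)) :
    (∑ i ∈ s, f i) w = ∑ i ∈ s, f i w :=
  Finset.sum_apply (M := fun _ : List (Fin d) => R) w s f

instance : Algebra R (NCSeries R d) :=
  Algebra.ofModule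
    (fun c f g => by ext w; simp [mul_apply, smul_apply, mul_sum, mul_assoc])
    (fun c f g => by ext w; simp [mul_apply, smul_apply, mul_sum, mul_left_comm])

/-- The monomial attached to a word. -/
def mono (R : Type*) [CommRing R] {d : ℕ} (w : List (Fin d)) : NCSeries R d :=
  fun v => if v = w then 1 else 0

theorem mono_apply (w v : List (Fin d)) : mono R w v = if v = w then 1 else 0 := rfl

theorem mono_nil : mono R ([] : List (Fin d)) = 1 := rfl

theorem X_mul_nil (a : Fin d) (f : NCSeries R d) : (X R a * f) [] = 0 := by
  simp [mul_nil, X_apply]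

theorem X_mul_cons (a b : Fin d) (f : NCSeries R d) (w : List (Fin d)) :
    (X R a * f) (b :: w) = if b = a then f w else 0 := by
  have : shift b (X R a) = if b = a then 1 else 0 := by
    ext v
    split_ifs with h <;> simp [shift_apply, one_apply, zero_apply, X_apply, h]
  rw [mul_cons, this, X_apply, if_neg (by simp), zero_mul, zero_add]
  split_ifs <;> simp [zero_apply]

theorem mono_cons (a : Fin d) (w : List (Fin d)) : mono R (a :: w) = X R a * mono R w := by
  ext v
  cases v with
  | nil => simp [X_mul_nil, mono_apply]
  | cons b v =>
    rw [X_mul_cons, mono_apply, mono_apply]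
    by_cases h : b = a <;> simp [h]

theorem mono_append (u w : List (Fin d)) : mono R (u ++ w) = mono R u * mono R w := by
  induction u with
  | nil => simp [mono_nil]
  | cons a u ih => rw [List.cons_append, mono_cons, ih, mono_cons, mul_assoc]

/-- Removal of an initial letter, as a linear map. -/
def shiftₗ (R : Type*) [CommRing R] {d : ℕ} (a : Fin d) : NCSeries R d →ₗ[R] NCSeries R d where
  toFun := shift a
  map_add' _ _ := rfl
  map_smul' _ _ := rfl

@[simp]
theorem shiftₗ_apply (a : Fin d) (f : NCSeries R d) : shiftₗ R a f = shift a f := rfl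

/-- Removal of an initial letter is the Fox derivative on series, and this is its product rule, with
the constant term `f []` acting on the derivative of `g`. -/
theorem shift_mul (a : Fin d) (f g : NCSeries R d) :
    shift a (f * g) = f [] • shift a g + shift a f * g := by
  ext v
  rw [shift_apply, mul_cons]
  rfl

theorem shift_X_mul (a b : Fin d) (f : NCSeries R d) :
    shift b (X R a * f) = if b = a then f else 0 := by
  ext v
  rw [shift_apply, X_mul_cons]
  split_ifs <;> rfl

theorem eq_const_add_sum_shift (f : NCSeries R d) :
    f = f [] • 1 + ∑ a, X R a * shift a f := by
  ext w
  rw [add_apply, sum_apply, smul_apply]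
  cases w with
  | nil => simp [X_mul_nil, one_apply]
  | cons b w => simp [X_mul_cons, one_apply, shift_apply]

theorem sum_X_mul_shift {f : NCSeries R d} (hf : f [] = 0) :
    ∑ a, X R a * shift a f = f := by
  conv_rhs => rw [eq_const_add_sum_shift f, hf, zero_smul, zero_add]

/-- The series of order at least `n`. -/
def order (R : Type*) [CommRing R] (d n : ℕ) : Submodule R (NCSeries R d) where
  carrier := {f | ∀ w, w.length < n → f w = 0}
  add_mem' hf hg w hw := by rw [add_apply, hf w hw, hg w hw, add_zero]
  zero_mem' _ _ := rfl
  smul_mem' c f hf w hw := by rw [smul_apply, hf w hw, mul_zero]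

theorem order_anti {m n : ℕ} (h : m ≤ n) : order R d n ≤ order R d m :=
  fun _ hf w hw => hf w (hw.trans_le h)

theorem mem_order_zero (f : NCSeries R d) : f ∈ order R d 0 := fun _ hw => by omega

theorem mem_order_one {f : NCSeries R d} : f ∈ order R d 1 ↔ f [] = 0 := by
  refine ⟨fun h => h [] (by simp), fun h w hw => ?_⟩
  rw [List.length_eq_zero_iff.1 (by omega : w.length = 0), h]

theorem mul_mem_order {m n : ℕ} {f g : NCSeries R d} (hf : f ∈ order R d m)
    (hg : g ∈ order R d n) : f * g ∈ order R d (m + n) := by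
  intro w hw
  rw [mul_apply]
  refine sum_eq_zero fun i hi => ?_
  rw [mem_range] at hi
  by_cases h : i < m
  · rw [hf _ (by rw [List.length_take]; omega), zero_mul]
  · rw [hg _ (by rw [List.length_drop]; omega), mul_zero]

theorem mul_mem_order_left {n : ℕ} {f : NCSeries R d} (hf : f ∈ order R d n)
    (g : NCSeries R d) : f * g ∈ order R d n :=
  mul_mem_order hf (mem_order_zero g)

theorem mul_mem_order_right {n : ℕ} (f : NCSeries R d) {g : NCSeries R d}
    (hg : g ∈ order R d n) : f * g ∈ order R d n := by
  simpa using mul_mem_order (mem_order_zero f) hg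

theorem mono_mem_order (w : List (Fin d)) : mono R w ∈ order R d w.length := by
  intro v hv
  rw [mono_apply, if_neg]
  rintro rfl
  omega

theorem shift_mem_order {n : ℕ} {f : NCSeries R d} (a : Fin d) (hf : f ∈ order R d (n + 1)) :
    shift a f ∈ order R d n := fun w hw => hf (a :: w) (by simpa using hw)

/-- The words of length less than `n`. -/
noncomputable def words (d n : ℕ) : Finset (List (Fin d)) :=
  (List.finite_length_lt (Fin d) n).toFinset

@[simp]
theorem mem_words {n : ℕ} {w : List (Fin d)} : w ∈ words d n ↔ w.length < n := by
  simp [words]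

/-- Because the alphabet is finite, a series is a finite combination of monomials up to high order.
This reduces questions about smooth functionals to monomials. -/
theorem sub_sum_mono_mem_order (n : ℕ) (f : NCSeries R d) :
    f - ∑ w ∈ words d n, f w • mono R w ∈ order R d n := by
  intro v hv
  rw [sub_apply, sum_apply, sum_eq_single v]
  · simp [smul_apply, mono_apply]
  · intro w _ hw
    simp [smul_apply, mono_apply, hw.symm]
  · simp [hv]

/-- Finite sums of words: the pairing of a series with a function on words, truncated at `n`. -/
noncomputable def pairing (n : ℕ) (ψ : List (Fin d) → R) : NCSeries R d →ₗ[R] R where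
  toFun f := ∑ w ∈ words d n, f w * ψ w
  map_add' f g := by simp [add_apply, add_mul, sum_add_distrib]
  map_smul' c f := by simp [smul_apply, mul_sum, mul_assoc]

theorem pairing_apply (n : ℕ) (ψ : List (Fin d) → R) (f : NCSeries R d) :
    pairing n ψ f = ∑ w ∈ words d n, f w * ψ w := rfl

theorem pairing_mono {n : ℕ} {ψ : List (Fin d) → R} (hψ : ∀ w, n ≤ w.length → ψ w = 0)
    (w : List (Fin d)) : pairing n ψ (mono R w) = ψ w := by
  rw [pairing_apply]
  by_cases h : w.length < n
  · rw [sum_eq_single w]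
    · simp [mono_apply]
    · intro v _ hv
      simp [mono_apply, hv]
    · simp [h]
  · rw [hψ w (by omega)]
    refine sum_eq_zero fun v hv => ?_
    rw [mono_apply, if_neg, zero_mul]
    rintro rfl
    exact h (by simpa using hv)

end Algebra

/-! ### Smooth functionals on series. -/

section Functionals

variable {R : Type*} [CommRing R] {d : ℕ}

/-- The linear functionals on noncommutative series that vanish on all series of sufficiently high
order. -/
def smoothDual (R : Type*) [CommRing R] (d : ℕ) : Submodule R (NCSeries R d →ₗ[R] R) where
  carrier := {l | ∃ n, ∀ f ∈ order R d n, l f = 0}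
  add_mem' := by
    rintro l l' ⟨n, h⟩ ⟨n', h'⟩
    refine ⟨max n n', fun f hf => ?_⟩
    rw [LinearMap.add_apply, h f (order_anti (le_max_left _ _) hf),
      h' f (order_anti (le_max_right _ _) hf), add_zero]
  zero_mem' := ⟨0, fun _ _ => rfl⟩
  smul_mem' := by
    rintro c l ⟨n, h⟩
    exact ⟨n, fun f hf => by rw [LinearMap.smul_apply, h f hf, smul_zero]⟩

theorem pairing_mem_smoothDual (n : ℕ) (ψ : List (Fin d) → R) :
    pairing n ψ ∈ smoothDual R d :=
  ⟨n, fun f hf => sum_eq_zero fun w hw => by rw [hf w (by simpa using hw), zero_mul]⟩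

theorem apply_eq_sum {l : NCSeries R d →ₗ[R] R} {n : ℕ} (h : ∀ f ∈ order R d n, l f = 0)
    (f : NCSeries R d) : l f = ∑ w ∈ words d n, f w * l (mono R w) := by
  have := h _ (sub_sum_mono_mem_order n f)
  rw [map_sub, sub_eq_zero, map_sum] at this
  simpa using this

/-- A smooth functional is determined by its values on monomials. -/
theorem smoothDual_ext {l l' : NCSeries R d →ₗ[R] R} (hl : l ∈ smoothDual R d)
    (hl' : l' ∈ smoothDual R d) (h : ∀ w, l (mono R w) = l' (mono R w)) : l = l' := by
  obtain ⟨n, hn⟩ := (smoothDual R d).sub_mem hl hl'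
  refine LinearMap.ext fun f => sub_eq_zero.1 ?_
  rw [← LinearMap.sub_apply, apply_eq_sum hn]
  exact sum_eq_zero fun w _ => by rw [LinearMap.sub_apply, h, sub_self, mul_zero]

theorem comp_mulLeft_mem {l : NCSeries R d →ₗ[R] R} (hl : l ∈ smoothDual R d)
    (f : NCSeries R d) : l ∘ₗ LinearMap.mulLeft R f ∈ smoothDual R d := by
  obtain ⟨n, hn⟩ := hl
  exact ⟨n, fun g hg => hn _ (mul_mem_order_right f hg)⟩

theorem comp_mulRight_mem {l : NCSeries R d →ₗ[R] R} (hl : l ∈ smoothDual R d)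
    (f : NCSeries R d) : l ∘ₗ LinearMap.mulRight R f ∈ smoothDual R d := by
  obtain ⟨n, hn⟩ := hl
  exact ⟨n, fun g hg => hn _ (mul_mem_order_left hg f)⟩

theorem comp_shift_mem {l : NCSeries R d →ₗ[R] R} (hl : l ∈ smoothDual R d)
    (a : Fin d) : l ∘ₗ shiftₗ R a ∈ smoothDual R d := by
  obtain ⟨n, hn⟩ := hl
  exact ⟨n + 1, fun g hg => hn _ (shift_mem_order a hg)⟩

/-- The constant coefficient, as a linear functional. -/
def constCoeffₗ (R : Type*) [CommRing R] (d : ℕ) : NCSeries R d →ₗ[R] R where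
  toFun f := f []
  map_add' _ _ := rfl
  map_smul' _ _ := rfl

@[simp]
theorem constCoeffₗ_apply (f : NCSeries R d) : constCoeffₗ R d f = f [] := rfl

theorem constCoeffₗ_mem : constCoeffₗ R d ∈ smoothDual R d :=
  ⟨1, fun _ hf => mem_order_one.1 hf⟩

/-- The value of a smooth functional on `x f y` with monomials `x`, `y`, as a sum over words. -/
theorem apply_mono_mul_mul_mono {l : NCSeries R d →ₗ[R] R} {n : ℕ}
    (h : ∀ f ∈ order R d n, l f = 0) (f : NCSeries R d) (x y : List (Fin d)) :
    l (mono R x * f * mono R y) = ∑ v ∈ words d n, f v * l (mono R (x ++ v ++ y)) := by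
  have := apply_eq_sum (l := l ∘ₗ LinearMap.mulRight R (mono R y) ∘ₗ LinearMap.mulLeft R (mono R x))
    (fun g hg => h _ (mul_mem_order_left (mul_mem_order_right _ hg) _)) f
  simpa [mono_append, mul_assoc] using this

end Functionals

end NCSeries

end ProP

namespace ProP

open Finset NCSeries

/-! ### The monomial order. -/

section WordOrder

variable {d : ℕ}

theorem lex_irrefl (u : List (Fin d)) : ¬ List.Lex (· < ·) u u :=
  (List.lex_lt (α := Fin d) (l₁ := u) (l₂ := u)).not.2 (lt_irrefl u)

theorem WordLT.irrefl (u : List (Fin d)) : ¬ WordLT u u := by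
  rintro (h | ⟨-, h⟩)
  · exact lt_irrefl _ h
  · exact lex_irrefl u h

theorem WordLT.trans {u v w : List (Fin d)} (h : WordLT u v) (h' : WordLT v w) : WordLT u w := by
  rcases h with h | ⟨h, hl⟩ <;> rcases h' with h' | ⟨h', hl'⟩
  · exact Or.inl (h'.trans h)
  · exact Or.inl (h' ▸ h)
  · exact Or.inl (h ▸ h')
  · refine Or.inr ⟨h.trans h', ?_⟩
    rw [List.lex_lt] at *
    exact hl.trans hl'

theorem WordLT.length_le {u v : List (Fin d)} (h : WordLT u v) : v.length ≤ u.length := by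
  rcases h with h | ⟨h, -⟩ <;> omega

theorem lex_append_right {u v : List (Fin d)} (y : List (Fin d)) (hl : u.length = v.length)
    (h : List.Lex (· < ·) u v) : List.Lex (· < ·) (u ++ y) (v ++ y) := by
  induction h with
  | nil => simp at hl
  | cons _ ih => exact List.Lex.cons (ih (by simpa using hl))
  | rel h => exact List.Lex.rel h

theorem WordLT.append (x y : List (Fin d)) {u v : List (Fin d)} (h : WordLT u v) :
    WordLT (x ++ u ++ y) (x ++ v ++ y) := by
  rcases h with h | ⟨h, hl⟩
  · exact Or.inl (by simp; omega)
  · refine Or.inr ⟨by simp [h], ?_⟩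
    rw [List.append_assoc, List.append_assoc]
    exact List.Lex.append_left _ (lex_append_right y h hl) x

/-- The order on monomials, restricted to words of length less than `n`, is well-founded. -/
theorem wordLT_wellFounded (n : ℕ) :
    WellFounded fun u v : {w : List (Fin d) // w.length < n} => WordLT u.1 v.1 := by
  -- The length bound is essential: longer words are smaller, so the order on all words has infinite
  -- descending chains.
  have : Finite {w : List (Fin d) // w.length < n} := (List.finite_length_lt (Fin d) n).to_subtype
  have : IsTrans {w : List (Fin d) // w.length < n} fun u v => WordLT u.1 v.1 :=
    ⟨fun _ _ _ h h' => h.trans h'⟩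
  have : Std.Irrefl fun u v : {w : List (Fin d) // w.length < n} => WordLT u.1 v.1 :=
    ⟨fun u => WordLT.irrefl u.1⟩
  exact Finite.wellFounded_of_trans_of_irrefl _

end WordOrder

/-! ### Combinatorially free families and the extension lemma. -/

section StrongFreeness

variable {d : ℕ} {K : Type*}

/-- A word is normal for a family of words if it has no factor in the family. -/
def IsNormalWord (m : K → List (Fin d)) (w : List (Fin d)) : Prop :=
  ∀ k x y, w ≠ x ++ m k ++ y

/-- Let `u` be the displacement between the two starting points. If `u` covers all of `m k`, the
occurrences are disjoint. Otherwise `m k = u ++ s`. If `s` begins with `m l`, the latter is a factor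
of `m k`, so the indices agree and lengths force `u = []`. If `s` is a prefix of `m l`, then it is
empty (disjoint with no gap), or `u` is empty (again a factor), or `s` is a forbidden overlap. -/
theorem CombinatoriallyFree.occurrence_aux {m : K → List (Fin d)} (hm : CombinatoriallyFree m)
    {k l : K} {x y x' y' : List (Fin d)} (h : x ++ m k ++ y = x' ++ m l ++ y')
    (hlen : x.length ≤ x'.length) :
    (k = l ∧ x = x' ∧ y = y') ∨ ∃ z, x' = x ++ m k ++ z ∧ y = z ++ m l ++ y' := by
  have hinf : ∀ {i j}, m i <:+: m j → i = j := fun {i j} hij => by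
    by_contra hne
    exact hm.not_infix i j hne hij
  rw [List.append_assoc, List.append_assoc, List.append_eq_append_iff] at h
  obtain ⟨u, hu, h'⟩ : ∃ u, x' = x ++ u ∧ m k ++ y = u ++ (m l ++ y') := by
    rcases h with ⟨u, hu, h⟩ | ⟨u, hu, h⟩
    · exact ⟨u, hu, h⟩
    · have : u = [] := List.length_eq_zero_iff.1 (by rw [hu, List.length_append] at hlen; omega)
      subst this
      exact ⟨[], by simpa using hu.symm, by simpa using h.symm⟩
  subst hu
  rw [List.append_eq_append_iff] at h'
  rcases h' with ⟨z, hz, h⟩ | ⟨s, hs, h⟩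
  · exact Or.inr ⟨z, by rw [hz, List.append_assoc], by rw [h, List.append_assoc]⟩
  · rw [List.append_eq_append_iff] at h
    have same : ∀ t : List (Fin d), s = m l ++ t → m l ++ y' = s ++ y →
        (k = l ∧ x = x ++ u ∧ y = y') := by
      intro t ht hy
      have hkl : l = k := hinf ⟨u, t, by rw [hs, ht, List.append_assoc]⟩
      subst hkl
      have hl := congrArg List.length hs
      have hl' := congrArg List.length ht
      rw [List.length_append] at hl hl'
      have hu0 : u = [] := List.length_eq_zero_iff.1 (by omega)
      have ht0 : t = [] := List.length_eq_zero_iff.1 (by omega)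
      subst hu0 ht0
      rw [ht, List.append_nil, List.append_cancel_left_eq] at hy
      exact ⟨rfl, by simp, hy.symm⟩
    rcases h with ⟨t, ht, hy⟩ | ⟨t, ht, hy⟩
    · exact Or.inl (same t ht (by rw [ht, List.append_assoc, hy]))
    · by_cases ht0 : t = []
      · subst ht0
        exact Or.inl (same [] (by simpa using ht.symm) (by rw [ht, List.append_nil]; simp [hy]))
      by_cases hs0 : s = []
      · subst hs0
        right
        refine ⟨[], ?_, ?_⟩
        · rw [hs]; simp
        · rw [hy, ht]; simp
      by_cases hu0 : u = []
      · subst hu0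
        have hkl : k = l := hinf ⟨[], t, by rw [hs, ht]; simp⟩
        subst hkl
        have hl := congrArg List.length (hs.symm.trans ht)
        simp at hl
        exact absurd hl ht0
      exact absurd rfl (hm.no_overlap l k s t u s hs0 ht0 hu0 hs0 ht hs)

/-- Two occurrences of members of a combinatorially free family in a word are equal or disjoint. -/
theorem CombinatoriallyFree.occurrence {m : K → List (Fin d)} (hm : CombinatoriallyFree m)
    {k l : K} {x y x' y' : List (Fin d)} (h : x ++ m k ++ y = x' ++ m l ++ y') :
    (k = l ∧ x = x' ∧ y = y') ∨ (∃ z, x' = x ++ m k ++ z ∧ y = z ++ m l ++ y') ∨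
      ∃ z, x = x' ++ m l ++ z ∧ y' = z ++ m k ++ y := by
  rcases le_total x.length x'.length with hl | hl
  · rcases hm.occurrence_aux h hl with h | h
    exacts [Or.inl h, Or.inr (Or.inl h)]
  · rcases hm.occurrence_aux h.symm hl with ⟨h, h', h''⟩ | h
    exacts [Or.inl ⟨h.symm, h'.symm, h''.symm⟩, Or.inr (Or.inr h)]

variable {R : Type*} [Field R]

theorem IsHighestTerm.wordLT_append {Z : NCSeries R d} {w v : List (Fin d)}
    (h : IsHighestTerm Z w) (hv : Z v ≠ 0) (hvw : v ≠ w) (x y : List (Fin d)) :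
    WordLT (x ++ v ++ y) (x ++ w ++ y) :=
  (h.2 v hv hvw).append x y

/-- Series whose highest terms are combinatorially free impose independent conditions: there is a
function on words of length less than `n` with prescribed values on normal words and with
prescribed (compatible) pairings with the series `x · Z k · y`. -/
theorem CombinatoriallyFree.exists_extension {m : K → List (Fin d)} (hm : CombinatoriallyFree m)
    {Z : K → NCSeries R d} (hZ : ∀ k, IsHighestTerm (Z k) (m k)) (n : ℕ)
    (E : K → List (Fin d) → List (Fin d) → R)
    (hE : ∀ k x y, n ≤ (x ++ m k ++ y).length → E k x y = 0)
    (hcompat : ∀ k l x y z, ∑ v ∈ words d n, Z l v * E k x (z ++ v ++ y) =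
      ∑ v ∈ words d n, Z k v * E l (x ++ v ++ z) y)
    (β : List (Fin d) → R) :
    ∃ ψ : List (Fin d) → R, (∀ w, n ≤ w.length → ψ w = 0) ∧
      (∀ w, w.length < n → IsNormalWord m w → ψ w = β w) ∧
      ∀ k x y, ∑ v ∈ words d n, Z k v * ψ (x ++ v ++ y) = E k x y := by
  classical
  let occ (w : List (Fin d)) (o : K × List (Fin d) × List (Fin d)) : Prop :=
    w = o.2.1 ++ m o.1 ++ o.2.2
  -- Recursion along the monomial order: a word containing some `x ++ m k ++ y` receives the value
  -- forced by the condition at one chosen occurrence, which involves only smaller words; a normal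
  -- word receives `β`. The guard `hv` fails only for terms that vanish anyway, because the
  -- coefficient is zero or the word is too long.
  let step (w : {w : List (Fin d) // w.length < n})
      (rec : (v : {w : List (Fin d) // w.length < n}) → WordLT v.1 w.1 → R) : R :=
    if h : ∃ o, occ w.1 o then
      (Z h.choose.1 (m h.choose.1))⁻¹ * (E h.choose.1 h.choose.2.1 h.choose.2.2 -
        ∑ v ∈ (words d n).erase (m h.choose.1), Z h.choose.1 v *
          if hv : (h.choose.2.1 ++ v ++ h.choose.2.2).length < n ∧
            WordLT (h.choose.2.1 ++ v ++ h.choose.2.2) w.1 then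
              rec ⟨h.choose.2.1 ++ v ++ h.choose.2.2, hv.1⟩ hv.2 else 0)
    else β w.1
  let ψ₀ : {w : List (Fin d) // w.length < n} → R := (wordLT_wellFounded n).fix step
  have hψ₀ : ∀ w, ψ₀ w = step w fun v _ => ψ₀ v := fun w => (wordLT_wellFounded n).fix_eq step w
  let ψ : List (Fin d) → R := fun w => if h : w.length < n then ψ₀ ⟨w, h⟩ else 0
  have hψbig : ∀ w, n ≤ w.length → ψ w = 0 := fun w hw => dif_neg (by omega)
  -- the defining equation of `ψ` at the chosen occurrence
  have hchosen : ∀ w : List (Fin d), w.length < n → (∃ o, occ w o) →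
      ∃ o, occ w o ∧ Z o.1 (m o.1) * ψ w = E o.1 o.2.1 o.2.2 -
        ∑ v ∈ (words d n).erase (m o.1), Z o.1 v * ψ (o.2.1 ++ v ++ o.2.2) := by
    intro w hw h
    refine ⟨h.choose, h.choose_spec, ?_⟩
    have h1 : ψ w = ψ₀ ⟨w, hw⟩ := dif_pos hw
    have hspec : w = _ := h.choose_spec
    rw [h1, hψ₀]
    simp only [step, dif_pos h]
    rw [mul_inv_cancel_left₀ (hZ _).1]
    congr 1
    refine sum_congr rfl fun v hv => ?_
    by_cases hz : Z h.choose.1 v = 0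
    · rw [hz, zero_mul, zero_mul]
    congr 1
    have hlt : WordLT (h.choose.2.1 ++ v ++ h.choose.2.2) w := by
      conv_rhs => rw [hspec]
      exact (hZ _).wordLT_append hz (mem_erase.1 hv).1 _ _
    by_cases hl : (h.choose.2.1 ++ v ++ h.choose.2.2).length < n
    · rw [dif_pos ⟨hl, hlt⟩]
      simp only [ψ, dif_pos hl]
    · rw [dif_neg (fun hh => hl hh.1), hψbig _ (by omega)]
  -- long words contribute nothing
  have hlong : ∀ k x y, n ≤ (x ++ m k ++ y).length →
      ∑ v ∈ words d n, Z k v * ψ (x ++ v ++ y) = E k x y := by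
    intro k x y hl
    rw [hE k x y hl]
    refine sum_eq_zero fun v _ => ?_
    by_cases hz : Z k v = 0
    · rw [hz, zero_mul]
    · by_cases hv : v = m k
      · rw [hv, hψbig _ hl, mul_zero]
      · rw [hψbig _ (hl.trans ((hZ k).wordLT_append hz hv x y).length_le), mul_zero]
  have hsplit : ∀ k x y, (x ++ m k ++ y).length < n →
      ∑ v ∈ words d n, Z k v * ψ (x ++ v ++ y) = Z k (m k) * ψ (x ++ m k ++ y) +
        ∑ v ∈ (words d n).erase (m k), Z k v * ψ (x ++ v ++ y) := by
    intro k x y hl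
    rw [← add_sum_erase]
    rw [mem_words]
    simp only [List.length_append] at hl
    omega
  -- The condition must hold at every occurrence in `w`, not just at the chosen one. Any other
  -- occurrence is disjoint from the chosen one, so both relations can be expanded at once. In this
  -- double sum every non-leading term involves a smaller word, where the induction hypothesis
  -- applies, and `hcompat` matches the right-hand sides.
  have key : ∀ w : {w : List (Fin d) // w.length < n}, ∀ k x y, w.1 = x ++ m k ++ y →
      ∑ v ∈ words d n, Z k v * ψ (x ++ v ++ y) = E k x y := by
    intro w
    induction w using (wordLT_wellFounded n).induction with
    | _ w ih =>
    have ih' : ∀ k x y, WordLT (x ++ m k ++ y) w.1 →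
        ∑ v ∈ words d n, Z k v * ψ (x ++ v ++ y) = E k x y := by
      intro k x y h
      by_cases hl : (x ++ m k ++ y).length < n
      · exact ih ⟨_, hl⟩ h k x y rfl
      · exact hlong k x y (by omega)
    have hmlen : ∀ k x y, w.1 = x ++ m k ++ y → m k ∈ words d n := by
      intro k x y h
      have := w.2
      rw [h] at this
      simp only [List.length_append] at this
      rw [mem_words]
      omega
    -- the two reductions at disjoint occurrences agree
    have swap : ∀ k l x y z, w.1 = x ++ m k ++ z ++ m l ++ y →
        Z l (m l) * (∑ v ∈ words d n, Z k v * ψ (x ++ v ++ (z ++ m l ++ y)) -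
          E k x (z ++ m l ++ y)) =
        Z k (m k) * (∑ v ∈ words d n, Z l v * ψ (x ++ m k ++ z ++ v ++ y) -
          E l (x ++ m k ++ z) y) := by
      intro k l x y z hw
      have e1 : ∀ v, Z k v ≠ 0 → v ≠ m k →
          ∑ v' ∈ words d n, Z l v' * ψ (x ++ v ++ z ++ v' ++ y) = E l (x ++ v ++ z) y := by
        intro v hz hv
        apply ih'
        rw [hw]
        have := (hZ k).wordLT_append hz hv x (z ++ m l ++ y)
        simpa only [List.append_assoc] using this
      have e2 : ∀ v', Z l v' ≠ 0 → v' ≠ m l →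
          ∑ v ∈ words d n, Z k v * ψ (x ++ v ++ (z ++ v' ++ y)) = E k x (z ++ v' ++ y) := by
        intro v hz hv
        apply ih'
        rw [hw]
        have := (hZ l).wordLT_append hz hv (x ++ m k ++ z) y
        simpa only [List.append_assoc] using this
      have hml : m l ∈ words d n := hmlen l (x ++ m k ++ z) y hw
      have hmk : m k ∈ words d n := hmlen k x (z ++ m l ++ y) (by simpa using hw)
      -- the double sum, evaluated in two ways
      have s1 : ∑ v' ∈ words d n, Z l v' *
          (∑ v ∈ words d n, Z k v * ψ (x ++ v ++ (z ++ v' ++ y)) - E k x (z ++ v' ++ y)) =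
          Z l (m l) * (∑ v ∈ words d n, Z k v * ψ (x ++ v ++ (z ++ m l ++ y)) -
          E k x (z ++ m l ++ y)) := by
        refine sum_eq_single_of_mem _ hml fun v' _ hv' => ?_
        by_cases hz : Z l v' = 0
        · rw [hz, zero_mul]
        · rw [e2 v' hz hv', sub_self, mul_zero]
      have s2 : ∑ v ∈ words d n, Z k v *
          (∑ v' ∈ words d n, Z l v' * ψ (x ++ v ++ z ++ v' ++ y) - E l (x ++ v ++ z) y) =
          Z k (m k) * (∑ v ∈ words d n, Z l v * ψ (x ++ m k ++ z ++ v ++ y) -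
          E l (x ++ m k ++ z) y) := by
        refine sum_eq_single_of_mem _ hmk fun v _ hv => ?_
        by_cases hz : Z k v = 0
        · rw [hz, zero_mul]
        · rw [e1 v hz hv, sub_self, mul_zero]
      rw [← s1, ← s2]
      simp only [mul_sub, sum_sub_distrib]
      congr 1
      · simp only [mul_sum]
        rw [sum_comm]
        refine sum_congr rfl fun v _ => sum_congr rfl fun v' _ => ?_
        simp only [List.append_assoc]
        ring
      · exact hcompat k l x y z
    intro k x y hw
    obtain ⟨o, ho, hoeq⟩ := hchosen w.1 w.2 ⟨(k, x, y), hw⟩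
    obtain ⟨l, x', y'⟩ := o
    have ho' : w.1 = x' ++ m l ++ y' := ho
    have hl : ∑ v ∈ words d n, Z l v * ψ (x' ++ v ++ y') = E l x' y' := by
      rw [hsplit l x' y' (ho' ▸ w.2), ← ho']
      simp only at hoeq
      rw [hoeq, sub_add_cancel]
    rcases hm.occurrence (hw.symm.trans ho') with ⟨rfl, rfl, rfl⟩ | ⟨z, rfl, rfl⟩ | ⟨z, rfl, rfl⟩
    · exact hl
    · have := swap k l x y' z (by simpa using hw)
      rw [hl, sub_self, mul_zero] at this
      exact sub_eq_zero.1 ((mul_eq_zero.1 this).resolve_left (hZ l).1)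
    · have := swap l k x' y z (by simpa using ho')
      rw [hl, sub_self, mul_zero] at this
      exact sub_eq_zero.1 ((mul_eq_zero.1 this.symm).resolve_left (hZ l).1)
  refine ⟨ψ, hψbig, ?_, ?_⟩
  · intro w hw hnorm
    have h1 : ψ w = ψ₀ ⟨w, hw⟩ := dif_pos hw
    rw [h1, hψ₀]
    exact dif_neg fun ⟨o, ho⟩ => hnorm _ _ _ ho
  · intro k x y
    by_cases hl : (x ++ m k ++ y).length < n
    · exact key ⟨_, hl⟩ k x y rfl
    · exact hlong k x y (by omega)

end StrongFreeness

end ProP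

namespace ProP

open Finset NCSeries

/-! ### Unipotence of finite `p`-groups in characteristic `p`. -/

section PGroup

variable {p : ℕ} [Fact p.Prime]

/-- A finite `p`-group acting linearly on a finite `𝔽_p`-module fixes a nonzero vector of every
nonzero quotient by an invariant submodule. -/
theorem exists_fixed_mod {P M : Type*} [Group P] (hP : IsPGroup p P) [AddCommGroup M]
    [Module (ZMod p) M] [Finite M] (ρ : Representation (ZMod p) P M) (S : Submodule (ZMod p) M)
    (hS : ∀ g, ∀ m ∈ S, ρ g m ∈ S) (hne : S ≠ ⊤) :
    ∃ m, m ∉ S ∧ ∀ g, ρ g m - m ∈ S := by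
  classical
  let _ : MulAction P (M ⧸ S) :=
    { smul := fun g => S.mapQ S (ρ g) (hS g)
      one_smul := fun x => by
        obtain ⟨m, rfl⟩ := S.mkQ_surjective x
        change S.mapQ S (ρ 1) (hS 1) (S.mkQ m) = _
        simp
      mul_smul := fun g g' x => by
        obtain ⟨m, rfl⟩ := S.mkQ_surjective x
        change S.mapQ S (ρ (g * g')) (hS _) (S.mkQ m) =
          S.mapQ S (ρ g) (hS g) (S.mapQ S (ρ g') (hS g') (S.mkQ m))
        simp }
  have hsmul : ∀ (g : P) (m : M), g • (S.mkQ m) = S.mkQ (ρ g m) := fun g m => rfl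
  have hfin : Finite (M ⧸ S) := Finite.of_surjective _ S.mkQ_surjective
  have hnt : Nontrivial (M ⧸ S) := Submodule.Quotient.nontrivial_iff.2 hne
  -- The number of fixed points is congruent to the cardinality modulo `p`, so the fixed point zero
  -- is not the only one.
  have hdvd : p ∣ Nat.card (M ⧸ S) := by
    have := Module.natCard_eq_pow_finrank (K := ZMod p) (V := M ⧸ S)
    rw [this, Nat.card_zmod]
    exact dvd_pow_self _ (Module.finrank_pos (R := ZMod p) (M := M ⧸ S)).ne'
  have h0 : (0 : M ⧸ S) ∈ MulAction.fixedPoints P (M ⧸ S) := by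
    intro g
    have := hsmul g 0
    simpa using this
  obtain ⟨b, hb, hb0⟩ := hP.exists_fixed_point_of_prime_dvd_card_of_fixed_point _ hdvd h0
  obtain ⟨m, rfl⟩ := S.mkQ_surjective b
  refine ⟨m, fun hm => hb0 ?_, fun g => ?_⟩
  · exact ((Submodule.Quotient.mk_eq_zero S).2 hm).symm
  · have := hb g
    rw [hsmul] at this
    exact (Submodule.Quotient.eq S).1 this

/-- The ascending chain of submodules with trivial action on successive quotients. -/
def fixedChain {P M : Type*} [Group P] [AddCommGroup M] [Module (ZMod p) M]
    (ρ : Representation (ZMod p) P M) : ℕ → Submodule (ZMod p) M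
  | 0 => ⊥
  | n + 1 => ⨅ g : P, (fixedChain ρ n).comap (ρ g - 1)

theorem mem_fixedChain_succ {P M : Type*} [Group P] [AddCommGroup M] [Module (ZMod p) M]
    {ρ : Representation (ZMod p) P M} {n : ℕ} {m : M} :
    m ∈ fixedChain ρ (n + 1) ↔ ∀ g, ρ g m - m ∈ fixedChain ρ n := by
  simp [fixedChain]

/-- The chain stabilizes because `M` is finite. If it stabilized at a proper submodule,
`exists_fixed_mod` would produce a fixed vector in the quotient, and the next term would be larger.
-/
theorem exists_fixedChain_eq_top {P M : Type*} [Group P] (hP : IsPGroup p P) [AddCommGroup M]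
    [Module (ZMod p) M] [Finite M] (ρ : Representation (ZMod p) P M) :
    ∃ n, fixedChain ρ n = ⊤ := by
  have hstable : ∀ n g, ∀ m ∈ fixedChain ρ n, ρ g m ∈ fixedChain ρ n := by
    intro n
    induction n with
    | zero => intro g m hm; simp_all [fixedChain]
    | succ n ih =>
      intro g m hm
      rw [mem_fixedChain_succ] at hm ⊢
      intro g'
      have h1 := hm (g' * g)
      have h2 := hm g
      have : ρ g' (ρ g m) - ρ g m = (ρ (g' * g) m - m) - (ρ g m - m) := by
        rw [map_mul]; simp
      rw [this]
      exact Submodule.sub_mem _ h1 h2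
  have hmono : Monotone (fixedChain ρ) := by
    refine monotone_nat_of_le_succ fun n m hm => ?_
    rw [mem_fixedChain_succ]
    exact fun g => Submodule.sub_mem _ (hstable n g m hm) hm
  obtain ⟨n, hn⟩ := monotone_stabilizes_iff_noetherian.2
    (inferInstance : IsNoetherian (ZMod p) M) ⟨_, hmono⟩
  refine ⟨n, ?_⟩
  by_contra hne
  obtain ⟨m, hm, hm'⟩ := exists_fixed_mod hP ρ (fixedChain ρ n) (hstable n) hne
  have h1 : fixedChain ρ n = fixedChain ρ (n + 1) := hn (n + 1) (Nat.le_succ n)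
  exact hm (h1 ▸ mem_fixedChain_succ.2 hm')

end PGroup

/-! ### The system of finite `p`-quotients of the free group. -/

namespace PIndex

variable {p d : ℕ} [Fact p.Prime]

theorem card_quot (N : PIndex p d) : ∃ k, Nat.card N.Quot = p ^ k := N.2.2

instance (N : PIndex p d) : Finite N.Quot := by
  obtain ⟨k, hk⟩ := N.card_quot
  exact Nat.finite_of_card_ne_zero (hk ▸ pow_ne_zero k (Fact.out : p.Prime).ne_zero)

theorem isPGroup_quot (N : PIndex p d) : IsPGroup p N.Quot := IsPGroup.iff_card.2 N.card_quot

/-- The kernel of a homomorphism to a finite group of `p`-power order. -/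
def ker {P : Type*} [Group P] (hP : ∃ k, Nat.card P = p ^ k) (φ : FreeGroup (Fin d) →* P) :
    PIndex p d :=
  ⟨φ.ker, inferInstance, by
    obtain ⟨k, hk⟩ := hP
    rw [Subgroup.index_ker]
    have h : Nat.card φ.range ∣ p ^ k := hk ▸ Subgroup.card_subgroup_dvd_card φ.range
    obtain ⟨j, -, hj⟩ := (Nat.dvd_prime_pow Fact.out).1 h
    exact ⟨j, hj⟩⟩

/-- The injection of the quotient by the kernel. -/
def kerLift {P : Type*} [Group P] (hP : ∃ k, Nat.card P = p ^ k) (φ : FreeGroup (Fin d) →* P) :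
    (ker hP φ).Quot →* P :=
  QuotientGroup.lift (ker hP φ).1 φ fun _ hg => hg

theorem exists_le_le (N M : PIndex p d) : ∃ L : PIndex p d, L.1 ≤ N.1 ∧ L.1 ≤ M.1 := by
  obtain ⟨a, ha⟩ := N.card_quot
  obtain ⟨b, hb⟩ := M.card_quot
  refine ⟨ker (P := N.Quot × M.Quot) ⟨a + b, by rw [Nat.card_prod, ha, hb, pow_add]⟩
    ((QuotientGroup.mk' N.1).prod (QuotientGroup.mk' M.1)), ?_, ?_⟩
  · intro x hx
    exact (QuotientGroup.eq_one_iff x).1 (congrArg Prod.fst (MonoidHom.mem_ker.1 hx))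
  · intro x hx
    exact (QuotientGroup.eq_one_iff x).1 (congrArg Prod.snd (MonoidHom.mem_ker.1 hx))

theorem exists_le_of_finite {I : Set (PIndex p d)} (hI : I.Finite) :
    ∃ L : PIndex p d, ∀ N ∈ I, L.1 ≤ N.1 := by
  induction I, hI using Set.Finite.induction_on with
  | empty => exact ⟨FreeProP.truncIndex p d 0, by simp⟩
  | @insert N I _ _ ih =>
    obtain ⟨L, hL⟩ := ih
    obtain ⟨L', h1, h2⟩ := exists_le_le L N
    refine ⟨L', ?_⟩
    rintro M (rfl | hM)
    exacts [h2, h1.trans (hL M hM)]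

end PIndex

/-! ### The free pro-`p` group and its locally constant functions. -/

namespace FreeProP

variable {p d : ℕ}

/-- The projection of the free pro-`p` group to a finite quotient. -/
def proj (N : PIndex p d) : FreeProP p d →* N.Quot :=
  (Pi.evalMonoidHom _ N).comp (freeProPSubgroup p d).subtype

theorem proj_apply (N : PIndex p d) (x : FreeProP p d) : proj N x = x.1 N := rfl

theorem continuous_proj (N : PIndex p d) : Continuous (proj N) :=
  (continuous_apply N).comp continuous_subtype_val

/-- The canonical map from the abstract free group. -/
def ofFree (p d : ℕ) : FreeGroup (Fin d) →* FreeProP p d where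
  toFun g := ⟨fun _ => QuotientGroup.mk g, fun _ _ _ => rfl⟩
  map_one' := rfl
  map_mul' _ _ := rfl

theorem ofFree_of (i : Fin d) : ofFree p d (FreeGroup.of i) = of i := rfl

theorem exists_proj_eq (N : PIndex p d) (x : FreeProP p d) :
    ∃ g, proj N (ofFree p d g) = proj N x := by
  obtain ⟨g, hg⟩ := QuotientGroup.mk_surjective (proj N x)
  exact ⟨g, hg⟩

theorem proj_surjective (N : PIndex p d) : Function.Surjective (proj N) := fun y => by
  obtain ⟨g, rfl⟩ := QuotientGroup.mk_surjective y
  exact ⟨ofFree p d g, rfl⟩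

theorem proj_eq_of_le {N M : PIndex p d} (h : N.1 ≤ M.1) {x y : FreeProP p d}
    (hxy : proj N x = proj N y) : proj M x = proj M y := by
  rw [proj_apply, proj_apply, ← x.2 N M h, ← y.2 N M h]
  exact congrArg _ hxy

variable [Fact p.Prime]

theorem isClosed_freeProPSubgroup :
    IsClosed (freeProPSubgroup p d : Set ((N : PIndex p d) → N.Quot)) := by
  have : (freeProPSubgroup p d : Set ((N : PIndex p d) → N.Quot)) =
      ⋂ (N : PIndex p d) (M : PIndex p d) (h : N.1 ≤ M.1),
        {x | QuotientGroup.map N.1 M.1 (MonoidHom.id _) h (x N) = x M} := by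
    ext x; simp [freeProPSubgroup]
  rw [this]
  refine isClosed_iInter fun N => isClosed_iInter fun M => isClosed_iInter fun h => ?_
  exact isClosed_eq (continuous_of_discreteTopology.comp (continuous_apply N)) (continuous_apply M)

instance : CompactSpace (FreeProP p d) :=
  isCompact_iff_compactSpace.1 isClosed_freeProPSubgroup.isCompact

/-- The kernels of the projections to finite quotients form a basis of neighbourhoods. -/
theorem exists_proj_subset {x : FreeProP p d} {U : Set (FreeProP p d)} (hU : U ∈ nhds x) :
    ∃ N : PIndex p d, ∀ y, proj N y = proj N x → y ∈ U := by
  rw [nhds_subtype_eq_comap, nhds_pi] at hU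
  obtain ⟨V, hV, hVU⟩ := Filter.mem_comap.1 hU
  obtain ⟨I, hI, t, ht, htV⟩ := Filter.mem_pi.1 hV
  obtain ⟨N, hN⟩ := PIndex.exists_le_of_finite hI
  refine ⟨N, fun y hy => hVU (htV fun M hM => ?_)⟩
  have h1 : y.1 M = x.1 M := proj_eq_of_le (hN M hM) hy
  rw [h1]
  exact mem_of_mem_nhds (ht M)

theorem isOpen_proj_fiber (N : PIndex p d) (x : FreeProP p d) :
    IsOpen {y | proj N y = proj N x} :=
  (isOpen_discrete {proj N x}).preimage (continuous_proj N)

/-- A locally constant function on the free pro-`p` group factors through a finite quotient. -/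
theorem exists_factor {α : Type*} {f : FreeProP p d → α} (hf : IsLocallyConstant f) :
    ∃ N : PIndex p d, ∀ x y, proj N x = proj N y → f x = f y := by
  have h : ∀ x, ∃ N : PIndex p d, ∀ y, proj N y = proj N x → f y = f x := fun x =>
    exists_proj_subset ((hf.isOpen_fiber (f x)).mem_nhds rfl)
  choose N hN using h
  obtain ⟨t, ht⟩ := isCompact_univ.elim_nhds_subcover (fun x => {y | proj (N x) y = proj (N x) x})
    fun x _ => (isOpen_proj_fiber (N x) x).mem_nhds rfl
  obtain ⟨L, hL⟩ := PIndex.exists_le_of_finite (t.finite_toSet.image N)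
  refine ⟨L, fun x y hxy => ?_⟩
  obtain ⟨z, hz, hxz⟩ := Set.mem_iUnion₂.1 (ht.2 (Set.mem_univ x))
  have hyz : proj (N z) y = proj (N z) z :=
    (proj_eq_of_le (hL _ ⟨z, hz, rfl⟩) hxy.symm).trans hxz
  rw [hN z x hxz, hN z y hyz]

theorem isLocallyConstant_of_factor {α : Type*} {f : FreeProP p d → α} (N : PIndex p d)
    (h : ∀ x y, proj N x = proj N y → f x = f y) : IsLocallyConstant f := by
  rw [IsLocallyConstant.iff_exists_open]
  exact fun x => ⟨_, isOpen_proj_fiber N x, rfl, fun y hy => h y x hy⟩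

/-- Locally constant functions that agree on the abstract free group are equal. -/
theorem eq_of_ofFree {α : Type*} {f f' : FreeProP p d → α} (hf : IsLocallyConstant f)
    (hf' : IsLocallyConstant f') (h : ∀ g, f (ofFree p d g) = f' (ofFree p d g)) : f = f' := by
  funext x
  obtain ⟨N, hN⟩ := exists_factor hf
  obtain ⟨N', hN'⟩ := exists_factor hf'
  obtain ⟨L, h1, h2⟩ := PIndex.exists_le_le N N'
  obtain ⟨g, hg⟩ := exists_proj_eq L x
  rw [← hN _ x (proj_eq_of_le h1 hg), ← hN' _ x (proj_eq_of_le h2 hg), h]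

theorem isOpen_ker_proj (N : PIndex p d) : IsOpen ((proj N).ker : Set (FreeProP p d)) := by
  have : ((proj N).ker : Set (FreeProP p d)) = {y | proj N y = proj N 1} := by
    ext y
    rw [map_one]
    rfl
  rw [this]
  exact isOpen_proj_fiber N 1

/-- The continuous homomorphism between free pro-`p` groups with given values on generators. -/
noncomputable def lift {n : ℕ} (z : Fin d → FreeProP p n) : FreeProP p d →* FreeProP p n :=
  let φ (M : PIndex p n) : FreeGroup (Fin d) →* M.Quot := FreeGroup.lift fun i => proj M (z i)
  { toFun := fun x => ⟨fun M => PIndex.kerLift M.card_quot (φ M)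
        (proj (PIndex.ker M.card_quot (φ M)) x), fun M M' h => by
      obtain ⟨L, h1, h2⟩ := PIndex.exists_le_le (PIndex.ker M.card_quot (φ M))
        (PIndex.ker M'.card_quot (φ M'))
      obtain ⟨g, hg⟩ := exists_proj_eq L x
      dsimp only
      rw [← proj_eq_of_le h1 hg, ← proj_eq_of_le h2 hg]
      change QuotientGroup.map M.1 M'.1 (MonoidHom.id _) h (φ M g) = φ M' g
      have : (QuotientGroup.map M.1 M'.1 (MonoidHom.id _) h).comp (φ M) = φ M' := by
        ext i
        simp only [φ, MonoidHom.comp_apply, FreeGroup.lift_apply_of]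
        exact (z i).2 M M' h
      exact DFunLike.congr_fun this g⟩
    map_one' := by
      apply Subtype.ext
      funext M
      change PIndex.kerLift M.card_quot (φ M) _ = 1
      rw [map_one, map_one]
    map_mul' := fun x y => by
      apply Subtype.ext
      funext M
      change PIndex.kerLift M.card_quot (φ M) _ = PIndex.kerLift M.card_quot (φ M) _ *
        PIndex.kerLift M.card_quot (φ M) _
      rw [map_mul, map_mul] }

theorem lift_of {n : ℕ} (z : Fin d → FreeProP p n) (i : Fin d) : lift z (of i) = z i := by
  apply Subtype.ext
  funext M
  exact FreeGroup.lift_apply_of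

theorem continuous_lift {n : ℕ} (z : Fin d → FreeProP p n) : Continuous (lift z) := by
  refine Continuous.subtype_mk (continuous_pi fun M => ?_) _
  exact continuous_of_discreteTopology.comp (continuous_proj _)

theorem magnus_ofFree (g : FreeGroup (Fin d)) :
    magnus (ofFree p d g) = (freeMagnus (ZMod p) d g : NCSeries (ZMod p) d) := by
  ext w
  exact magnusCoeff_eq _ w.length g rfl w le_rfl

theorem magnus_eq_of_proj {n : ℕ} {x y : FreeProP p d}
    (h : proj (truncIndex p d n) x = proj (truncIndex p d n) y) {w : List (Fin d)}
    (hw : w.length ≤ n) : magnus x w = magnus y w := by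
  obtain ⟨g, hg⟩ := QuotientGroup.mk_surjective (proj (truncIndex p d n) x)
  exact (magnusCoeff_eq x n g hg.symm w hw).trans
    (magnusCoeff_eq y n g (hg.trans h).symm w hw).symm

theorem magnus_nil (x : FreeProP p d) : magnus x [] = 1 := by
  obtain ⟨g, hg⟩ := exists_proj_eq (truncIndex p d 0) x
  rw [← magnus_eq_of_proj hg (by simp), magnus_ofFree, freeMagnus_nil]

theorem magnus_sub_mem_order {n : ℕ} {x y : FreeProP p d}
    (h : proj (truncIndex p d n) x = proj (truncIndex p d n) y) :
    magnus x - magnus y ∈ order (ZMod p) d n := fun w hw => by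
  rw [NCSeries.sub_apply, magnus_eq_of_proj h hw.le, sub_self]

/-- A smooth functional gives a locally constant function on the free pro-`p` group. -/
theorem isLocallyConstant_magnus {l : NCSeries (ZMod p) d →ₗ[ZMod p] ZMod p}
    (hl : l ∈ smoothDual (ZMod p) d) :
    IsLocallyConstant fun x : FreeProP p d => l (magnus x) := by
  obtain ⟨n, hn⟩ := hl
  refine isLocallyConstant_of_factor (truncIndex p d n) fun x y h => ?_
  rw [← sub_eq_zero, ← map_sub]
  exact hn _ (magnus_sub_mem_order h)

/-- A smooth functional that vanishes on the free pro-`p` group is zero. -/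
theorem smoothDual_eq_zero {l : NCSeries (ZMod p) d →ₗ[ZMod p] ZMod p}
    (hl : l ∈ smoothDual (ZMod p) d) (h : ∀ x : FreeProP p d, l (magnus x) = 0) : l = 0 := by
  -- Since φ(x_a x) - φ(x) = X_a φ(x), the functional precomposed with left multiplication by X_a
  -- also vanishes on all Magnus images. Induction on the word then reaches every monomial.
  have key : ∀ (w : List (Fin d)) (l : NCSeries (ZMod p) d →ₗ[ZMod p] ZMod p),
      (∀ x : FreeProP p d, l (magnus x) = 0) → l (mono (ZMod p) w) = 0 := by
    intro w
    induction w with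
    | nil => intro l h; simpa [mono_nil] using h 1
    | cons a w ih =>
      intro l h
      rw [mono_cons]
      refine ih (l ∘ₗ LinearMap.mulLeft (ZMod p) (X (ZMod p) a)) fun x => ?_
      have h1 := h (of a * x)
      rw [map_mul, magnus_of, add_mul, one_mul, map_add, h x, zero_add] at h1
      exact h1
  exact smoothDual_ext hl (Submodule.zero_mem _) fun w => key w l h

theorem smoothDual_ext_magnus {l l' : NCSeries (ZMod p) d →ₗ[ZMod p] ZMod p}
    (hl : l ∈ smoothDual (ZMod p) d) (hl' : l' ∈ smoothDual (ZMod p) d)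
    (h : ∀ x : FreeProP p d, l (magnus x) = l' (magnus x)) : l = l' :=
  sub_eq_zero.1 (smoothDual_eq_zero ((smoothDual (ZMod p) d).sub_mem hl hl') fun x => by
    rw [LinearMap.sub_apply, h, sub_self])

/-- The difference operator `h ↦ h(x_a y) - h(y)`. -/
def diff (a : Fin d) (h : FreeProP p d → ZMod p) : FreeProP p d → ZMod p :=
  fun y => h (of a * y) - h y

/-- Iterated differences at the identity. -/
def iterDiff : List (Fin d) → (FreeProP p d → ZMod p) → ZMod p
  | [], h => h 1
  | a :: w, h => iterDiff w (diff a h)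

/-- The left translation action on functions on a group. -/
def leftRegular (p : ℕ) (P : Type*) [Group P] : Representation (ZMod p) P (P → ZMod p) where
  toFun g := LinearMap.funLeft (ZMod p) (ZMod p) (fun y => g⁻¹ * y)
  map_one' := by ext; simp [LinearMap.funLeft]
  map_mul' g g' := by
    refine LinearMap.ext fun f => funext fun y => ?_
    simp [LinearMap.funLeft, mul_assoc]

theorem diff_comp_proj (N : PIndex p d) (a : Fin d) (h : N.Quot → ZMod p) :
    diff a (h ∘ proj N) = (leftRegular p N.Quot (proj N (of a))⁻¹ h - h) ∘ proj N := by
  funext y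
  simp [diff, leftRegular, LinearMap.funLeft]

theorem iterDiff_zero (w : List (Fin d)) : iterDiff w (0 : FreeProP p d → ZMod p) = 0 := by
  induction w with
  | nil => rfl
  | cons a w ih =>
    have : diff a (0 : FreeProP p d → ZMod p) = 0 := by funext y; simp [diff]
    rw [iterDiff, this, ih]

/-- Taking the difference at a generator lowers the position in the fixed chain by one. This
nilpotence is what makes the functional built in `exists_smoothDual` smooth. -/
theorem iterDiff_eq_zero (N : PIndex p d) (n : ℕ) : ∀ h ∈ fixedChain (leftRegular p N.Quot) n,
    ∀ w : List (Fin d), n ≤ w.length → iterDiff w (h ∘ proj N) = 0 := by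
  induction n with
  | zero =>
    intro h hh w _
    rw [fixedChain, Submodule.mem_bot] at hh
    subst hh
    exact iterDiff_zero w
  | succ n ih =>
    intro h hh w hw
    cases w with
    | nil => simp at hw
    | cons a w =>
      rw [iterDiff, diff_comp_proj]
      exact ih _ (mem_fixedChain_succ.1 hh _) w (by simpa using hw)

/-- Every locally constant function on the free pro-`p` group comes from a smooth functional. -/
theorem exists_smoothDual {h : FreeProP p d → ZMod p} (hh : IsLocallyConstant h) :
    ∃ l ∈ smoothDual (ZMod p) d, ∀ x, h x = l (magnus x) := by
  obtain ⟨N, hN⟩ := exists_factor hh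
  obtain ⟨n, hn⟩ := exists_fixedChain_eq_top N.isPGroup_quot (leftRegular p N.Quot)
  -- Taylor expansion at the identity: the value on the word `w` is the iterated difference along
  -- `w`. These differences vanish from length `n` on, so the truncation at `n` loses nothing.
  let l (f : N.Quot → ZMod p) : NCSeries (ZMod p) d →ₗ[ZMod p] ZMod p :=
    pairing n fun w => iterDiff w (f ∘ proj N)
  have hbig : ∀ f : N.Quot → ZMod p, ∀ w : List (Fin d), n ≤ w.length →
      iterDiff w (f ∘ proj N) = 0 := fun f =>
    iterDiff_eq_zero N n f (hn ▸ Submodule.mem_top)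
  let D (a : Fin d) (f : N.Quot → ZMod p) : N.Quot → ZMod p :=
    leftRegular p N.Quot (proj N (of a))⁻¹ f - f
  have hlD : ∀ a f, l (D a f) = l f ∘ₗ LinearMap.mulLeft (ZMod p) (X (ZMod p) a) := by
    intro a f
    refine smoothDual_ext (pairing_mem_smoothDual _ _)
      (comp_mulLeft_mem (pairing_mem_smoothDual _ _) _) fun w => ?_
    rw [LinearMap.comp_apply, LinearMap.mulLeft_apply, ← mono_cons]
    simp only [l]
    rw [pairing_mono (hbig _), pairing_mono (hbig _), iterDiff, diff_comp_proj]
  -- The error of the expansion satisfies the same difference equation as `f`. It vanishes at the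
  -- identity and hence should vanish along all words in the generators.
  let e (f : N.Quot → ZMod p) (x : FreeProP p d) : ZMod p := f (proj N x) - l f (magnus x)
  have he : ∀ f a x, e f (of a * x) = e f x + e (D a f) x := by
    intro f a x
    have h1 : f (proj N (of a * x)) = D a f (proj N x) + f (proj N x) := by
      simp [D, leftRegular, LinearMap.funLeft]
    simp only [e]
    rw [h1, map_mul, magnus_of, add_mul, one_mul, map_add, hlD]
    simp only [LinearMap.comp_apply, LinearMap.mulLeft_apply]
    ring
  -- Membership is an equivalence so that `T` is closed under inverses. For a generator the backward
  -- implication is proved by climbing the fixed chain: the error of the difference `D a f` at `y`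
  -- is known to vanish one level lower.
  let T : Subgroup (FreeProP p d) :=
    { carrier := {x | ∀ y, (∀ f, e f (x * y) = 0) ↔ ∀ f, e f y = 0}
      one_mem' := fun y => by simp
      mul_mem' := fun {x x'} hx hx' y => by rw [mul_assoc, hx, hx']
      inv_mem' := fun {x} hx y => by rw [← hx (x⁻¹ * y), mul_inv_cancel_left] }
  have hT : ∀ a, of a ∈ T := by
    intro a y
    refine ⟨fun H => ?_, fun H f => by rw [he, H, H, add_zero]⟩
    have : ∀ i, ∀ f ∈ fixedChain (leftRegular p N.Quot) i, e f y = 0 := by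
      intro i
      induction i with
      | zero =>
        intro f hf
        rw [fixedChain, Submodule.mem_bot] at hf
        subst hf
        have hz : ((0 : N.Quot → ZMod p) ∘ proj N) = 0 := rfl
        simp [e, l, hz, pairing_apply, iterDiff_zero]
      | succ i ih =>
        intro f hf
        have h1 := H f
        rw [he, ih _ (mem_fixedChain_succ.1 hf _), add_zero] at h1
        exact h1
    exact fun f => this n f (hn ▸ Submodule.mem_top)
  have hfree : ∀ g, ofFree p d g ∈ T := by
    have : (⊤ : Subgroup (FreeGroup (Fin d))) ≤ T.comap (ofFree p d) := by
      rw [← FreeGroup.closure_range_of, Subgroup.closure_le]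
      rintro _ ⟨a, rfl⟩
      exact hT a
    exact fun g => this (Subgroup.mem_top g)
  have h1 : ∀ f, e f 1 = 0 := by
    intro f
    have := pairing_mono (hbig f) ([] : List (Fin d))
    simp only [e, l, map_one]
    rw [← mono_nil, this, iterDiff]
    simp
  have hall : ∀ g f, e f (ofFree p d g) = 0 := by
    intro g
    have := ((hfree g) 1).2 h1
    simpa using this
  let f : N.Quot → ZMod p := fun y => h (proj_surjective N y).choose
  have hf : ∀ x, f (proj N x) = h x := fun x => hN _ _ (proj_surjective N (proj N x)).choose_spec
  refine ⟨l f, pairing_mem_smoothDual _ _, fun x => ?_⟩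
  have := eq_of_ofFree hh (isLocallyConstant_magnus (pairing_mem_smoothDual _ _))
    (f' := fun x => l f (magnus x)) fun g => by
      have := hall g f
      simp only [e, hf] at this
      exact sub_eq_zero.1 this
  exact congrFun this x

/-- The coefficient of `X_i` is a homomorphism. -/
theorem magnus_mul_singleton (x y : FreeProP p d) (i : Fin d) :
    magnus (x * y) [i] = magnus x [i] + magnus y [i] := by
  rw [map_mul, mul_apply]
  simp [sum_range_succ, magnus_nil, add_comm]

theorem magnus_mul_pair (x y : FreeProP p d) (i j : Fin d) :
    magnus (x * y) [i, j] = magnus x [i, j] + magnus y [i, j] + magnus x [i] * magnus y [j] := by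
  rw [map_mul, mul_apply]
  simp [sum_range_succ, magnus_nil]
  ring

theorem isLocallyConstant_magnus_apply (w : List (Fin d)) :
    IsLocallyConstant fun x : FreeProP p d => magnus x w :=
  isLocallyConstant_of_factor (truncIndex p d w.length) fun _ _ h => magnus_eq_of_proj h le_rfl

/-- A continuous homomorphism to `𝔽_p` is a linear combination of coefficients of the variables. -/
theorem hom_eq_sum {χ : FreeProP p d → ZMod p} (hχ : IsLocallyConstant χ)
    (hmul : ∀ x y, χ (x * y) = χ x + χ y) (x : FreeProP p d) :
    χ x = ∑ i, χ (of i) * magnus x [i] := by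
  have hlc : IsLocallyConstant fun x : FreeProP p d => ∑ i, χ (of i) * magnus x [i] :=
    isLocallyConstant_of_factor (truncIndex p d 1) fun x y h =>
      sum_congr rfl fun i _ => by rw [magnus_eq_of_proj h (by simp)]
  let φ : FreeGroup (Fin d) →* Multiplicative (ZMod p) :=
    MonoidHom.mk' (fun g => Multiplicative.ofAdd (χ (ofFree p d g))) fun g h => by
      rw [map_mul, hmul, ofAdd_add]
  let φ' : FreeGroup (Fin d) →* Multiplicative (ZMod p) :=
    MonoidHom.mk' (fun g => Multiplicative.ofAdd (∑ i, χ (of i) * magnus (ofFree p d g) [i]))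
      fun g h => by
        rw [← ofAdd_add, ← sum_add_distrib]
        refine congrArg _ (sum_congr rfl fun i _ => ?_)
        rw [map_mul, magnus_mul_singleton, mul_add]
  have hφ : φ = φ' := by
    ext i
    change χ (ofFree p d (FreeGroup.of i)) =
      ∑ j, χ (of j) * magnus (ofFree p d (FreeGroup.of i)) [j]
    rw [ofFree_of, magnus_of]
    simp [NCSeries.add_apply, one_apply, X_apply]
  exact congrFun (eq_of_ofFree hχ hlc fun g => DFunLike.congr_fun hφ g) x

end FreeProP

end ProP

namespace ProP

open Finset

/-! ### Continuous cochains with coefficients and dimension shifting. -/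

section Coefficients

variable {p : ℕ} {Γ : Type} [Group Γ]

/-- The inhomogeneous coboundary with coefficients in a representation. -/
def cob {M : Type*} [AddCommGroup M] [Module (ZMod p) M] (ρ : Representation (ZMod p) Γ M) (n : ℕ)
    (f : (Fin n → Γ) → M) : (Fin (n + 1) → Γ) → M := fun g =>
  ρ (g 0) (f fun i => g i.succ) +
    ∑ j : Fin (n + 1), (-1 : ZMod p) ^ ((j : ℕ) + 1) • f (Fin.contractNth j (· * ·) g)

theorem cob_cob {M : Type} [AddCommGroup M] [Module (ZMod p) M]
    (ρ : Representation (ZMod p) Γ M) (n : ℕ) (f : (Fin n → Γ) → M) :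
    cob ρ (n + 1) (cob ρ n f) = 0 := by
  have h := groupCohomology.inhomogeneousCochains.d_comp_d (n := n) (A := Rep.of ρ)
  have h' := congrArg (fun φ => φ.hom f) h
  exact h'

theorem cob_trivial (n : ℕ) (f : (Fin n → Γ) → ZMod p) :
    cob (Representation.trivial (ZMod p) Γ (ZMod p)) n f = coboundary p Γ n f := by
  funext g
  simp [cob, coboundary_apply]

theorem cob_sub {M : Type*} [AddCommGroup M] [Module (ZMod p) M]
    (ρ : Representation (ZMod p) Γ M) (n : ℕ) (f f' : (Fin n → Γ) → M) :
    cob ρ n (f - f') = cob ρ n f - cob ρ n f' := by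
  funext g
  simp only [cob, Pi.sub_apply, map_sub, smul_sub, sum_sub_distrib]
  abel

theorem map_cob {M N : Type*} [AddCommGroup M] [Module (ZMod p) M] [AddCommGroup N]
    [Module (ZMod p) N] {ρ : Representation (ZMod p) Γ M} {σ : Representation (ZMod p) Γ N}
    {q : M →ₗ[ZMod p] N} (hq : ∀ g m, q (ρ g m) = σ g (q m)) (n : ℕ) (f : (Fin n → Γ) → M) :
    q ∘ cob ρ n f = cob σ n (q ∘ f) := by
  funext g
  simp [cob, hq]

variable [TopologicalSpace Γ]

/-- Every locally constant cocycle of degree `n + 1` with values in the representation is the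
coboundary of a locally constant cochain. -/
def CohomologyVanishes {M : Type*} [AddCommGroup M] [Module (ZMod p) M]
    (ρ : Representation (ZMod p) Γ M) (n : ℕ) : Prop :=
  ∀ f : (Fin (n + 1) → Γ) → M, IsLocallyConstant f → cob ρ (n + 1) f = 0 →
    ∃ g : (Fin n → Γ) → M, IsLocallyConstant g ∧ cob ρ n g = f

/-- Only the summand in which `g 0` acts needs `hρ`: near a point the vector acted upon is first
frozen, and then its orbit map is locally constant. -/
theorem isLocallyConstant_cob [IsTopologicalGroup Γ] {M : Type*} [AddCommGroup M]
    [Module (ZMod p) M] {ρ : Representation (ZMod p) Γ M}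
    (hρ : ∀ m, IsLocallyConstant fun g => ρ g m)
    {n : ℕ} {f : (Fin n → Γ) → M} (hf : IsLocallyConstant f) : IsLocallyConstant (cob ρ n f) := by
  have h1 : IsLocallyConstant fun g : Fin (n + 1) → Γ => ρ (g 0) (f fun i => g i.succ) := by
    have hf' : IsLocallyConstant fun g : Fin (n + 1) → Γ => f fun i => g i.succ :=
      hf.comp_continuous (by fun_prop)
    rw [IsLocallyConstant.iff_eventually_eq]
    intro g
    have h2 := (hf'.eventually_eq g)
    have h3 := (((hρ (f fun i => g i.succ)).comp_continuous
      (continuous_apply (0 : Fin (n + 1)) :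
        Continuous fun g : Fin (n + 1) → Γ => g 0)).eventually_eq g)
    filter_upwards [h2, h3] with g' h2 h3
    rw [h2]
    exact h3
  have hc : ∀ j : Fin (n + 1), Continuous fun g : Fin (n + 1) → Γ =>
      Fin.contractNth j (· * ·) g := by
    intro j
    refine continuous_pi fun k => ?_
    simp only [Fin.contractNth]
    split_ifs <;> fun_prop
  have hs : ∀ s : Finset (Fin (n + 1)), IsLocallyConstant fun g : Fin (n + 1) → Γ =>
      ∑ j ∈ s, (-1 : ZMod p) ^ ((j : ℕ) + 1) • f (Fin.contractNth j (· * ·) g) := by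
    classical
    intro s
    induction s using Finset.induction_on with
    | empty => exact IsLocallyConstant.const (0 : M)
    | insert a s ha ih =>
      simp only [sum_insert ha]
      exact IsLocallyConstant.add ((hf.comp_continuous (hc a)).comp
        fun m => (-1 : ZMod p) ^ ((a : ℕ) + 1) • m) ih
  exact IsLocallyConstant.add h1 (hs _)

/-- Dimension shifting along a short exact sequence of representations. -/
theorem CohomologyVanishes.of_exact [IsTopologicalGroup Γ] {L N : Type*} {M : Type}
    [AddCommGroup L] [Module (ZMod p) L]
    [AddCommGroup M] [Module (ZMod p) M] [AddCommGroup N] [Module (ZMod p) N]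
    {ρL : Representation (ZMod p) Γ L} {ρM : Representation (ZMod p) Γ M}
    {ρN : Representation (ZMod p) Γ N} (hρM : ∀ m, IsLocallyConstant fun g => ρM g m)
    {i : L →ₗ[ZMod p] M} {q : M →ₗ[ZMod p] N}
    (hi : ∀ g m, i (ρL g m) = ρM g (i m)) (hq : ∀ g m, q (ρM g m) = ρN g (q m))
    (hinj : Function.Injective i) (hqi : ∀ l, q (i l) = 0)
    (hker : ∀ m, q m = 0 → ∃ l, i l = m) (hsurj : Function.Surjective q) {n : ℕ}
    (hM : CohomologyVanishes ρM (n + 1)) (hN : CohomologyVanishes ρN n) :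
    CohomologyVanishes ρL (n + 1) := by
  intro f hf hcf
  obtain ⟨g, hg, hcg⟩ := hM (i ∘ f) (hf.comp i) (by
    rw [← map_cob hi, hcf]; funext x; simp)
  obtain ⟨h, hh, hch⟩ := hN (q ∘ g) (hg.comp q) (by
    rw [← map_cob hq, hcg]; funext x; simp [hqi])
  -- A set-theoretic section suffices, since `s ∘ h` is locally constant as soon as `h` is.
  let s := Function.surjInv hsurj
  have hsq : q ∘ (s ∘ h) = h := funext fun x => Function.surjInv_eq hsurj (h x)
  -- Subtracting a coboundary does not change the coboundary of `g` and makes its image under `q`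
  -- zero, so the corrected cochain comes from the kernel `L`.
  let g' := g - cob ρM n (s ∘ h)
  have hg' : IsLocallyConstant g' :=
    IsLocallyConstant.sub hg (isLocallyConstant_cob hρM (hh.comp s))
  have hqg' : ∀ x, q (g' x) = 0 := by
    intro x
    have := congrFun (map_cob hq n (s ∘ h)) x
    rw [hsq, hch] at this
    simp only [g', Pi.sub_apply, map_sub, sub_eq_zero]
    exact this.symm
  choose t ht using hker
  let l : (Fin (n + 1) → Γ) → L := fun x => t (g' x) (hqg' x)
  have hl : ∀ x, i (l x) = g' x := fun x => ht _ _
  have hil : i ∘ l = g' := funext hl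
  refine ⟨l, ?_, ?_⟩
  · rw [IsLocallyConstant.iff_eventually_eq]
    intro x
    filter_upwards [hg'.eventually_eq x] with y hy
    exact hinj (by rw [hl, hl, hy])
  · have h1 : i ∘ cob ρL (n + 1) l = i ∘ f := by
      rw [map_cob hi, hil, cob_sub, hcg, cob_cob, sub_zero]
    exact funext fun x => hinj (congrFun h1 x)

end Coefficients

/-! ### Direct sums of representations. -/

section DirectSum

variable {p : ℕ} {Γ : Type} [Group Γ]

/-- The direct sum of copies of a representation. -/
noncomputable def finsuppRep {M : Type*} [AddCommGroup M] [Module (ZMod p) M] (ι : Type*)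
    (ρ : Representation (ZMod p) Γ M) : Representation (ZMod p) Γ (ι →₀ M) where
  toFun g := Finsupp.mapRange.linearMap (ρ g)
  map_one' := by ext; simp
  map_mul' g g' := by ext; simp

@[simp]
theorem finsuppRep_apply {M : Type*} [AddCommGroup M] [Module (ZMod p) M] {ι : Type*}
    (ρ : Representation (ZMod p) Γ M) (g : Γ) (f : ι →₀ M) (k : ι) :
    finsuppRep ι ρ g f k = ρ g (f k) := by
  simp [finsuppRep]

variable [TopologicalSpace Γ]

theorem isLocallyConstant_finsupp_sum {X ι M : Type*} [TopologicalSpace X] [AddCommGroup M]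
    (s : Finset ι) {f : ι → X → M} (hf : ∀ k, IsLocallyConstant (f k)) :
    IsLocallyConstant fun x => ∑ k ∈ s, Finsupp.single k (f k x) := by
  classical
  induction s using Finset.induction_on with
  | empty => exact IsLocallyConstant.const (0 : ι →₀ M)
  | insert a s ha ih =>
    simp only [sum_insert ha]
    exact IsLocallyConstant.add ((hf a).comp (Finsupp.single a)) ih

theorem isLocallyConstant_finsuppRep {M : Type*} [AddCommGroup M] [Module (ZMod p) M] {ι : Type*}
    {ρ : Representation (ZMod p) Γ M} (hρ : ∀ m, IsLocallyConstant fun g => ρ g m) (f : ι →₀ M) :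
    IsLocallyConstant fun g => finsuppRep ι ρ g f := by
  have h := isLocallyConstant_finsupp_sum f.support (f := fun k g => ρ g (f k)) fun k => hρ (f k)
  have h' : (fun g => finsuppRep ι ρ g f) =
      fun g => ∑ k ∈ f.support, Finsupp.single k (ρ g (f k)) := by
    funext g
    conv_lhs => rw [← Finsupp.sum_single f, Finsupp.sum, map_sum]
    simp [finsuppRep]
  rw [h']
  exact h

end DirectSum

/-! ### Acyclicity of locally constant functions. -/

section Coinduced

variable {p : ℕ} {Γ : Type} [Group Γ]

theorem contractNth_zero_cons {n : ℕ} (x : Γ) (g : Fin (n + 1) → Γ) :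
    Fin.contractNth 0 (· * ·) (Fin.cons x g : Fin (n + 2) → Γ) =
      Fin.cons (x * g 0) fun i => g i.succ := by
  funext k
  refine Fin.cases ?_ (fun k => ?_) k
  · simp [Fin.contractNth]
  · simp [Fin.contractNth]

theorem contractNth_succ_cons {n : ℕ} (x : Γ) (g : Fin (n + 1) → Γ) (j : Fin (n + 1)) :
    Fin.contractNth j.succ (· * ·) (Fin.cons x g : Fin (n + 2) → Γ) =
      Fin.cons x (Fin.contractNth j (· * ·) g) := by
  funext k
  refine Fin.cases ?_ (fun k => ?_) k
  · simp [Fin.contractNth]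
  · simp [Fin.contractNth]

variable [TopologicalSpace Γ]

/-- Partial evaluation of a locally constant function on a product with a compact space. -/
theorem isLocallyConstant_curry {X Y α : Type*} [TopologicalSpace X] [CompactSpace X]
    [TopologicalSpace Y] {f : X × Y → α} (hf : IsLocallyConstant f) :
    IsLocallyConstant fun (y : Y) (x : X) => f (x, y) := by
  rw [IsLocallyConstant.iff_exists_open]
  intro y
  have hopen : IsOpen {z : X × Y | f z = f (z.1, y)} := by
    have h2 : IsLocallyConstant fun z : X × Y => (f z, f (z.1, y)) :=
      hf.prodMk (hf.comp_continuous (by fun_prop))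
    exact h2 {w | w.1 = w.2}
  obtain ⟨u, v, hu, hv, hXu, hyv, huv⟩ := generalized_tube_lemma isCompact_univ
    (isCompact_singleton (x := y)) hopen (by rintro ⟨x, y'⟩ ⟨-, rfl⟩; rfl)
  refine ⟨v, hv, hyv rfl, fun y' hy' => funext fun x => ?_⟩
  exact huv (Set.mk_mem_prod (hXu (Set.mem_univ x)) hy')

variable [IsTopologicalGroup Γ]

/-- The right translation action on locally constant functions. -/
def rightRegular (p : ℕ) (Γ : Type) [Group Γ] [TopologicalSpace Γ] [IsTopologicalGroup Γ] :
    Representation (ZMod p) Γ (LocallyConstant Γ (ZMod p)) where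
  toFun g :=
    { toFun := fun h => h.comap ⟨fun y => y * g, by fun_prop⟩
      map_add' := fun _ _ => rfl
      map_smul' := fun _ _ => rfl }
  map_one' := by
    refine LinearMap.ext fun h => LocallyConstant.ext fun y => ?_
    simp
  map_mul' g g' := by
    refine LinearMap.ext fun h => LocallyConstant.ext fun y => ?_
    exact congrArg h (mul_assoc y g g').symm

@[simp]
theorem rightRegular_apply (g : Γ) (h : LocallyConstant Γ (ZMod p)) (y : Γ) :
    rightRegular p Γ g h y = h (y * g) := rfl

variable [CompactSpace Γ]

theorem isLocallyConstant_rightRegular (h : LocallyConstant Γ (ZMod p)) :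
    IsLocallyConstant fun g => rightRegular p Γ g h := by
  have h1 : IsLocallyConstant fun z : Γ × Γ => h (z.1 * z.2) :=
    h.isLocallyConstant.comp_continuous (by fun_prop)
  have h2 := isLocallyConstant_curry h1
  rw [IsLocallyConstant.iff_eventually_eq] at h2 ⊢
  intro g
  filter_upwards [h2 g] with g' hg'
  exact LocallyConstant.ext fun y => congrFun hg' y

/-- The contracting homotopy of a coinduced module: the primitive is y ↦ (x ↦ f(x, y)(1)).
Evaluating the cocycle identity at (x, y) and then at 1 gives the claim, because (x · f(y))(1) =
f(y)(x). Compactness of `Γ` makes the primitive locally constant as a map into the function space.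
-/
theorem rightRegular_vanishes (n : ℕ) : CohomologyVanishes (rightRegular p Γ) n := by
  intro f hf hcf
  have hf1 : IsLocallyConstant fun z : Γ × (Fin n → Γ) => f (Fin.cons z.1 z.2) 1 :=
    (hf.comp fun h => h 1).comp_continuous
      (f := fun z : Γ × (Fin n → Γ) => (Fin.cons z.1 z.2 : Fin (n + 1) → Γ))
      (continuous_pi fun k => by
        refine Fin.cases ?_ (fun k => ?_) k
        · simpa using continuous_fst
        · simp only [Fin.cons_succ]; fun_prop)
  have hf2 := isLocallyConstant_curry hf1
  let g : (Fin n → Γ) → LocallyConstant Γ (ZMod p) := fun y =>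
    ⟨fun x => f (Fin.cons x y) 1, hf1.comp_continuous (f := fun x => (x, y)) (by fun_prop)⟩
  refine ⟨g, ?_, ?_⟩
  · rw [IsLocallyConstant.iff_eventually_eq] at hf2 ⊢
    intro y
    filter_upwards [hf2 y] with y' hy'
    exact LocallyConstant.ext fun x => congrFun hy' x
  · funext y
    refine LocallyConstant.ext fun x => ?_
    have hsm : ∀ (c : ZMod p) (h : LocallyConstant Γ (ZMod p)) (z : Γ), (c • h) z = c * h z :=
      fun _ _ _ => rfl
    let evl : Γ → LocallyConstant Γ (ZMod p) →ₗ[ZMod p] ZMod p := fun z =>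
      ⟨⟨fun h => h z, fun _ _ => rfl⟩, fun _ _ => rfl⟩
    have hev : ∀ z h, evl z h = h z := fun _ _ => rfl
    have h1 := congrArg (evl 1) (congrFun hcf (Fin.cons x y))
    rw [cob, map_add, map_sum, Fin.sum_univ_succ, contractNth_zero_cons, Pi.zero_apply,
      map_zero] at h1
    simp only [contractNth_succ_cons, hsm, hev, Fin.cons_zero, Fin.cons_succ,
      rightRegular_apply, one_mul] at h1
    rw [← hev x, cob, map_add, map_sum]
    simp only [hsm, hev, rightRegular_apply]
    simp only [g, LocallyConstant.coe_mk]
    have h2 : ∑ j : Fin (n + 1), (-1 : ZMod p) ^ ((j.succ : ℕ) + 1) *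
        f (Fin.cons x (Fin.contractNth j (· * ·) y)) 1 = -∑ j : Fin (n + 1),
          (-1 : ZMod p) ^ ((j : ℕ) + 1) * f (Fin.cons x (Fin.contractNth j (· * ·) y)) 1 := by
      rw [← sum_neg_distrib]
      refine sum_congr rfl fun j _ => ?_
      rw [Fin.val_succ, pow_succ _ ((j : ℕ) + 1)]
      ring
    rw [h2] at h1
    simp only [Fin.val_zero, zero_add, pow_one] at h1
    linear_combination -h1

/-- A locally constant cochain on a compact space has finite range, so only finitely many
coordinates occur and primitives are needed only for these. -/
theorem CohomologyVanishes.finsupp {M : Type*} [AddCommGroup M] [Module (ZMod p) M] {ι : Type*}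
    {ρ : Representation (ZMod p) Γ M} {n : ℕ} (hρ : CohomologyVanishes ρ n) :
    CohomologyVanishes (finsuppRep ι ρ) n := by
  classical
  intro f hf hcf
  have happ : ∀ (m : ℕ) (f : (Fin m → Γ) → ι →₀ M) (k : ι) (x : Fin (m + 1) → Γ),
      cob (finsuppRep ι ρ) m f x k = cob ρ m (fun y => f y k) x := by
    intro m f k x
    simp [cob]
  have hk : ∀ k, ∃ g : (Fin n → Γ) → M, IsLocallyConstant g ∧ cob ρ n g = fun y => f y k := by
    intro k
    refine hρ (fun y => f y k) (hf.comp fun m => m k) (funext fun x => ?_)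
    rw [← happ, hcf]
    rfl
  choose g hg hcg using hk
  have hfin := hf.range_finite
  let s : Finset ι := hfin.toFinset.sup Finsupp.support
  have hs : ∀ y, ∀ k ∉ s, f y k = 0 := by
    intro y k hk
    by_contra hne
    exact hk (Finset.mem_sup.2 ⟨f y, by simp, Finsupp.mem_support_iff.2 hne⟩)
  refine ⟨fun y => ∑ k ∈ s, Finsupp.single k (g k y), isLocallyConstant_finsupp_sum s hg, ?_⟩
  funext y
  ext k
  rw [happ]
  by_cases hks : k ∈ s
  · rw [← congrFun (hcg k) y]
    congr 1
    funext x
    rw [Finsupp.finsetSum_apply, sum_eq_single k]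
    · simp
    · intro j _ hj; simp [hj]
    · simp [hks]
  · rw [hs y k hks]
    have : (fun x : Fin n → Γ => (∑ j ∈ s, Finsupp.single j (g j x)) k) = fun _ => 0 := by
      funext x
      rw [Finsupp.finsetSum_apply]
      refine sum_eq_zero fun j hj => ?_
      rw [Finsupp.single_apply, if_neg]
      rintro rfl
      exact hks hj
    rw [this]
    simp [cob]

end Coinduced

end ProP

namespace ProP

open Finset NCSeries FreeProP

/-! ### Functions on a quotient as functionals killing the relations. -/

section Presentation

variable {p d : ℕ} [Fact p.Prime] {K : Type*}

theorem closedNormalClosure_le {F : Type*} [Group F] [TopologicalSpace F] [IsTopologicalGroup F]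
    {S : Set F} {T : Subgroup F} [T.Normal] (hT : IsClosed (T : Set F)) (hS : S ⊆ T) :
    closedNormalClosure S ≤ T :=
  Subgroup.topologicalClosure_minimal _ (Subgroup.normalClosure_le_normal hS) hT

theorem subset_closedNormalClosure {F : Type*} [Group F] [TopologicalSpace F]
    [IsTopologicalGroup F] (S : Set F) : S ⊆ closedNormalClosure S :=
  Subgroup.subset_normalClosure.trans (Subgroup.le_topologicalClosure _)

theorem isClosed_closedNormalClosure {F : Type*} [Group F] [TopologicalSpace F]
    [IsTopologicalGroup F] (S : Set F) : IsClosed (closedNormalClosure S : Set F) :=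
  Subgroup.isClosed_topologicalClosure _

/-- The series `φ(x) - 1`, with `φ` the Magnus homomorphism. -/
noncomputable def magnusSub (x : FreeProP p d) : NCSeries (ZMod p) d := magnus x - 1

theorem magnusSub_nil (x : FreeProP p d) : magnusSub x [] = 0 := by
  rw [magnusSub, NCSeries.sub_apply, magnus_nil, one_apply, if_pos rfl, sub_self]

theorem magnusSub_mul (x y : FreeProP p d) :
    magnusSub (x * y) = magnusSub x * magnus y + magnusSub y := by
  simp only [magnusSub, map_mul]
  noncomm_ring

theorem magnusSub_inv (x : FreeProP p d) :
    magnusSub x⁻¹ = -(magnus x⁻¹ * magnusSub x) := by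
  have h : magnus x⁻¹ * magnus x = 1 := by rw [← map_mul, inv_mul_cancel, map_one]
  simp only [magnusSub, mul_sub, h]
  simp

theorem magnusSub_conj (x y : FreeProP p d) :
    magnusSub (y * x * y⁻¹) = magnus y * magnusSub x * magnus y⁻¹ := by
  have h : magnus y * magnus y⁻¹ = 1 := by rw [← map_mul, mul_inv_cancel, map_one]
  simp only [magnusSub, map_mul, mul_sub, sub_mul, mul_one, h]

theorem magnus_mul_sub (x y : FreeProP p d) :
    magnus (x * y) - magnus x = magnus x * magnusSub y := by
  simp only [magnusSub, map_mul]
  noncomm_ring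

theorem isLocallyConstant_mul_magnusSub_mul {l : NCSeries (ZMod p) d →ₗ[ZMod p] ZMod p}
    (hl : l ∈ smoothDual (ZMod p) d) (f g : NCSeries (ZMod p) d) :
    IsLocallyConstant fun x : FreeProP p d => l (f * magnusSub x * g) := by
  have h := isLocallyConstant_magnus (comp_mulLeft_mem (comp_mulRight_mem hl g) f)
  have e : (fun x : FreeProP p d => l (f * magnusSub x * g)) = (fun c => c - l (f * g)) ∘ fun x =>
      (l ∘ₗ LinearMap.mulRight (ZMod p) g ∘ₗ LinearMap.mulLeft (ZMod p) f) (magnus x) := by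
    funext x
    simp [magnusSub, mul_sub, sub_mul]
  rw [e]
  exact h.comp _

/-- If a smooth functional is multiplicative on the relations, it is so on the closed normal
subgroup they generate. -/
theorem apply_mul_magnusSub_mul {ρ : K → FreeProP p d}
    {l : NCSeries (ZMod p) d →ₗ[ZMod p] ZMod p} (hl : l ∈ smoothDual (ZMod p) d)
    (h : ∀ k f g, l (f * magnusSub (ρ k) * g) = f [] * g [] * l (magnusSub (ρ k)))
    {x : FreeProP p d} (hx : x ∈ closedNormalClosure (Set.range ρ)) (f g : NCSeries (ZMod p) d) :
    l (f * magnusSub x * g) = f [] * g [] * l (magnusSub x) := by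
  -- Quantifying over all `f` and `g` makes the condition stable under products, inverses and
  -- conjugation; as it is also closed, it passes to the closed normal subgroup.
  let T : Subgroup (FreeProP p d) :=
    { carrier := {x | ∀ f g, l (f * magnusSub x * g) = f [] * g [] * l (magnusSub x)}
      one_mem' := fun f g => by simp [magnusSub]
      mul_mem' := fun {x y} hx hy f g => by
        have h1 := hx f (magnus y * g)
        have h2 := hx 1 (magnus y)
        rw [mul_nil, magnus_nil, one_mul, ← mul_assoc] at h1
        rw [magnus_nil, one_apply, if_pos rfl, one_mul, one_mul, one_mul] at h2
        rw [magnusSub_mul, mul_add, add_mul, map_add, hy f g, ← mul_assoc f, h1, map_add, h2]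
        ring
      inv_mem' := fun {x} hx f g => by
        have h1 := hx (f * magnus x⁻¹) g
        have h2 := hx (magnus x⁻¹) 1
        rw [mul_nil, magnus_nil, mul_one] at h1
        rw [magnus_nil, one_apply, if_pos rfl, one_mul, one_mul, mul_one] at h2
        rw [magnusSub_inv, mul_neg, neg_mul, map_neg, map_neg, h2, ← mul_assoc, h1]
        ring }
  have hT : T.Normal := ⟨fun x hx y f g => by
    have h1 := hx (f * magnus y) (magnus y⁻¹ * g)
    have h2 := hx (magnus y) (magnus y⁻¹)
    rw [mul_nil, mul_nil, magnus_nil, magnus_nil, mul_one, one_mul] at h1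
    rw [magnus_nil, magnus_nil, mul_one, one_mul] at h2
    rw [magnusSub_conj, h2, ← h1]
    simp only [mul_assoc]⟩
  have hclosed : IsClosed (T : Set (FreeProP p d)) := by
    have : (T : Set (FreeProP p d)) = ⋂ f, ⋂ g,
        {x | l (f * magnusSub x * g) - f [] * g [] * l (magnusSub x) = 0} := by
      ext x; simp [T, sub_eq_zero]
    rw [this]
    refine isClosed_iInter fun f => isClosed_iInter fun g => ?_
    have h1 := isLocallyConstant_mul_magnusSub_mul hl f g
    have h2 := (isLocallyConstant_mul_magnusSub_mul hl 1 1).comp fun c => f [] * g [] * c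
    have h3 := (h1.sub h2).isClosed_fiber 0
    simpa using h3
  exact closedNormalClosure_le hclosed (by rintro _ ⟨k, rfl⟩; exact h k) hx f g

/-- A smooth functional that vanishes on the two-sided ideal generated by the relations vanishes on
the closed normal subgroup they generate. -/
theorem apply_mul_magnusSub_mul_eq_zero {ρ : K → FreeProP p d}
    {l : NCSeries (ZMod p) d →ₗ[ZMod p] ZMod p} (hl : l ∈ smoothDual (ZMod p) d)
    (h : ∀ k f g, l (f * magnusSub (ρ k) * g) = 0)
    {x : FreeProP p d} (hx : x ∈ closedNormalClosure (Set.range ρ)) (f g : NCSeries (ZMod p) d) :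
    l (f * magnusSub x * g) = 0 := by
  let T : Subgroup (FreeProP p d) :=
    { carrier := {x | ∀ f g, l (f * magnusSub x * g) = 0}
      one_mem' := fun f g => by simp [magnusSub]
      mul_mem' := fun {x y} hx hy f g => by
        rw [magnusSub_mul, mul_add, add_mul, map_add, hy f g, ← mul_assoc f, mul_assoc _ _ g,
          hx, add_zero]
      inv_mem' := fun {x} hx f g => by
        rw [magnusSub_inv, mul_neg, neg_mul, map_neg, ← mul_assoc, hx, neg_zero] }
  have hT : T.Normal := ⟨fun x hx y f g => by
    have h1 := hx (f * magnus y) (magnus y⁻¹ * g)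
    rw [magnusSub_conj, ← h1]
    simp only [mul_assoc]⟩
  have hclosed : IsClosed (T : Set (FreeProP p d)) := by
    have : (T : Set (FreeProP p d)) = ⋂ f, ⋂ g, {x | l (f * magnusSub x * g) = 0} := by
      ext x; simp [T]
    rw [this]
    exact isClosed_iInter fun f => isClosed_iInter fun g =>
      (isLocallyConstant_mul_magnusSub_mul hl f g).isClosed_fiber 0
  exact closedNormalClosure_le hclosed (by rintro _ ⟨k, rfl⟩; exact h k) hx f g

/-- `q` presents `Γ` as the quotient of the free pro-`p` group by the relations `ρ`. -/
structure IsPresentation {Γ : Type*} [Group Γ] [TopologicalSpace Γ] (q : FreeProP p d →* Γ)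
    (ρ : K → FreeProP p d) : Prop where
  isOpenQuotientMap : IsOpenQuotientMap q
  ker_eq : q.ker = closedNormalClosure (Set.range ρ)

theorem isLocallyConstant_of_comp {X Y α : Type*} [TopologicalSpace X] [TopologicalSpace Y]
    {q : X → Y} (hq : IsOpenQuotientMap q) {f : Y → α} (hf : IsLocallyConstant (f ∘ q)) :
    IsLocallyConstant f := fun s => by
  rw [← Set.image_preimage_eq (f ⁻¹' s) hq.surjective]
  exact hq.isOpenMap _ (hf s)

/-- The smooth functionals that vanish on the closed two-sided ideal generated by the relations. -/
def relDual (ρ : K → FreeProP p d) : Submodule (ZMod p) (NCSeries (ZMod p) d →ₗ[ZMod p] ZMod p) :=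
  smoothDual (ZMod p) d ⊓
    { carrier := {l | ∀ k f g, l (f * magnusSub (ρ k) * g) = 0}
      add_mem' := fun h h' k f g => by rw [LinearMap.add_apply, h, h', add_zero]
      zero_mem' := fun _ _ _ => rfl
      smul_mem' := fun c l h k f g => by rw [LinearMap.smul_apply, h, smul_zero] }

/-- Smoothness allows passing from monomials to arbitrary series one factor at a time, first on the
right, then on the left. -/
theorem mem_relDual_of_mono {ρ : K → FreeProP p d} {l : NCSeries (ZMod p) d →ₗ[ZMod p] ZMod p}
    (hl : l ∈ smoothDual (ZMod p) d)
    (h : ∀ k x y, l (mono (ZMod p) x * magnusSub (ρ k) * mono (ZMod p) y) = 0) :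
    l ∈ relDual ρ := by
  refine ⟨hl, fun k f g => ?_⟩
  have h1 : ∀ x, l ∘ₗ LinearMap.mulLeft (ZMod p) (mono (ZMod p) x * magnusSub (ρ k)) = 0 :=
    fun x => smoothDual_ext (comp_mulLeft_mem hl _) (Submodule.zero_mem _) fun y => h k x y
  have h2 : l ∘ₗ LinearMap.mulRight (ZMod p) (magnusSub (ρ k) * g) = 0 :=
    smoothDual_ext (comp_mulRight_mem hl _) (Submodule.zero_mem _) fun x => by
      have := LinearMap.congr_fun (h1 x) g
      simpa [mul_assoc] using this
  have := LinearMap.congr_fun h2 f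
  simpa [mul_assoc] using this

variable {Γ : Type*} [Group Γ] [TopologicalSpace Γ] {q : FreeProP p d →* Γ}

/-- The smooth functional attached to a locally constant function on a quotient of the free
pro-`p` group. -/
noncomputable def functional (hq : Continuous q) :
    LocallyConstant Γ (ZMod p) →ₗ[ZMod p] NCSeries (ZMod p) d →ₗ[ZMod p] ZMod p :=
  have H (h : LocallyConstant Γ (ZMod p)) :=
    exists_smoothDual (h.isLocallyConstant.comp_continuous hq)
  { toFun := fun h => (H h).choose
    map_add' := fun h h' => smoothDual_ext_magnus (H _).choose_spec.1
      ((smoothDual (ZMod p) d).add_mem (H h).choose_spec.1 (H h').choose_spec.1) fun x => by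
        rw [LinearMap.add_apply, ← (H _).choose_spec.2, ← (H _).choose_spec.2,
          ← (H _).choose_spec.2]
        rfl
    map_smul' := fun c h => smoothDual_ext_magnus (H _).choose_spec.1
      ((smoothDual (ZMod p) d).smul_mem c (H h).choose_spec.1) fun x => by
        rw [RingHom.id_apply, LinearMap.smul_apply, ← (H _).choose_spec.2, ← (H _).choose_spec.2]
        rfl }

theorem functional_mem (hq : Continuous q) (h : LocallyConstant Γ (ZMod p)) :
    functional hq h ∈ smoothDual (ZMod p) d :=
  (exists_smoothDual (h.isLocallyConstant.comp_continuous hq)).choose_spec.1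

theorem functional_magnus (hq : Continuous q) (h : LocallyConstant Γ (ZMod p))
    (x : FreeProP p d) : functional hq h (magnus x) = h (q x) :=
  ((exists_smoothDual (h.isLocallyConstant.comp_continuous hq)).choose_spec.2 x).symm

theorem eq_functional (hq : Continuous q) {l : NCSeries (ZMod p) d →ₗ[ZMod p] ZMod p}
    (hl : l ∈ smoothDual (ZMod p) d) {h : LocallyConstant Γ (ZMod p)}
    (H : ∀ x, l (magnus x) = h (q x)) : functional hq h = l :=
  smoothDual_ext_magnus (functional_mem hq h) hl fun x => by rw [functional_magnus, H]

/-- If `f` and `g` are Magnus images of y and z, the product is φ(yxz) - φ(yz), on which the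
functional vanishes because `q x = 1`. Smooth functionals are determined by Magnus images, which
settles first `g` and then `f`. -/
theorem functional_mul_magnusSub_mul (hq : Continuous q) (h : LocallyConstant Γ (ZMod p))
    {x : FreeProP p d} (hx : q x = 1) (f g : NCSeries (ZMod p) d) :
    functional hq h (f * magnusSub x * g) = 0 := by
  have hl := functional_mem hq h
  have h1 : ∀ y, functional hq h ∘ₗ LinearMap.mulLeft (ZMod p) (magnus y * magnusSub x) = 0 := by
    intro y
    refine smoothDual_eq_zero (comp_mulLeft_mem hl _) fun z => ?_
    have : magnus y * magnusSub x * magnus z = magnus (y * x * z) - magnus (y * z) := by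
      simp only [magnusSub, map_mul, mul_sub, sub_mul, mul_one]
    rw [LinearMap.comp_apply, LinearMap.mulLeft_apply, this, map_sub, functional_magnus,
      functional_magnus]
    simp [hx]
  have h2 : functional hq h ∘ₗ LinearMap.mulRight (ZMod p) (magnusSub x * g) = 0 := by
    refine smoothDual_eq_zero (comp_mulRight_mem hl _) fun y => ?_
    have := LinearMap.congr_fun (h1 y) g
    simpa [mul_assoc] using this
  have := LinearMap.congr_fun h2 f
  simpa [mul_assoc] using this

namespace IsPresentation

variable {ρ : K → FreeProP p d} (P : IsPresentation q ρ)

include P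

theorem continuous : Continuous q := P.isOpenQuotientMap.continuous

theorem surjective : Function.Surjective q := P.isOpenQuotientMap.surjective

theorem map_relation (k : K) : q (ρ k) = 1 := by
  rw [← MonoidHom.mem_ker, P.ker_eq]
  exact subset_closedNormalClosure _ ⟨k, rfl⟩

theorem functional_mem_relDual (h : LocallyConstant Γ (ZMod p)) :
    functional P.continuous h ∈ relDual ρ :=
  ⟨functional_mem _ h, fun k => functional_mul_magnusSub_mul _ h (P.map_relation k)⟩

/-- For n in the kernel, φ(xn) - φ(x) = φ(x)(φ(n) - 1) is killed by `l`, so `l` composed with φ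
descends to the quotient. It stays locally constant because `q` is open. -/
theorem exists_functional_eq {l : NCSeries (ZMod p) d →ₗ[ZMod p] ZMod p} (hl : l ∈ relDual ρ) :
    ∃ h, functional P.continuous h = l := by
  let s := Function.surjInv P.surjective
  have hs : ∀ x, l (magnus (s (q x))) = l (magnus x) := by
    intro x
    have h1 : x⁻¹ * s (q x) ∈ closedNormalClosure (Set.range ρ) := by
      rw [← P.ker_eq, MonoidHom.mem_ker, map_mul, map_inv, Function.surjInv_eq P.surjective]
      simp
    have h2 := apply_mul_magnusSub_mul_eq_zero hl.1 hl.2 h1 (magnus x) 1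
    rw [mul_one, ← magnus_mul_sub, mul_inv_cancel_left, map_sub, sub_eq_zero] at h2
    exact h2
  let h : LocallyConstant Γ (ZMod p) := ⟨fun y => l (magnus (s y)),
    isLocallyConstant_of_comp P.isOpenQuotientMap (by
      have e : (fun y => l (magnus (s y))) ∘ q = fun x => l (magnus x) := funext hs
      rw [e]
      exact isLocallyConstant_magnus hl.1)⟩
  exact ⟨h, eq_functional _ hl.1 fun x => (hs x).symm⟩

/-- Locally constant functions on the quotient are the same as smooth functionals killing the
relations. -/
noncomputable def equivRelDual : LocallyConstant Γ (ZMod p) ≃ₗ[ZMod p] relDual ρ :=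
  LinearEquiv.ofBijective ((functional P.continuous).codRestrict _ P.functional_mem_relDual) <| by
    refine ⟨fun h h' hh => LocallyConstant.ext fun y => ?_, fun l => ?_⟩
    · obtain ⟨x, rfl⟩ := P.surjective y
      rw [← functional_magnus P.continuous, ← functional_magnus P.continuous]
      exact LinearMap.congr_fun (congrArg Subtype.val hh) _
    · obtain ⟨h, hh⟩ := P.exists_functional_eq l.2
      exact ⟨h, Subtype.ext hh⟩

theorem equivRelDual_apply (h : LocallyConstant Γ (ZMod p)) :
    (P.equivRelDual h : NCSeries (ZMod p) d →ₗ[ZMod p] ZMod p) = functional P.continuous h := rfl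

theorem functional_symm (l : relDual ρ) :
    functional P.continuous (P.equivRelDual.symm l) = l := by
  rw [← P.equivRelDual_apply, LinearEquiv.apply_symm_apply]

theorem functional_injective : Function.Injective (functional P.continuous) := fun _ _ h =>
  P.equivRelDual.injective (Subtype.ext h)

end IsPresentation

end Presentation

end ProP

namespace ProP

open Finset NCSeries FreeProP

/-! ### The dual Lyndon resolution and vanishing above degree two. -/

section Resolution

variable {p d : ℕ} [Fact p.Prime] {K : Type*}

/-- Relations with combinatorially free highest terms impose independent conditions on smooth
functionals. -/
theorem CombinatoriallyFree.exists_functional {m : K → List (Fin d)} (hm : CombinatoriallyFree m)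
    {ρ : K → FreeProP p d} (hρ : ∀ k, HasHighestTerm (ρ k) (m k)) (η : K →₀ relDual ρ) :
    ∃ l ∈ smoothDual (ZMod p) d, ∀ k f g, l (f * magnusSub (ρ k) * g) = f [] * (η k).1 g := by
  classical
  have hb : ∀ k, ∃ n, ∀ f ∈ order (ZMod p) d n, (η k).1 f = 0 := fun k => (η k).2.1
  choose b hb using hb
  -- The bound exceeds the smoothness bound of every `η k` by at least the length of `m k`; hence
  -- the prescribed values vanish whenever `x ++ m k ++ y` has length at least `n`.
  let n := ∑ k ∈ η.support, (b k + (m k).length)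
  have hn : ∀ k ∈ η.support, b k + (m k).length ≤ n := fun k hk =>
    single_le_sum (f := fun k => b k + (m k).length) (fun _ _ => Nat.zero_le _) hk
  have hηn : ∀ k, ∀ f ∈ order (ZMod p) d n, (η k).1 f = 0 := by
    intro k f hf
    by_cases hk : k ∈ η.support
    · exact hb k f (order_anti (by have := hn k hk; omega) hf)
    · rw [Finsupp.notMem_support_iff.1 hk]; rfl
  -- The wanted values on x Z_k y. Both sides of the compatibility condition vanish: one because `η
  -- k` kills the relations, the other because `x ++ v ++ z` is empty only for empty `v`, where Z_k
  -- has coefficient zero.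
  let E : K → List (Fin d) → List (Fin d) → ZMod p := fun k x y =>
    if x = [] then (η k).1 (mono (ZMod p) y) else 0
  obtain ⟨ψ, hψ, -, hψE⟩ := hm.exists_extension (Z := fun k => magnusSub (ρ k)) hρ n E
    (by
      intro k x y hl
      simp only [E]
      split_ifs with hx
      · by_cases hk : k ∈ η.support
        · refine hb k _ (order_anti ?_ (mono_mem_order y))
          have := hn k hk
          subst hx
          simp only [List.nil_append, List.length_append] at hl
          omega
        · rw [Finsupp.notMem_support_iff.1 hk]; rfl
      · rfl)
    (by
      intro k l x y z
      have h1 : ∑ v ∈ words d n, magnusSub (ρ l) v * E k x (z ++ v ++ y) = 0 := by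
        simp only [E]
        split_ifs
        · rw [← apply_mono_mul_mul_mono (hηn k)]
          exact (η k).2.2 l _ _
        · simp
      rw [h1, sum_eq_zero]
      intro v _
      simp only [E]
      split_ifs with hv
      · have : v = [] := by
          simp only [List.append_eq_nil_iff] at hv
          exact hv.1.2
        rw [this, magnusSub_nil, zero_mul]
      · rw [mul_zero])
    (fun _ => 0)
  have hl := pairing_mem_smoothDual (R := ZMod p) (d := d) n ψ
  have hln : ∀ f ∈ order (ZMod p) d n, pairing n ψ f = 0 := fun f hf =>
    sum_eq_zero fun w hw => by rw [hf w (by simpa using hw), zero_mul]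
  refine ⟨pairing n ψ, hl, fun k f g => ?_⟩
  have key : ∀ x y, pairing n ψ (mono (ZMod p) x * magnusSub (ρ k) * mono (ZMod p) y) =
      E k x y := by
    intro x y
    rw [apply_mono_mul_mul_mono hln, ← hψE k x y]
    exact sum_congr rfl fun v _ => by rw [pairing_mono hψ]
  have h1 : ∀ x, pairing n ψ ∘ₗ LinearMap.mulLeft (ZMod p) (mono (ZMod p) x * magnusSub (ρ k)) =
      (mono (ZMod p) x []) • (η k).1 := by
    intro x
    refine smoothDual_ext (comp_mulLeft_mem hl _) (Submodule.smul_mem _ _ (η k).2.1) fun y => ?_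
    rw [LinearMap.comp_apply, LinearMap.mulLeft_apply, key, LinearMap.smul_apply, mono_apply]
    simp only [E, eq_comm (a := x)]
    split_ifs <;> simp
  have h2 : pairing n ψ ∘ₗ LinearMap.mulRight (ZMod p) (magnusSub (ρ k) * g) =
      (η k).1 g • constCoeffₗ (ZMod p) d := by
    refine smoothDual_ext (comp_mulRight_mem hl _) (Submodule.smul_mem _ _ constCoeffₗ_mem)
      fun x => ?_
    have := LinearMap.congr_fun (h1 x) g
    simp only [LinearMap.comp_apply, LinearMap.mulLeft_apply, LinearMap.smul_apply,
      smul_eq_mul] at this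
    rw [LinearMap.comp_apply, LinearMap.mulRight_apply, ← mul_assoc, this, LinearMap.smul_apply,
      constCoeffₗ_apply, smul_eq_mul, mul_comm]
  have := LinearMap.congr_fun h2 f
  simpa [mul_assoc, mul_comm] using this

namespace IsPresentation

variable {Γ : Type} [Group Γ] [TopologicalSpace Γ] [IsTopologicalGroup Γ]
  {q : FreeProP p d →* Γ} {ρ : K → FreeProP p d} (P : IsPresentation q ρ)

include P

theorem functional_rightRegular (x : FreeProP p d) (h : LocallyConstant Γ (ZMod p)) :
    functional P.continuous (rightRegular p Γ (q x) h) =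
      functional P.continuous h ∘ₗ LinearMap.mulRight (ZMod p) (magnus x) := by
  refine eq_functional _ (comp_mulRight_mem (functional_mem _ h) _) fun y => ?_
  rw [LinearMap.comp_apply, LinearMap.mulRight_apply, ← map_mul, functional_magnus, map_mul]
  rfl

/-- Left multiplication by a variable preserves the functionals that kill the relations. -/
noncomputable def varMul (a : Fin d) :
    LocallyConstant Γ (ZMod p) →ₗ[ZMod p] LocallyConstant Γ (ZMod p) :=
  P.equivRelDual.symm.toLinearMap ∘ₗ
    { toFun := fun h => ⟨functional P.continuous h ∘ₗ LinearMap.mulLeft (ZMod p) (X (ZMod p) a),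
        comp_mulLeft_mem (functional_mem _ h) _, fun k f g => by
          rw [LinearMap.comp_apply, LinearMap.mulLeft_apply, ← mul_assoc, ← mul_assoc]
          exact (P.functional_mem_relDual h).2 k _ _⟩
      map_add' := fun h h' => by ext; simp
      map_smul' := fun c h => by ext; simp }

theorem functional_varMul (a : Fin d) (h : LocallyConstant Γ (ZMod p)) :
    functional P.continuous (P.varMul a h) =
      functional P.continuous h ∘ₗ LinearMap.mulLeft (ZMod p) (X (ZMod p) a) :=
  P.functional_symm _

/-- The first map of the resolution. -/
noncomputable def resolutionOne :
    LocallyConstant Γ (ZMod p) →ₗ[ZMod p] Fin d →₀ LocallyConstant Γ (ZMod p) :=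
  (Finsupp.linearEquivFunOnFinite (ZMod p) (LocallyConstant Γ (ZMod p)) (Fin d)).symm.toLinearMap ∘ₗ
    LinearMap.pi P.varMul

theorem resolutionOne_apply (h : LocallyConstant Γ (ZMod p)) (a : Fin d) :
    P.resolutionOne h a = P.varMul a h := rfl

/-- The functional `g ↦ ∑ a, c_a (∂_a ρ_k · g)`. -/
noncomputable def foxFunctional (c : Fin d →₀ LocallyConstant Γ (ZMod p)) (k : K) : relDual ρ :=
  ⟨∑ a, functional P.continuous (c a) ∘ₗ LinearMap.mulLeft (ZMod p) (shift a (magnusSub (ρ k))),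
    Submodule.sum_mem _ fun a _ => ⟨comp_mulLeft_mem (functional_mem _ _) _, fun l f g => by
      rw [LinearMap.comp_apply, LinearMap.mulLeft_apply, ← mul_assoc, ← mul_assoc]
      exact (P.functional_mem_relDual _).2 l _ _⟩⟩

theorem foxFunctional_apply (c : Fin d →₀ LocallyConstant Γ (ZMod p)) (k : K)
    (g : NCSeries (ZMod p) d) : (P.foxFunctional c k).1 g =
      ∑ a, functional P.continuous (c a) (shift a (magnusSub (ρ k)) * g) := by
  simp [foxFunctional]

/-- A relation whose order exceeds the smoothness bounds of all `c a` has Fox derivatives killed by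
every `c a`. Hence the second map lands in the direct sum, not merely in the product. -/
theorem finite_support_foxFunctional
    (hfin : ∀ n, {k | magnusSub (ρ k) ∉ order (ZMod p) d n}.Finite)
    (c : Fin d →₀ LocallyConstant Γ (ZMod p)) :
    (Function.support fun k => P.equivRelDual.symm (P.foxFunctional c k)).Finite := by
  have hb : ∀ a, ∃ n, ∀ f ∈ order (ZMod p) d n, functional P.continuous (c a) f = 0 :=
    fun a => functional_mem _ _
  choose b hb using hb
  refine (hfin (∑ a, b a + 1)).subset fun k hk hmem => hk ?_
  rw [LinearEquiv.map_eq_zero_iff]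
  refine Subtype.ext (LinearMap.ext fun g => ?_)
  rw [foxFunctional_apply]
  refine sum_eq_zero fun a _ =>
    hb a _ (mul_mem_order_left (order_anti ?_ (shift_mem_order a hmem)) g)
  exact single_le_sum (f := b) (fun _ _ => Nat.zero_le _) (mem_univ a)

/-- The second map of the resolution. -/
noncomputable def resolutionTwo (hfin : ∀ n, {k | magnusSub (ρ k) ∉ order (ZMod p) d n}.Finite) :
    (Fin d →₀ LocallyConstant Γ (ZMod p)) →ₗ[ZMod p] K →₀ LocallyConstant Γ (ZMod p) where
  toFun c := Finsupp.ofSupportFinite (fun k => P.equivRelDual.symm (P.foxFunctional c k))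
    (P.finite_support_foxFunctional hfin c)
  map_add' c c' := by
    refine Finsupp.ext fun k => ?_
    change P.equivRelDual.symm _ = P.equivRelDual.symm _ + P.equivRelDual.symm _
    rw [← map_add]
    refine congrArg _ (Subtype.ext (LinearMap.ext fun g => ?_))
    simp [foxFunctional_apply, sum_add_distrib]
  map_smul' s c := by
    refine Finsupp.ext fun k => ?_
    change P.equivRelDual.symm _ = s • P.equivRelDual.symm _
    rw [← map_smul]
    refine congrArg _ (Subtype.ext (LinearMap.ext fun g => ?_))
    simp [foxFunctional_apply, mul_sum]

variable (hfin : ∀ n, {k | magnusSub (ρ k) ∉ order (ZMod p) d n}.Finite)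

theorem functional_resolutionTwo (c : Fin d →₀ LocallyConstant Γ (ZMod p)) (k : K)
    (g : NCSeries (ZMod p) d) : functional P.continuous (P.resolutionTwo hfin c k) g =
      ∑ a, functional P.continuous (c a) (shift a (magnusSub (ρ k)) * g) := by
  change functional P.continuous (P.equivRelDual.symm _) g = _
  rw [P.functional_symm, foxFunctional_apply]

/-- The group acts through right multiplication of series, whereas the maps of the complex use left
multiplication; the two commute. -/
theorem resolutionOne_equivariant (g : Γ) (h : LocallyConstant Γ (ZMod p)) :
    P.resolutionOne (rightRegular p Γ g h) =
      finsuppRep (Fin d) (rightRegular p Γ) g (P.resolutionOne h) := by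
  obtain ⟨x, rfl⟩ := P.surjective g
  refine Finsupp.ext fun a => P.functional_injective (LinearMap.ext fun f => ?_)
  rw [finsuppRep_apply, resolutionOne_apply, resolutionOne_apply, functional_varMul,
    P.functional_rightRegular, P.functional_rightRegular, functional_varMul]
  simp [mul_assoc]

theorem resolutionTwo_equivariant (g : Γ) (c : Fin d →₀ LocallyConstant Γ (ZMod p)) :
    P.resolutionTwo hfin (finsuppRep (Fin d) (rightRegular p Γ) g c) =
      finsuppRep K (rightRegular p Γ) g (P.resolutionTwo hfin c) := by
  obtain ⟨x, rfl⟩ := P.surjective g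
  refine Finsupp.ext fun k => P.functional_injective (LinearMap.ext fun f => ?_)
  rw [finsuppRep_apply, P.functional_rightRegular, LinearMap.comp_apply, functional_resolutionTwo,
    functional_resolutionTwo]
  refine sum_congr rfl fun a _ => ?_
  rw [finsuppRep_apply, P.functional_rightRegular]
  simp [mul_assoc]

theorem resolutionOne_const (s : ZMod p) :
    P.resolutionOne (LocallyConstant.const Γ s) = 0 := by
  refine Finsupp.ext fun a => P.functional_injective (LinearMap.ext fun f => ?_)
  have : functional P.continuous (LocallyConstant.const Γ s) = s • constCoeffₗ (ZMod p) d :=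
    eq_functional _ (Submodule.smul_mem _ _ constCoeffₗ_mem) fun x => by simp [magnus_nil]
  rw [resolutionOne_apply, functional_varMul, this]
  simp [X_mul_nil]

/-- Such a function kills every X_a f, hence everything in φ(x) = 1 + ∑ X_a ∂_a φ(x) except the
constant term. -/
theorem eq_const_of_resolutionOne {h : LocallyConstant Γ (ZMod p)} (hh : P.resolutionOne h = 0) :
    ∃ s, LocallyConstant.const Γ s = h := by
  refine ⟨h 1, LocallyConstant.ext fun y => ?_⟩
  obtain ⟨x, rfl⟩ := P.surjective y
  have h1 : ∀ a f, functional P.continuous h (X (ZMod p) a * f) = 0 := by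
    intro a f
    have := P.functional_varMul a h
    rw [← resolutionOne_apply, hh] at this
    have := LinearMap.congr_fun this f
    simpa using this.symm
  have h2 : h (q x) = h 1 := by
    rw [← functional_magnus P.continuous, eq_const_add_sum_shift (magnus x), map_add, map_sum,
      sum_eq_zero fun a _ => h1 a _, add_zero, magnus_nil, one_smul,
      ← map_one (magnus (p := p) (d := d)), functional_magnus, map_one]
  exact h2.symm

/-- This is the fundamental formula of Fox calculus, ∑ X_a ∂_a ρ = φ(ρ) - 1, followed by the fact
that `h` kills the relations. -/
theorem resolutionTwo_resolutionOne (h : LocallyConstant Γ (ZMod p)) :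
    P.resolutionTwo hfin (P.resolutionOne h) = 0 := by
  refine Finsupp.ext fun k => P.functional_injective (LinearMap.ext fun f => ?_)
  rw [functional_resolutionTwo]
  simp only [resolutionOne_apply, functional_varMul, LinearMap.comp_apply, LinearMap.mulLeft_apply,
    ← mul_assoc]
  rw [← map_sum, ← sum_mul, sum_X_mul_shift (magnusSub_nil _)]
  have := (P.functional_mem_relDual h).2 k 1 f
  simpa using this

/-- The candidate is l(f) = ∑ c_a(∂_a f), for which l(X_a f) = c_a(f). By the product rule, l(f Z_k
g) is `f []` times the `k`-th component of the second map at `g`, plus values of the `c a` on the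
ideal, and so vanishes. -/
theorem exists_resolutionOne_eq {c : Fin d →₀ LocallyConstant Γ (ZMod p)}
    (hc : P.resolutionTwo hfin c = 0) : ∃ h, P.resolutionOne h = c := by
  let l : NCSeries (ZMod p) d →ₗ[ZMod p] ZMod p :=
    ∑ a, functional P.continuous (c a) ∘ₗ shiftₗ (ZMod p) a
  have hl : ∀ f, l f = ∑ a, functional P.continuous (c a) (shift a f) := fun f => by simp [l]
  have hmem : l ∈ relDual ρ := by
    refine ⟨Submodule.sum_mem _ fun a _ => comp_shift_mem (functional_mem _ _) a,
      fun k f g => ?_⟩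
    have h1 : ∀ a, shift a (f * magnusSub (ρ k) * g) =
        f [] • (shift a (magnusSub (ρ k)) * g) + shift a f * magnusSub (ρ k) * g := by
      intro a
      rw [shift_mul, mul_nil, magnusSub_nil, mul_zero, zero_smul, zero_add, shift_mul, add_mul,
        smul_mul_assoc]
    have h2 : ∀ a, functional P.continuous (c a) (shift a f * magnusSub (ρ k) * g) = 0 :=
      fun a => (P.functional_mem_relDual (c a)).2 k _ _
    rw [hl]
    simp only [h1, map_add, map_smul, h2, add_zero]
    rw [← smul_sum, ← P.functional_resolutionTwo hfin, hc]
    simp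
  obtain ⟨h, hh⟩ := P.exists_functional_eq hmem
  refine ⟨h, Finsupp.ext fun a => P.functional_injective (LinearMap.ext fun f => ?_)⟩
  rw [resolutionOne_apply, functional_varMul, hh, LinearMap.comp_apply, LinearMap.mulLeft_apply, hl,
    sum_eq_single a]
  · rw [shift_X_mul, if_pos rfl]
  · intro b _ hb
    rw [shift_X_mul, if_neg hb, map_zero]
  · simp

/-- The only exactness statement that uses combinatorial freeness. The functional with l(f Z_k g) =
f(1) e_k(g), where f(1) is the constant term, need not kill the relations, but its compositions with
left multiplication by the X_a do, as X_a f has no constant term. -/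
theorem resolutionTwo_surjective {m : K → List (Fin d)} (hm : CombinatoriallyFree m)
    (hρ : ∀ k, HasHighestTerm (ρ k) (m k)) : Function.Surjective (P.resolutionTwo hfin) := by
  intro e
  obtain ⟨l, hl, hl'⟩ := hm.exists_functional hρ
    (e.mapRange P.equivRelDual (map_zero _))
  have hmem : ∀ a, l ∘ₗ LinearMap.mulLeft (ZMod p) (X (ZMod p) a) ∈ relDual ρ := by
    refine fun a => ⟨comp_mulLeft_mem hl _, fun k f g => ?_⟩
    rw [LinearMap.comp_apply, LinearMap.mulLeft_apply, ← mul_assoc, ← mul_assoc, hl', X_mul_nil,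
      zero_mul]
  refine ⟨Finsupp.equivFunOnFinite.symm fun a => P.equivRelDual.symm ⟨_, hmem a⟩, ?_⟩
  refine Finsupp.ext fun k => P.functional_injective (LinearMap.ext fun g => ?_)
  rw [functional_resolutionTwo]
  simp only [Finsupp.equivFunOnFinite_symm_apply_apply, P.functional_symm, LinearMap.comp_apply,
    LinearMap.mulLeft_apply, ← mul_assoc]
  rw [← map_sum, ← sum_mul, sum_X_mul_shift (magnusSub_nil _)]
  have := hl' k 1 g
  rw [one_mul, one_apply, if_pos rfl, one_mul, Finsupp.mapRange_apply] at this
  exact this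

variable [CompactSpace Γ]

/-- Cohomology vanishes above degree two for relations with combinatorially free highest terms. -/
theorem cohomologyVanishes {m : K → List (Fin d)} (hm : CombinatoriallyFree m)
    (hρ : ∀ k, HasHighestTerm (ρ k) (m k))
    (hfin : ∀ n, {k | magnusSub (ρ k) ∉ order (ZMod p) d n}.Finite) (n : ℕ) :
    CohomologyVanishes (Representation.trivial (ZMod p) Γ (ZMod p)) (n + 2) := by
  let d₂ := P.resolutionTwo hfin
  have hstab : ∀ g, ∀ c ∈ LinearMap.ker d₂,
      finsuppRep (Fin d) (rightRegular p Γ) g c ∈ LinearMap.ker d₂ := by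
    intro g c hc
    rw [LinearMap.mem_ker] at hc ⊢
    rw [P.resolutionTwo_equivariant hfin, hc, map_zero]
  let σ : Representation (ZMod p) Γ (LinearMap.ker d₂) :=
    { toFun := fun g => (finsuppRep (Fin d) (rightRegular p Γ) g).restrict (hstab g)
      map_one' := by ext; simp
      map_mul' := fun g g' => by ext; simp }
  -- The four-term resolution is split at the kernel of the second map into two short exact
  -- sequences, each shifting the degree by one.
  have h1 : CohomologyVanishes σ (n + 1) :=
    CohomologyVanishes.of_exact (ρM := finsuppRep (Fin d) (rightRegular p Γ))
      (ρN := finsuppRep K (rightRegular p Γ)) (i := (LinearMap.ker d₂).subtype) (q := d₂)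
      (isLocallyConstant_finsuppRep isLocallyConstant_rightRegular)
      (fun _ _ => rfl) (P.resolutionTwo_equivariant hfin) Subtype.val_injective
      (fun c => c.2) (fun c hc => ⟨⟨c, hc⟩, rfl⟩) (P.resolutionTwo_surjective hfin hm hρ)
      (rightRegular_vanishes _).finsupp (rightRegular_vanishes _).finsupp
  exact CohomologyVanishes.of_exact (ρM := rightRegular p Γ) (ρN := σ)
      (i := ⟨⟨LocallyConstant.const Γ, fun _ _ => rfl⟩, fun _ _ => rfl⟩)
      (q := P.resolutionOne.codRestrict _ (P.resolutionTwo_resolutionOne hfin))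
      isLocallyConstant_rightRegular (fun _ _ => rfl)
      (fun g h => Subtype.ext (P.resolutionOne_equivariant g h))
      (fun _ _ h => congrArg (fun f : LocallyConstant Γ (ZMod p) => f 1) h)
      (fun s => Subtype.ext (P.resolutionOne_const s))
      (fun h hh => P.eq_const_of_resolutionOne (congrArg Subtype.val hh))
      (fun c => by
        obtain ⟨h, hh⟩ := P.exists_resolutionOne_eq hfin c.2
        exact ⟨h, Subtype.ext hh⟩)
      (rightRegular_vanishes _) h1

end IsPresentation

/-- The cocycles of a group are coboundaries if cohomology with trivial coefficients vanishes. -/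
theorem CohomologyVanishes.mem_coboundaries {Γ : Type} [Group Γ] [TopologicalSpace Γ] {n : ℕ}
    (h : CohomologyVanishes (Representation.trivial (ZMod p) Γ (ZMod p)) n)
    {f : (Fin (n + 1) → Γ) → ZMod p} (hf : f ∈ cocycles p Γ (n + 1)) :
    f ∈ coboundaries p Γ (n + 1) := by
  obtain ⟨g, hg, hgf⟩ := h f hf.1 (by rw [cob_trivial]; exact hf.2)
  exact ⟨g, hg, by rw [← cob_trivial, hgf]⟩

end Resolution

end ProP

namespace ProP

open Finset NCSeries FreeProP

/-! ### Transgression from functions additive along the kernel to H². -/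

section Transgression

theorem coboundary_one_apply {p : ℕ} {Γ : Type*} [Group Γ] (b : (Fin 1 → Γ) → ZMod p)
    (g : Fin 2 → Γ) : coboundary p Γ 1 b g =
      b (fun _ => g 1) - b (fun _ => g 0 * g 1) + b (fun _ => g 0) := by
  have h1 : Fin.contractNth (0 : Fin 2) (· * ·) g = fun _ => g 0 * g 1 := by
    ext i; fin_cases i; rfl
  have h2 : Fin.contractNth (1 : Fin 2) (· * ·) g = fun _ => g 0 := by
    ext i; fin_cases i; rfl
  have h0 : (fun i : Fin 1 => g i.succ) = fun _ => g 1 := by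
    ext i; fin_cases i; rfl
  rw [coboundary_apply, Fin.sum_univ_two, h0, h1, h2]
  simp
  ring

theorem coboundary_two_apply {p : ℕ} {Γ : Type*} [Group Γ] (f : (Fin 2 → Γ) → ZMod p)
    (g : Fin 3 → Γ) : coboundary p Γ 2 f g =
      f ![g 1, g 2] - f ![g 0 * g 1, g 2] + f ![g 0, g 1 * g 2] - f ![g 0, g 1] := by
  have e0 : (fun i : Fin 2 => g i.succ) = ![g 1, g 2] := by
    ext i; fin_cases i <;> rfl
  have e1 : Fin.contractNth (0 : Fin 3) (· * ·) g = ![g 0 * g 1, g 2] := by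
    ext i; fin_cases i <;> rfl
  have e2 : Fin.contractNth (1 : Fin 3) (· * ·) g = ![g 0, g 1 * g 2] := by
    ext i; fin_cases i <;> rfl
  have e3 : Fin.contractNth (2 : Fin 3) (· * ·) g = ![g 0, g 1] := by
    ext i; fin_cases i <;> rfl
  rw [coboundary_apply, Fin.sum_univ_three, e0, e1, e2, e3]
  simp
  ring

theorem coboundary_comp {p : ℕ} {F Γ : Type*} [Group F] [Group Γ] (q : F →* Γ) (n : ℕ)
    (f : (Fin n → Γ) → ZMod p) (x : Fin (n + 1) → F) :
    coboundary p F n (fun y => f fun i => q (y i)) x = coboundary p Γ n f fun i => q (x i) := by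
  rw [coboundary_apply, coboundary_apply]
  congr 1
  refine sum_congr rfl fun j _ => ?_
  congr 2
  funext k
  simp only [Fin.contractNth]
  split_ifs <;> simp

variable {p d : ℕ} {Γ : Type*} [Group Γ] [TopologicalSpace Γ]

/-- The locally constant functions on the free pro-`p` group that are additive for multiplication
by elements of the kernel. -/
def primitives (q : FreeProP p d →* Γ) : Submodule (ZMod p) (FreeProP p d → ZMod p) where
  carrier := {a | IsLocallyConstant a ∧ ∀ n ∈ q.ker, ∀ x,
    a (n * x) = a n + a x ∧ a (x * n) = a x + a n}
  add_mem' ha hb := ⟨ha.1.add hb.1, fun n hn x => by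
    simp only [Pi.add_apply, (ha.2 n hn x).1, (hb.2 n hn x).1, (ha.2 n hn x).2, (hb.2 n hn x).2]
    constructor <;> ring⟩
  zero_mem' := ⟨IsLocallyConstant.const 0, fun _ _ _ => by simp⟩
  smul_mem' c a ha := ⟨ha.1.comp (c * ·), fun n hn x => by
    simp only [Pi.smul_apply, (ha.2 n hn x).1, (ha.2 n hn x).2, smul_eq_mul]
    constructor <;> ring⟩

variable {q : FreeProP p d →* Γ}

theorem primitives_one {a : FreeProP p d → ZMod p} (ha : a ∈ primitives q) : a 1 = 0 := by
  have := (ha.2 1 (Subgroup.one_mem _) 1).1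
  simpa using this

/-- Compare both additivity rules on n y = y (y⁻¹ n y). -/
theorem primitives_conj {a : FreeProP p d → ZMod p} (ha : a ∈ primitives q) {n : FreeProP p d}
    (hn : n ∈ q.ker) (y : FreeProP p d) : a (y⁻¹ * n * y) = a n := by
  have hn' : y⁻¹ * n * y ∈ q.ker := by
    have := q.normal_ker.conj_mem n hn y⁻¹
    simpa using this
  have h1 := (ha.2 n hn y).1
  have h2 := (ha.2 _ hn' y).2
  rw [show y * (y⁻¹ * n * y) = n * y by group] at h2
  linear_combination h1 - h2

/-- The difference `a(x) + a(y) - a(xy)` only depends on the images of `x` and `y`. -/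
theorem primitives_delta {a : FreeProP p d → ZMod p} (ha : a ∈ primitives q)
    {x x' y y' : FreeProP p d} (hx : q x = q x') (hy : q y = q y') :
    a y' - a (x' * y') + a x' = a y - a (x * y) + a x := by
  obtain ⟨n, hn, rfl⟩ : ∃ n ∈ q.ker, x' = x * n :=
    ⟨x⁻¹ * x', by simp [MonoidHom.mem_ker, hx], by simp⟩
  obtain ⟨m, hm, rfl⟩ : ∃ n ∈ q.ker, y' = y * n :=
    ⟨y⁻¹ * y', by simp [MonoidHom.mem_ker, hy], by simp⟩
  have hn' : y⁻¹ * n * y ∈ q.ker := by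
    have := q.normal_ker.conj_mem n hn y⁻¹
    simpa using this
  have h1 : x * n * (y * m) = x * y * (y⁻¹ * n * y) * m := by group
  rw [h1, (ha.2 m hm (x * y * _)).2, (ha.2 _ hn' _).2, primitives_conj ha hn, (ha.2 m hm _).2,
    (ha.2 n hn _).2]
  ring

/-- The cochain on the quotient attached to a primitive function. -/
noncomputable def deltaCochain (hq : Function.Surjective q) (a : FreeProP p d → ZMod p) :
    (Fin 2 → Γ) → ZMod p := fun g =>
  a (Function.surjInv hq (g 1)) - a (Function.surjInv hq (g 0) * Function.surjInv hq (g 1)) +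
    a (Function.surjInv hq (g 0))

theorem deltaCochain_apply (hq : Function.Surjective q) {a : FreeProP p d → ZMod p}
    (ha : a ∈ primitives q) (x : Fin 2 → FreeProP p d) :
    deltaCochain hq a (fun i => q (x i)) = a (x 1) - a (x 0 * x 1) + a (x 0) :=
  primitives_delta ha (Function.surjInv_eq hq _).symm (Function.surjInv_eq hq _).symm

theorem isLocallyConstant_delta {a : FreeProP p d → ZMod p} (ha : IsLocallyConstant a) :
    IsLocallyConstant fun x : Fin 2 → FreeProP p d => a (x 1) - a (x 0 * x 1) + a (x 0) :=
  ((ha.comp_continuous (f := fun x : Fin 2 → FreeProP p d => x 1) (by fun_prop)).sub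
    (ha.comp_continuous (f := fun x : Fin 2 → FreeProP p d => x 0 * x 1) (by fun_prop))).add
    (ha.comp_continuous (f := fun x : Fin 2 → FreeProP p d => x 0) (by fun_prop))

theorem isOpenQuotientMap_pi (hq : IsOpenQuotientMap q) (n : ℕ) :
    IsOpenQuotientMap fun (x : Fin n → FreeProP p d) (i : Fin n) => q (x i) :=
  IsOpenQuotientMap.piMap fun _ => hq

theorem deltaCochain_mem (hq : IsOpenQuotientMap q) {a : FreeProP p d → ZMod p}
    (ha : a ∈ primitives q) : deltaCochain hq.surjective a ∈ cocycles p Γ 2 := by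
  refine ⟨?_, LinearMap.mem_ker.2 (funext fun g => ?_)⟩
  · refine isLocallyConstant_of_comp (isOpenQuotientMap_pi hq 2) ?_
    have : (deltaCochain hq.surjective a ∘ fun (x : Fin 2 → FreeProP p d) i => q (x i)) =
        fun x => a (x 1) - a (x 0 * x 1) + a (x 0) := funext (deltaCochain_apply _ ha)
    rw [this]
    exact isLocallyConstant_delta ha.1
  · obtain ⟨x, rfl⟩ := (isOpenQuotientMap_pi hq 3).surjective g
    rw [← coboundary_comp, coboundary_two_apply]
    simp only [deltaCochain_apply _ ha]
    simp [mul_assoc]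
    ring

/-- The transgression from primitive functions to the second cohomology of the quotient. -/
noncomputable def transgress (hq : IsOpenQuotientMap q) :
    primitives q →ₗ[ZMod p] Cohomology p Γ 2 :=
  (Submodule.mkQ _) ∘ₗ
    { toFun := fun a => ⟨deltaCochain hq.surjective a.1, deltaCochain_mem hq a.2⟩
      map_add' := fun a b => by
        refine Subtype.ext (funext fun g => ?_)
        simp only [deltaCochain, Submodule.coe_add, Pi.add_apply]
        ring
      map_smul' := fun c a => by
        refine Subtype.ext (funext fun g => ?_)
        simp only [deltaCochain, Submodule.coe_smul, Pi.smul_apply, smul_eq_mul, RingHom.id_apply]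
        ring }

theorem transgress_eq_mk (hq : IsOpenQuotientMap q) (a : primitives q) (f : cocycles p Γ 2)
    (h : ∀ x : Fin 2 → FreeProP p d, f.1 (fun i => q (x i)) =
      a.1 (x 1) - a.1 (x 0 * x 1) + a.1 (x 0)) :
    transgress hq a = Submodule.Quotient.mk f := by
  refine congrArg (Submodule.Quotient.mk) (Subtype.ext (funext fun g => ?_))
  obtain ⟨x, rfl⟩ := (isOpenQuotientMap_pi hq 2).surjective g
  rw [h]
  exact deltaCochain_apply _ a.2 x

/-- If all homomorphisms to `𝔽_p` vanish on the kernel, the kernel of the transgression consists of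
the functions that vanish on the kernel. -/
theorem transgress_eq_zero_iff (hq : IsOpenQuotientMap q)
    (hmin : ∀ χ : FreeProP p d → ZMod p, IsLocallyConstant χ → (∀ x y, χ (x * y) = χ x + χ y) →
      ∀ n ∈ q.ker, χ n = 0) (a : primitives q) :
    transgress hq a = 0 ↔ ∀ n ∈ q.ker, a.1 n = 0 := by
  constructor
  · intro h
    obtain ⟨b, hb, hba⟩ := (Submodule.Quotient.mk_eq_zero _).1 h
    have hb' : IsLocallyConstant b := hb
    have key : ∀ x y, b (fun _ => q y) - b (fun _ => q (x * y)) + b (fun _ => q x) =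
        a.1 y - a.1 (x * y) + a.1 x := by
      intro x y
      have h1 := congrFun hba fun i => q ((![x, y] : Fin 2 → FreeProP p d) i)
      rw [coboundary_one_apply] at h1
      have h2 := deltaCochain_apply hq.surjective a.2 ![x, y]
      simp only [Matrix.cons_val_zero, Matrix.cons_val_one] at h1 h2
      rw [map_mul, ← h2]
      exact h1
    -- When δa is the coboundary of a cochain `b` on the quotient, a - b ∘ q is a homomorphism on
    -- the free group, to which minimality applies.
    have hχ := hmin (fun x => a.1 x - b fun _ => q x)
      (IsLocallyConstant.sub a.2.1 (hb'.comp_continuous (f := fun x (_ : Fin 1) => q x)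
        (continuous_pi fun _ => hq.continuous)))
      (fun x y => by linear_combination key x y)
    intro n hn
    have h1 := hχ n hn
    have h2 := hχ 1 (Subgroup.one_mem _)
    rw [MonoidHom.mem_ker.1 hn] at h1
    rw [map_one, primitives_one a.2] at h2
    linear_combination h1 - h2
  · intro h
    -- Conversely, a primitive function vanishing on the kernel is constant on cosets and descends
    -- to a cochain bounding the transgressed class.
    have hs : ∀ x, a.1 (Function.surjInv hq.surjective (q x)) = a.1 x := by
      intro x
      have hn : x⁻¹ * Function.surjInv hq.surjective (q x) ∈ q.ker := by
        rw [MonoidHom.mem_ker, map_mul, map_inv, Function.surjInv_eq hq.surjective]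
        simp
      have h1 := (a.2.2 _ hn x).2
      rw [mul_inv_cancel_left, h _ hn, add_zero] at h1
      exact h1
    refine (Submodule.Quotient.mk_eq_zero _).2 ⟨fun g => a.1 (Function.surjInv hq.surjective (g 0)),
      ?_, funext fun g => ?_⟩
    · refine isLocallyConstant_of_comp (isOpenQuotientMap_pi hq 1) ?_
      have : ((fun g : Fin 1 → Γ => a.1 (Function.surjInv hq.surjective (g 0))) ∘
          fun (x : Fin 1 → FreeProP p d) i => q (x i)) = fun x => a.1 (x 0) :=
        funext fun x => hs (x 0)
      rw [this]
      have ha : IsLocallyConstant a.1 := a.2.1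
      exact ha.comp_continuous (f := fun x : Fin 1 → FreeProP p d => x 0) (by fun_prop)
    · obtain ⟨x, rfl⟩ := (isOpenQuotientMap_pi hq 2).surjective g
      rw [coboundary_one_apply]
      refine Eq.trans ?_ (deltaCochain_apply hq.surjective a.2 x).symm
      rw [← map_mul, hs, hs, hs]

/-- The second cohomology is infinite-dimensional if infinitely many relations can be separated by
primitive functions. -/
theorem not_finite_cohomology_two [Fact p.Prime] {K : Type*} [Infinite K] [DecidableEq K]
    {ρ : K → FreeProP p d}
    (hq : IsOpenQuotientMap q) (hρ : ∀ k, ρ k ∈ q.ker)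
    (hmin : ∀ χ : FreeProP p d → ZMod p, IsLocallyConstant χ → (∀ x y, χ (x * y) = χ x + χ y) →
      ∀ n ∈ q.ker, χ n = 0)
    (hsep : ∀ k, ∃ a ∈ primitives q, ∀ l, a (ρ l) = if k = l then 1 else 0) :
    ¬ Module.Finite (ZMod p) (Cohomology p Γ 2) := by
  intro hfin
  choose a ha hak using hsep
  have hli : LinearIndependent (ZMod p) fun k => transgress hq ⟨a k, ha k⟩ := by
    rw [linearIndependent_iff']
    intro s c hc k hk
    have h1 : transgress hq (∑ k ∈ s, c k • (⟨a k, ha k⟩ : primitives q)) = 0 := by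
      rw [map_sum, ← hc]
      exact sum_congr rfl fun k _ => map_smul _ _ _
    -- A linear relation among the classes is a primitive function vanishing on the whole kernel;
    -- its value at `ρ k` is the `k`-th coefficient.
    have h2 := (transgress_eq_zero_iff hq hmin _).1 h1 (ρ k) (hρ k)
    rw [Submodule.coe_sum, Finset.sum_apply, sum_eq_single k] at h2
    · simpa [hak] using h2
    · intro j _ hj
      simp [hak, hj]
    · exact fun h => absurd hk h
  exact not_finite_iff_infinite.2 ‹Infinite K› hli.finite

end Transgression

end ProP

namespace ProP

open Finset NCSeries FreeProP

/-! ### Homomorphisms and partially additive functions on finite `p`-groups. -/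

section FinitePGroup

variable {p : ℕ} [Fact p.Prime]

/-- A proper subgroup of a finite `p`-group is killed by a nonzero homomorphism to `𝔽_p`. -/
theorem exists_hom_of_ne_top {B : Type*} [Group B] [Finite B] (hB : IsPGroup p B) (A : Subgroup B)
    (hA : A ≠ ⊤) : ∃ χ : B → ZMod p, (∀ x y, χ (x * y) = χ x + χ y) ∧ (∀ x ∈ A, χ x = 0) ∧
      ∃ x, χ x ≠ 0 := by
  -- A maximal subgroup of a finite `p`-group is normal with quotient of order `p`, which provides
  -- the homomorphism.
  obtain ⟨M, hM, hAM⟩ := (eq_top_or_exists_le_coatom A).resolve_left hA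
  have hnil : Group.IsNilpotent B := hB.isNilpotent
  have hnorm : M.Normal := 
    Subgroup.NormalizerCondition.normal_of_coatom M Group.normalizerCondition_of_isNilpotent hM
  have hQ : IsPGroup p (B ⧸ M) := hB.to_quotient M
  have hnt : Nontrivial (B ⧸ M) := by
    by_contra h
    rw [not_nontrivial_iff_subsingleton] at h
    exact hM.1 (QuotientGroup.subgroup_eq_top_of_subsingleton M h)
  have hdvd : p ∣ Nat.card (B ⧸ M) := by
    obtain ⟨k, hk⟩ := IsPGroup.iff_card.1 hQ
    rw [hk]
    refine dvd_pow_self p fun h0 => ?_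
    rw [h0, pow_zero] at hk
    exact (Finite.one_lt_card (α := B ⧸ M)).ne' hk
  obtain ⟨g, hg⟩ := exists_prime_orderOf_dvd_card' p hdvd
  have htop : Subgroup.zpowers g = ⊤ := by
    have h1 : M < (Subgroup.zpowers g).comap (QuotientGroup.mk' M) := by
      obtain ⟨b, rfl⟩ := QuotientGroup.mk_surjective g
      refine lt_of_le_of_ne (fun x hx => ?_) fun h => ?_
      · rw [Subgroup.mem_comap, QuotientGroup.mk'_apply, (QuotientGroup.eq_one_iff x).2 hx]
        exact Subgroup.one_mem _
      · have hb : b ∈ M := by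
          rw [h, Subgroup.mem_comap]
          exact Subgroup.mem_zpowers _
        rw [(QuotientGroup.eq_one_iff b).2 hb, orderOf_one] at hg
        exact (Fact.out : p.Prime).one_lt.ne hg
    have h2 := hM.2 _ h1
    refine (Subgroup.eq_top_iff' _).2 fun x => ?_
    obtain ⟨b, rfl⟩ := QuotientGroup.mk_surjective x
    exact (h2 ▸ Subgroup.mem_top b : b ∈ (Subgroup.zpowers g).comap (QuotientGroup.mk' M))
  have hcard : Nat.card (B ⧸ M) = p := by
    rw [← Subgroup.card_top, ← htop, Nat.card_zpowers, hg]
  let e : B ⧸ M ≃* Multiplicative (ZMod p) := mulEquivOfPrimeCardEq (p := p) hcard (by simp)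
  refine ⟨fun x => (e (QuotientGroup.mk x)).toAdd, fun x y => ?_, fun x hx => ?_, ?_⟩
  · simp only [QuotientGroup.mk_mul, map_mul, toAdd_mul]
  · simp only [(QuotientGroup.eq_one_iff x).2 (hAM hx), map_one, toAdd_one]
  · obtain ⟨y, hy⟩ := exists_ne (1 : B ⧸ M)
    obtain ⟨x, rfl⟩ := QuotientGroup.mk_surjective y
    refine ⟨x, fun h => hy ?_⟩
    exact e.injective ((toAdd_eq_zero.1 h).trans (map_one e).symm)

/-- For normal subgroups `A < B` of a finite `p`-group there is a function that is additive for
multiplication by elements of `B`, vanishes on `A` and does not vanish on `B`. -/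
theorem exists_additive_of_lt {P : Type*} [Group P] [Finite P] (hP : IsPGroup p P)
    (A B : Subgroup P) [A.Normal] [B.Normal] (hAB : A < B) :
    ∃ a : P → ZMod p, (∀ b ∈ B, ∀ x, a (b * x) = a b + a x ∧ a (x * b) = a x + a b) ∧
      (∀ b ∈ A, a b = 0) ∧ ∃ b ∈ B, a b ≠ 0 := by
  let V : Submodule (ZMod p) (B → ZMod p) :=
    { carrier := {χ | (∀ x y, χ (x * y) = χ x + χ y) ∧ ∀ x : B, x.1 ∈ A → χ x = 0}
      add_mem' := fun {χ χ'} h h' => ⟨fun x y => by simp only [Pi.add_apply, h.1, h'.1]; ring,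
        fun x hx => by simp only [Pi.add_apply, h.2 x hx, h'.2 x hx, add_zero]⟩
      zero_mem' := ⟨fun _ _ => by simp, fun _ _ => rfl⟩
      smul_mem' := fun c χ h => ⟨fun x y => by simp only [Pi.smul_apply, h.1, smul_add],
        fun x hx => by simp only [Pi.smul_apply, h.2 x hx, smul_zero]⟩ }
  let conj : Representation (ZMod p) P (B → ZMod p) :=
    { toFun := fun g => LinearMap.funLeft (ZMod p) (ZMod p) fun b => (MulAut.conjNormal g⁻¹ b : B)
      map_one' := by
        refine LinearMap.ext fun f => funext fun y => ?_
        simp [LinearMap.funLeft]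
      map_mul' := fun g g' => by
        refine LinearMap.ext fun f => funext fun y => ?_
        simp [LinearMap.funLeft] }
  have hconj : ∀ g χ b, conj g χ b = χ (MulAut.conjNormal g⁻¹ b) := fun _ _ _ => rfl
  have hstab : ∀ g, ∀ χ ∈ V, conj g χ ∈ V := by
    refine fun g χ h => ⟨fun x y => ?_, fun x hx => ?_⟩
    · rw [hconj, hconj, hconj, map_mul, h.1]
    · rw [hconj]
      refine h.2 _ ?_
      rw [MulAut.conjNormal_apply]
      exact Subgroup.Normal.conj_mem inferInstance _ hx _
  let σ : Representation (ZMod p) P V :=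
    { toFun := fun g => (conj g).restrict (hstab g)
      map_one' := by ext; simp
      map_mul' := fun g g' => by ext; simp }
  have hne : (⊥ : Submodule (ZMod p) V) ≠ ⊤ := by
    obtain ⟨χ, h1, h2, x, hx⟩ := exists_hom_of_ne_top (hP.to_subgroup B) (A.subgroupOf B)
      (by rw [Ne, Subgroup.subgroupOf_eq_top]; exact not_le_of_gt hAB)
    intro h
    have h3 : (⟨χ, h1, fun x hx => h2 x hx⟩ : V) ∈ (⊥ : Submodule (ZMod p) V) :=
      h ▸ Submodule.mem_top
    exact hx (congrFun (congrArg Subtype.val ((Submodule.mem_bot _).1 h3)) x)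
  -- Conjugation by the `p`-group acts on the nonzero space of homomorphisms from `B` that kill `A`;
  -- a nonzero fixed vector is a conjugation-invariant homomorphism.
  obtain ⟨χ, hχ0, hχ⟩ := exists_fixed_mod hP σ ⊥ (fun g m hm => by simp_all) hne
  have hinv : ∀ (g : P) (b : B), χ.1 (MulAut.conjNormal g⁻¹ b) = χ.1 b := by
    intro g b
    have h1 := sub_eq_zero.1 ((Submodule.mem_bot _).1 (hχ g))
    exact congrFun (congrArg Subtype.val h1) b
  have hmul := χ.2.1
  have hone : χ.1 1 = 0 := by simpa using hmul 1 1
  have hr : ∀ x : P, (QuotientGroup.mk x : P ⧸ B).out⁻¹ * x ∈ B := fun x =>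
    QuotientGroup.eq.1 (QuotientGroup.out_eq' _)
  -- Extension along coset representatives: x = r b is sent to χ(b). The representative of `B`
  -- itself need not be 1, hence the later normalization by `a₀ 1`. Additivity on the left follows
  -- from the one on the right by invariance of `χ`.
  let a₀ : P → ZMod p := fun x => χ.1 ⟨_, hr x⟩
  have ha₀ : ∀ x (b : B), a₀ (x * b) = a₀ x + χ.1 b := by
    intro x b
    simp only [a₀]
    rw [← hmul]
    refine congrArg χ.1 (Subtype.ext ?_)
    have : (QuotientGroup.mk (x * b.1) : P ⧸ B) = QuotientGroup.mk x := by
      rw [QuotientGroup.mk_mul, (QuotientGroup.eq_one_iff b.1).2 b.2, mul_one]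
    simp only [this, Subgroup.coe_mul, mul_assoc]
  have hb : ∀ b : B, a₀ b.1 = a₀ 1 + χ.1 b := fun b => by simpa using ha₀ 1 b
  refine ⟨fun x => a₀ x - a₀ 1, fun b hbB x => ⟨?_, ?_⟩, fun b hbA => ?_, ?_⟩
  · have h1 : b * x = x * (MulAut.conjNormal x⁻¹ (⟨b, hbB⟩ : B) : B).1 := by
      rw [MulAut.conjNormal_apply]; simp [mul_assoc]
    have h2 := hb ⟨b, hbB⟩
    simp only at h2 ⊢
    rw [h1, ha₀, hinv, h2]
    ring
  · have h1 := ha₀ x ⟨b, hbB⟩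
    have h2 := hb ⟨b, hbB⟩
    simp only at h1 h2 ⊢
    rw [h1, h2]
    ring
  · have h2 := hb ⟨b, hAB.le hbA⟩
    simp only at h2 ⊢
    rw [h2, χ.2.2 _ hbA]
    ring
  · by_contra! h
    refine hχ0 ((Submodule.mem_bot _).2 (Subtype.ext (funext fun b => ?_)))
    have h1 := h b.1 b.2
    rw [hb b] at h1
    simpa using h1

end FinitePGroup

/-! ### Dual families and greedy bases. -/

section LinearAlgebra

variable {p : ℕ} [Fact p.Prime]

/-- Linearly independent homomorphisms to `𝔽_p` have a dual family of group elements. -/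
theorem exists_dual_elements {X : Type*} [Group X] {ι : Type*} [Fintype ι] [DecidableEq ι]
    {φ : ι → X → ZMod p} (hmul : ∀ i x y, φ i (x * y) = φ i x + φ i y)
    (hli : LinearIndependent (ZMod p) φ) :
    ∃ x : ι → X, ∀ i j, φ i (x j) = if i = j then 1 else 0 := by
  have hone : ∀ i, φ i 1 = 0 := fun i => by simpa using hmul i 1 1
  -- The joint image is a subgroup, hence an 𝔽_p-subspace. If it were proper, a nonzero functional
  -- vanishing on it would be a linear relation among the `φ i`.
  let W : AddSubgroup (ι → ZMod p) :=
    { carrier := Set.range fun x i => φ i x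
      add_mem' := by
        rintro _ _ ⟨x, rfl⟩ ⟨y, rfl⟩
        exact ⟨x * y, funext fun i => hmul i x y⟩
      zero_mem' := ⟨1, funext hone⟩
      neg_mem' := by
        rintro _ ⟨x, rfl⟩
        refine ⟨x⁻¹, funext fun i => ?_⟩
        have := hmul i x⁻¹ x
        rw [inv_mul_cancel, hone] at this
        simp only [Pi.neg_apply]
        linear_combination -this }
  let W' := AddSubgroup.toZModSubmodule p W
  have hW : W' = ⊤ := by
    by_contra hne
    obtain ⟨f, hf, hfW⟩ := Submodule.exists_le_ker_of_lt_top W' (lt_top_iff_ne_top.2 hne)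
    apply hf
    have hfsum : ∀ w, f w = ∑ i, w i * f (Pi.single i 1) := fun w => by
      conv_lhs => rw [← LinearMap.sum_single_apply (fun _ : ι => ZMod p) w]
      rw [map_sum]
      refine sum_congr rfl fun i _ => ?_
      have : Pi.single (M := fun _ : ι => ZMod p) i (w i) = w i • Pi.single i 1 := by
        rw [← Pi.single_smul]; simp
      rw [this, map_smul, smul_eq_mul]
    have h1 : ∑ i, f (Pi.single i 1) • φ i = 0 := by
      funext x
      have h2 : f (fun i => φ i x) = 0 := LinearMap.mem_ker.1 (hfW ⟨x, rfl⟩)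
      rw [hfsum] at h2
      rw [Finset.sum_apply, Pi.zero_apply, ← h2]
      exact sum_congr rfl fun i _ => by simp [mul_comm]
    have h3 := Fintype.linearIndependent_iff.1 hli _ h1
    refine LinearMap.ext fun w => ?_
    rw [hfsum]
    simp [h3]
  have h : ∀ j, ∃ x, (fun i => φ i x) = Pi.single j 1 := fun j => by
    have : Pi.single j 1 ∈ W' := hW ▸ Submodule.mem_top
    exact this
  choose x hx using h
  exact ⟨x, fun i j => by rw [congrFun (hx j) i, Pi.single_apply]⟩

/-- A spanning family indexed by a finite linear order contains a basis such that every member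
of the family is a combination of basis elements with larger or equal index. -/
theorem exists_pivots {k H I : Type*} [Field k] [AddCommGroup H] [Module k H] [Fintype I]
    [LinearOrder I] (v : I → H) (hv : Submodule.span k (Set.range v) = ⊤) {r : ℕ}
    (hr : Module.finrank k H = r) :
    ∃ e : Fin r → I, Function.Injective e ∧ LinearIndependent k (v ∘ e) ∧
      ∀ i, v i ∈ Submodule.span k ((v ∘ e) '' {j | i ≤ e j}) := by
  classical
  -- Greedy choice from the top: an index is kept when its vector is not in the span of those with
  -- larger index. In a relation among kept vectors, the smallest index occurring would contradict
  -- this.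
  let S : Set I := {i | v i ∉ Submodule.span k (v '' {j | i < j})}
  have hli : LinearIndependent k fun i : S => v i := by
    rw [linearIndependent_iff']
    intro s c hc
    by_contra! hne
    obtain ⟨i, his, hi⟩ := hne
    let t := s.filter fun i => c i ≠ 0
    have ht : t.Nonempty := ⟨i, mem_filter.2 ⟨his, hi⟩⟩
    obtain ⟨i₀, hi₀, hmin⟩ := t.exists_min_image (fun i => i.1) ht
    have hc0 := (mem_filter.1 hi₀).2
    refine i₀.2 ?_
    have h1 : c i₀ • v i₀ = -∑ i ∈ s.erase i₀, c i • v i := by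
      rw [eq_neg_iff_add_eq_zero, add_sum_erase s (fun i : S => c i • v i) (mem_filter.1 hi₀).1]
      exact hc
    have h2 : v i₀ = (c i₀)⁻¹ • (-∑ i ∈ s.erase i₀, c i • v i) := by
      rw [← h1, smul_smul, inv_mul_cancel₀ hc0, one_smul]
    rw [h2]
    refine Submodule.smul_mem _ _ (Submodule.neg_mem _ (Submodule.sum_mem _ fun i hi => ?_))
    by_cases hci : c i = 0
    · rw [hci, zero_smul]; exact Submodule.zero_mem _
    · refine Submodule.smul_mem _ _ (Submodule.subset_span ⟨i.1, ?_, rfl⟩)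
      have h3 := hmin i (mem_filter.2 ⟨(mem_erase.1 hi).2, hci⟩)
      exact lt_of_le_of_ne h3 fun h => (mem_erase.1 hi).1 (Subtype.ext h.symm)
  have hspan : ∀ i, v i ∈ Submodule.span k (v '' {j | j ∈ S ∧ i ≤ j}) := by
    intro i
    induction i using WellFoundedGT.induction with
    | ind i ih =>
    by_cases hi : i ∈ S
    · exact Submodule.subset_span ⟨i, ⟨hi, le_rfl⟩, rfl⟩
    · have h1 : v i ∈ Submodule.span k (v '' {j | i < j}) := not_not.1 hi
      refine Submodule.span_le.2 ?_ h1
      rintro _ ⟨j, hj, rfl⟩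
      refine Submodule.span_mono (Set.image_mono fun l hl => ?_) (ih j hj)
      exact ⟨hl.1, (le_of_lt hj).trans hl.2⟩
  have htop : ⊤ ≤ Submodule.span k (Set.range fun i : S => v i) := by
    rw [← hv, Submodule.span_le]
    rintro _ ⟨i, rfl⟩
    refine Submodule.span_mono ?_ (hspan i)
    rintro _ ⟨j, hj, rfl⟩
    exact ⟨⟨j, hj.1⟩, rfl⟩
  let b := Module.Basis.mk hli htop
  have hcard : Fintype.card S = r := by rw [← hr, Module.finrank_eq_card_basis b]
  let e := (Fintype.equivFinOfCardEq hcard).symm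
  refine ⟨fun j => (e j).1, Subtype.val_injective.comp e.injective, hli.comp e e.injective,
    fun i => ?_⟩
  refine Submodule.span_mono ?_ (hspan i)
  rintro _ ⟨j, hj, rfl⟩
  refine ⟨e.symm ⟨j, hj.1⟩, ?_, ?_⟩ <;> simp [hj.2]

end LinearAlgebra

end ProP

namespace ProP

open Finset NCSeries FreeProP

/-! ### Existence of a Forré presentation. -/

section MinimalPresentation

variable {p : ℕ} [Fact p.Prime] {G : Type*} [Group G] [TopologicalSpace G]

/-- A continuous surjection from a free pro-`p` group to a pro-`p` group is an open quotient map. -/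
theorem IsProP.isOpenQuotientMap (hG : IsProP p G) {d : ℕ} {π : FreeProP p d →* G}
    (hπ : Continuous π) (hs : Function.Surjective π) : IsOpenQuotientMap π := by
  have := hG.isTopologicalGroup
  have := hG.compactSpace
  have := hG.t2Space
  exact ⟨hs, hπ, MonoidHom.isOpenMap_of_sigmaCompact π hs hπ⟩

/-- A locally constant homomorphism to `𝔽_p`, as a cocycle. -/
def cocycleOfHom (χ : G → ZMod p) (hχ : IsLocallyConstant χ) (hmul : ∀ x y, χ (x * y) = χ x + χ y) :
    cocycles p G 1 :=
  ⟨fun g => χ (g 0), hχ.comp_continuous (f := fun g : Fin 1 → G => g 0) (by fun_prop),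
    LinearMap.mem_ker.2 (funext fun g => by
      rw [coboundary_one_apply, hmul]
      simp)⟩

theorem isLocallyConstant_cocycle (χ : cocycles p G 1) :
    IsLocallyConstant fun g => χ.1 fun _ => g := by
  have h : IsLocallyConstant χ.1 := χ.2.1
  exact h.comp_continuous (f := fun g (_ : Fin 1) => g) (by fun_prop)

/-- Cocycles of degree one with the same class are equal. -/
theorem cocycle_eq_of_mk_eq {χ ψ : cocycles p G 1}
    (h : (Submodule.Quotient.mk χ : Cohomology p G 1) = Submodule.Quotient.mk ψ) : χ = ψ := by
  have h1 : (χ - ψ).1 ∈ coboundaries p G 1 :=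
    (Submodule.Quotient.eq ((coboundaries p G 1).submoduleOf (cocycles p G 1))).1 h
  rw [coboundaries_one, Submodule.mem_bot] at h1
  exact sub_eq_zero.1 (Subtype.ext h1)

/-- Elements that are dual to a basis of the first cohomology topologically generate. -/
theorem surjective_of_dual (hG : IsProP p G) {n d : ℕ} {π' : FreeProP p n →* G}
    (hπ' : Continuous π') (hs' : Function.Surjective π') {π : FreeProP p d →* G}
    (hπ : Continuous π)
    (hdual : ∀ χ : cocycles p G 1, (∀ i, χ.1 (fun _ => π (of i)) = 0) → χ = 0) :
    Function.Surjective π := by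
  have hq := hG.isOpenQuotientMap hπ' hs'
  have := hG.t2Space
  by_contra hns
  -- If the closed image of `π` were proper, its preimage in the auxiliary free pro-`p` group would
  -- be proper in some finite `p`-quotient. A homomorphism to 𝔽_p killing that image also kills the
  -- kernel of `π'`, so it descends to a nonzero class on `G` vanishing on all generators.
  let H : Subgroup (FreeProP p n) := π.range.comap π'
  have hclosed : IsClosed (H : Set (FreeProP p n)) := by
    have h1 : IsClosed (π.range : Set G) := by
      rw [MonoidHom.coe_range]
      exact (isCompact_range hπ).isClosed
    exact h1.preimage hπ'
  obtain ⟨y, hy⟩ := not_forall.1 hns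
  obtain ⟨x, rfl⟩ := hs' y
  have hx : x ∉ H := fun h => hy h
  obtain ⟨N, hN⟩ := exists_proj_subset (hclosed.isOpen_compl.mem_nhds hx)
  have hne : H.map (proj N) ≠ ⊤ := by
    intro h
    obtain ⟨z, hz, hzx⟩ := (h ▸ Subgroup.mem_top (proj N x) : proj N x ∈ H.map (proj N))
    exact hN z hzx hz
  obtain ⟨χ, hmul, hker, z, hz⟩ := exists_hom_of_ne_top N.isPGroup_quot _ hne
  have hH : ∀ x ∈ H, χ (proj N x) = 0 := fun x hx => hker _ ⟨x, hx, rfl⟩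
  have hinv : ∀ x y, π' x = π' y → χ (proj N x) = χ (proj N y) := by
    intro x y hxy
    have h1 : x * y⁻¹ ∈ H := by
      change π' (x * y⁻¹) ∈ π.range
      rw [map_mul, map_inv, hxy, mul_inv_cancel]
      exact Subgroup.one_mem _
    have h2 := hmul (proj N (x * y⁻¹)) (proj N y)
    rw [← map_mul, inv_mul_cancel_right, hH _ h1, zero_add] at h2
    exact h2
  let s := Function.surjInv hs'
  have hsπ : ∀ x, χ (proj N (s (π' x))) = χ (proj N x) := fun x =>
    hinv _ _ (Function.surjInv_eq hs' _)
  have hlc : IsLocallyConstant fun y => χ (proj N (s y)) := by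
    refine isLocallyConstant_of_comp hq ?_
    have : (fun y => χ (proj N (s y))) ∘ π' = fun x => χ (proj N x) := funext hsπ
    rw [this]
    exact isLocallyConstant_of_factor N fun x y h => by rw [h]
  have hmul' : ∀ x y, χ (proj N (s (x * y))) = χ (proj N (s x)) + χ (proj N (s y)) := by
    intro x y
    obtain ⟨x, rfl⟩ := hs' x
    obtain ⟨y, rfl⟩ := hs' y
    rw [← map_mul, hsπ, hsπ, hsπ, map_mul, hmul]
  have h0 := hdual (cocycleOfHom _ hlc hmul') fun i => by
    change χ (proj N (s (π (of i)))) = 0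
    obtain ⟨x, hx⟩ := hs' (π (of i))
    rw [← hx, hsπ]
    refine hH _ ?_
    change π' x ∈ π.range
    rw [hx]
    exact ⟨_, rfl⟩
  obtain ⟨x, rfl⟩ := proj_surjective N z
  apply hz
  rw [← hsπ]
  exact congrFun (congrArg Subtype.val h0) fun _ => π' x

/-- If the transgression is controlled by functions dual to elements of the kernel, these elements
generate the kernel as a closed normal subgroup. -/
theorem ker_eq_closedNormalClosure {d : ℕ} {π : FreeProP p d →* G} {ι : Type*}
    {ρ : ι → FreeProP p d} (hρ : ∀ k, ρ k ∈ π.ker) (hclosed : IsClosed (π.ker : Set (FreeProP p d)))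
    (h : ∀ a ∈ primitives π, (∀ k, a (ρ k) = 0) → ∀ n ∈ π.ker, a n = 0) :
    π.ker = closedNormalClosure (Set.range ρ) := by
  have hle : closedNormalClosure (Set.range ρ) ≤ π.ker :=
    closedNormalClosure_le hclosed (by rintro _ ⟨k, rfl⟩; exact hρ k)
  refine le_antisymm (fun x hx => ?_) hle
  by_contra hxn
  -- A kernel element outside the closed normal closure stays outside in a finite quotient. There
  -- `exists_additive_of_lt` yields a primitive function that kills the closure but not the kernel,
  -- contrary to `h`.
  obtain ⟨M, hM⟩ := exists_proj_subset
    ((isClosed_closedNormalClosure (Set.range ρ)).isOpen_compl.mem_nhds hxn)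
  have := Subgroup.Normal.map (inferInstance : (closedNormalClosure (Set.range ρ)).Normal)
    (proj M) (proj_surjective M)
  have := Subgroup.Normal.map (inferInstance : π.ker.Normal) (proj M) (proj_surjective M)
  obtain ⟨a, hadd, hA, b, hb, hab⟩ := exists_additive_of_lt M.isPGroup_quot
    ((closedNormalClosure (Set.range ρ)).map (proj M)) (π.ker.map (proj M))
    (lt_of_le_of_ne (Subgroup.map_mono hle) fun heq => by
      obtain ⟨z, hz, hzx⟩ := (heq ▸ ⟨x, hx, rfl⟩ :
        proj M x ∈ (closedNormalClosure (Set.range ρ)).map (proj M))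
      exact hM z hzx hz)
  obtain ⟨y, hy, rfl⟩ := hb
  refine hab (h (fun x => a (proj M x)) ⟨?_, ?_⟩ (fun k => ?_) y hy)
  · exact isLocallyConstant_of_factor M fun x y h => by rw [h]
  · intro n hn x
    have := hadd (proj M n) ⟨n, hn, rfl⟩ (proj M x)
    simpa using this
  · exact hA _ ⟨_, subset_closedNormalClosure _ ⟨k, rfl⟩, rfl⟩

/-- Lexicographic comparison of two-letter words. -/
theorem wordLT_pair {d : ℕ} {i j t s : Fin d}
    (h : toLex (i, j) < toLex (t, s)) : WordLT [i, j] [t, s] := by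
  refine Or.inr ⟨rfl, ?_⟩
  rcases Prod.Lex.toLex_lt_toLex.1 h with h | ⟨h, h'⟩
  · exact List.Lex.rel h
  · simp only at h h'
    subst h
    exact List.Lex.cons (List.Lex.rel h')

/-- A pro-`p` group whose cup product is spanned by `U ∪ V` with `U ∪ U = 0` has a presentation
whose relations have distinct quadratic highest terms. -/
theorem exists_isForrePresentation (hG : IsProP p G) (hfp : IsFinitelyPresentedProP p G)
    (U V : Submodule (ZMod p) (Cohomology p G 1)) (hUV : IsCompl U V)
    (hUU : ∀ u ∈ U, ∀ u' ∈ U, cup p G u u' = 0)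
    (hcup : Submodule.map₂ (cup p G) U V = ⊤)
    (d r c : ℕ) (hd : Module.finrank (ZMod p) (Cohomology p G 1) = d) (hd0 : 0 < d)
    (hr : Module.finrank (ZMod p) (Cohomology p G 2) = r)
    (hc : Module.finrank (ZMod p) V = c) :
    ∃ (π : FreeProP p d →* G) (ρ : Fin r → FreeProP p d) (s t : Fin r → Fin d),
      IsForrePresentation c π ρ s t := by
  classical
  have hT2 := hG.t2Space
  have hfin : Module.Finite (ZMod p) (Cohomology p G 1) :=
    Module.finite_of_finrank_pos (by omega)
  -- a basis adapted to the decomposition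
  have hdim : c + Module.finrank (ZMod p) U = d := by
    rw [← hc, ← hd, add_comm]
    exact Submodule.finrank_add_eq_of_isCompl hUV
  -- The basis of `V` is placed first, so letters with index below `c` belong to `V` and the
  -- remaining ones to `U`.
  let bV := Module.finBasisOfFinrankEq (ZMod p) V hc
  let bU := Module.finBasis (ZMod p) U
  let ε : Fin c ⊕ Fin (Module.finrank (ZMod p) U) ≃ Fin d := finSumFinEquiv.trans (finCongr hdim)
  let B : Module.Basis (Fin d) (ZMod p) (Cohomology p G 1) :=
    ((bV.prod bU).map (Submodule.prodEquivOfIsCompl V U hUV.symm)).reindex ε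
  have hBl : ∀ i, B (ε (Sum.inl i)) = bV i := fun i => by
    simp [B]
  have hBr : ∀ i, B (ε (Sum.inr i)) = bU i := fun i => by
    simp [B]
  have hεl : ∀ i, (ε (Sum.inl i) : ℕ) < c := fun i => by simp [ε]
  have hεr : ∀ i, c ≤ (ε (Sum.inr i) : ℕ) := fun i => by simp [ε]
  have hBU : ∀ i : Fin d, c ≤ (i : ℕ) → B i ∈ U := by
    intro i hi
    obtain ⟨j | j, rfl⟩ := ε.surjective i
    · exact absurd (hεl j) (by omega)
    · rw [hBr]; exact (bU j).2
  choose χ hχ using fun i => Submodule.Quotient.mk_surjective _ (B i)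
  let φ : Fin d → G → ZMod p := fun i g => (χ i).1 fun _ => g
  have hφmul : ∀ i x y, φ i (x * y) = φ i x + φ i y := fun i => cocycles_one_map_mul (χ i)
  have hcoc : ∀ ψ : cocycles p G 1, ∃ e : Fin d → ZMod p, ∀ g, ψ.1 (fun _ => g) =
      ∑ i, e i * φ i g := by
    intro ψ
    refine ⟨fun i => B.repr (Submodule.Quotient.mk ψ) i, fun g => ?_⟩
    have h1 : ψ = ∑ i, B.repr (Submodule.Quotient.mk ψ) i • χ i := by
      refine cocycle_eq_of_mk_eq ?_
      conv_lhs => rw [← B.sum_repr (Submodule.Quotient.mk ψ)]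
      rw [← Submodule.mkQ_apply _ (∑ i, _ • χ i), map_sum]
      refine sum_congr rfl fun i _ => ?_
      rw [map_smul, Submodule.mkQ_apply, hχ]
    have h2 := congrFun (congrArg Subtype.val h1) fun _ => g
    rw [h2, Submodule.coe_sum, Finset.sum_apply]
    rfl
  have hφli : LinearIndependent (ZMod p) φ := by
    rw [Fintype.linearIndependent_iff]
    intro e he
    refine Fintype.linearIndependent_iff.1 B.linearIndependent e ?_
    have h1 : ∑ i, e i • χ i = 0 := by
      refine Subtype.ext (funext fun g => ?_)
      have h2 := congrFun he (g 0)
      have h3 : g = fun _ => g 0 := funext fun i => by rw [Subsingleton.elim i 0]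
      rw [h3, Submodule.coe_sum, Finset.sum_apply]
      rw [Finset.sum_apply] at h2
      exact h2
    have h2 := congrArg (Submodule.mkQ ((coboundaries p G 1).submoduleOf (cocycles p G 1))) h1
    rw [map_sum, map_zero] at h2
    rw [← h2]
    refine sum_congr rfl fun i _ => ?_
    rw [map_smul, Submodule.mkQ_apply, hχ]
  obtain ⟨γ, hγ⟩ := exists_dual_elements hφmul hφli
  -- the generators
  obtain ⟨n, π', -, hπ', hs', -, -⟩ := hfp
  choose z hz using fun i => hs' (γ i)
  let π : FreeProP p d →* G := π'.comp (lift z)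
  have hπ : Continuous π := hπ'.comp (continuous_lift z)
  have hπof : ∀ i, π (of i) = γ i := fun i => by
    rw [MonoidHom.comp_apply, lift_of, hz]
  have hsurj : Function.Surjective π := by
    refine surjective_of_dual hG hπ' hs' hπ fun ψ hψ => ?_
    obtain ⟨e, he⟩ := hcoc ψ
    have he0 : ∀ j, e j = 0 := by
      intro j
      have h1 := hψ j
      rw [he, hπof] at h1
      simpa [hγ] using h1
    refine Subtype.ext (funext fun g => ?_)
    have h3 : g = fun _ => g 0 := funext fun i => by rw [Subsingleton.elim i 0]
    rw [h3, he]
    simp [he0]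
  have hq : IsOpenQuotientMap π := hG.isOpenQuotientMap hπ hsurj
  have hclosed : IsClosed (π.ker : Set (FreeProP p d)) := isClosed_singleton.preimage hπ
  have hlin : ∀ i x, φ i (π x) = magnus x [i] := by
    intro i x
    have h := hom_eq_sum (χ := fun x => φ i (π x))
      ((isLocallyConstant_cocycle (χ i)).comp_continuous hπ)
      (fun x y => by rw [map_mul, hφmul]) x
    refine h.trans ?_
    simp [hπof, hγ]
  have hlin0 : ∀ i, ∀ x ∈ π.ker, magnus x [i] = 0 := by
    intro i x hx
    rw [← hlin, MonoidHom.mem_ker.1 hx]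
    simpa using hφmul i 1 1
  have hmin : ∀ χ : FreeProP p d → ZMod p, IsLocallyConstant χ →
      (∀ x y, χ (x * y) = χ x + χ y) → ∀ n ∈ π.ker, χ n = 0 := by
    intro ψ hψ hmul x hx
    rw [hom_eq_sum hψ hmul]
    exact sum_eq_zero fun i _ => by rw [hlin0 i x hx, mul_zero]
  -- quadratic coefficients transgress to cup products
  have hprim : ∀ i j, (fun x => -magnus x [i, j]) ∈ primitives π := by
    intro i j
    refine ⟨(isLocallyConstant_magnus_apply [i, j]).comp fun c => -c, fun x hx y => ?_⟩
    simp only [magnus_mul_pair, hlin0 _ x hx]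
    constructor <;> ring
  let a : Fin d → Fin d → primitives π := fun i j => ⟨_, hprim i j⟩
  -- By the product formula for quadratic coefficients, the coboundary of the negated coefficient is
  -- exactly the product of the linear coefficients, which are the cocycles `χ i` and `χ j`.
  have htr : ∀ i j, transgress hq (a i j) = cup p G (B i) (B j) := by
    intro i j
    rw [← hχ i, ← hχ j, cup_mk]
    refine transgress_eq_mk hq _ _ fun x => ?_
    change φ i (π (x 0)) * φ j (π (x 1)) = -magnus (x 1) [i, j] - -magnus (x 0 * x 1) [i, j] +
      -magnus (x 0) [i, j]
    rw [hlin, hlin, magnus_mul_pair]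
    ring
  -- choice of pivots
  let v : Fin d ×ₗ Fin d → Cohomology p G 2 := fun x =>
    if c ≤ ((ofLex x).1 : ℕ) ∧ ((ofLex x).2 : ℕ) < c then cup p G (B (ofLex x).1) (B (ofLex x).2)
    else 0
  -- That H² is spanned by this finite family also makes it finite-dimensional.
  have hvspan : Submodule.span (ZMod p) (Set.range v) = ⊤ := by
    rw [eq_top_iff, ← hcup, Submodule.map₂_le]
    intro u hu w hw
    have h1 := congrArg Subtype.val (bU.sum_repr ⟨u, hu⟩)
    have h2 := congrArg Subtype.val (bV.sum_repr ⟨w, hw⟩)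
    rw [Submodule.coe_sum] at h1 h2
    simp only [Submodule.coe_smul] at h1 h2
    rw [← h1, ← h2, map_sum (cup p G), LinearMap.sum_apply]
    refine Submodule.sum_mem _ fun i _ => ?_
    rw [map_sum]
    refine Submodule.sum_mem _ fun j _ => ?_
    rw [map_smul, map_smul, LinearMap.smul_apply]
    refine Submodule.smul_mem _ _ (Submodule.smul_mem _ _ (Submodule.subset_span
      ⟨toLex (ε (Sum.inr i), ε (Sum.inl j)), ?_⟩))
    rw [← hBl, ← hBr]
    exact if_pos ⟨hεr i, hεl j⟩
  obtain ⟨e, heinj, heli, hespan⟩ := exists_pivots v hvspan hr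
  -- Pairs outside U × V were assigned the zero vector, which cannot belong to an independent
  -- family.
  have hcond : ∀ k, c ≤ ((ofLex (e k)).1 : ℕ) ∧ ((ofLex (e k)).2 : ℕ) < c := by
    intro k
    by_contra h
    exact heli.ne_zero k (if_neg h)
  let A : Fin r → primitives π := fun k => a (ofLex (e k)).1 (ofLex (e k)).2
  have hA : ∀ k, transgress hq (A k) = v (e k) := fun k => by
    simp only [A, htr]
    exact (if_pos (hcond k)).symm
  have hzero := transgress_eq_zero_iff hq hmin
  have hAli : LinearIndependent (ZMod p) fun (k : Fin r) (x : π.ker) => (A k).1 x.1 := by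
    rw [Fintype.linearIndependent_iff]
    intro f hf
    refine Fintype.linearIndependent_iff.1 heli f ?_
    have h1 : transgress hq (∑ k, f k • A k) = 0 := by
      refine (hzero _).2 fun x hx => ?_
      have h2 := congrFun hf ⟨x, hx⟩
      rw [Finset.sum_apply] at h2
      rw [Submodule.coe_sum, Finset.sum_apply]
      exact h2
    rw [map_sum] at h1
    rw [← h1]
    exact sum_congr rfl fun k _ => by rw [map_smul, hA]; rfl
  -- The relations are kernel elements dual to the pivot coefficients. The pivots are independent as
  -- functions on the kernel because transgression only loses functions vanishing there.
  obtain ⟨ρ, hρ⟩ := exists_dual_elements (X := π.ker)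
    (fun k x y => ((A k).2.2 x.1 x.2 y.1).1) hAli
  -- functions are determined by the pivots
  have hexp : ∀ (b) (hb : b ∈ primitives π) (T : Set (Fin r)), transgress hq ⟨b, hb⟩ ∈
      Submodule.span (ZMod p) ((v ∘ e) '' T) → (∀ l ∉ T, b (ρ l).1 = 0) ∧
        ((∀ l, b (ρ l).1 = 0) → ∀ x ∈ π.ker, b x = 0) := by
    intro b hb T hT
    rw [Finsupp.mem_span_image_iff_linearCombination] at hT
    obtain ⟨f, hfT, hf⟩ := hT
    rw [Finsupp.linearCombination_apply, Finsupp.sum_fintype _ _ (by simp)] at hf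
    have h1 : ∀ x ∈ π.ker, b x = ∑ k, f k * (A k).1 x := by
      intro x hx
      have h2 : transgress hq (⟨b, hb⟩ - ∑ k, f k • A k) = 0 := by
        rw [map_sub, ← hf, map_sum, sub_eq_zero]
        exact sum_congr rfl fun k _ => by rw [map_smul, hA]; rfl
      have h3 := (hzero _).1 h2 x hx
      rw [Submodule.coe_sub, Pi.sub_apply, sub_eq_zero, Submodule.coe_sum, Finset.sum_apply] at h3
      exact h3
    have h2 : ∀ l, b (ρ l).1 = f l := by
      intro l
      rw [h1 _ (ρ l).2]
      simp only [hρ]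
      simp
    refine ⟨fun l hl => ?_, fun h x hx => ?_⟩
    · rw [h2]
      by_contra hne
      exact hl (hfT (Finsupp.mem_support_iff.2 hne))
    · rw [h1 x hx]
      exact sum_eq_zero fun k _ => by rw [← h2, h, zero_mul]
  refine ⟨π, fun k => (ρ k).1, fun k => (ofLex (e k)).2, fun k => (ofLex (e k)).1,
    hπ, hsurj, ?_, fun l => ⟨?_, fun w hw hne => ?_⟩, fun k => (hcond k).2,
    fun k => (hcond k).1, ?_⟩
  · refine ker_eq_closedNormalClosure (fun k => (ρ k).2) hclosed fun b hb h => ?_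
    refine (hexp b hb Set.univ ?_).2 h
    have h1 : Submodule.span (ZMod p) ((v ∘ e) '' Set.univ) = ⊤ := by
      rw [eq_top_iff, ← hvspan, Submodule.span_le]
      rintro _ ⟨i, rfl⟩
      exact Submodule.span_mono (Set.image_mono (Set.subset_univ _)) (hespan i)
    rw [h1]
    exact Submodule.mem_top
  · have h1 := hρ l l
    rw [if_pos rfl] at h1
    have h2 : magnus (ρ l).1 [(ofLex (e l)).1, (ofLex (e l)).2] = -1 := by
      have h3 : -magnus (ρ l).1 [(ofLex (e l)).1, (ofLex (e l)).2] = 1 := h1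
      rw [← h3, neg_neg]
    rw [NCSeries.sub_apply, h2, one_apply]
    simp
  · rcases Nat.lt_or_ge 2 w.length with hlen | hlen
    · exact Or.inl (by simpa using hlen)
    match w, hlen with
    | [], _ => exact absurd (magnusSub_nil (ρ l).1) hw
    | [i], _ =>
      refine absurd ?_ hw
      rw [NCSeries.sub_apply, hlin0 i _ (ρ l).2, one_apply]
      simp
    | [i, j], _ =>
      by_contra hlt
      -- A quadratic word that is not smaller than the pivot is larger, so its first letter is a
      -- U-letter. If the second letter is one too, U ∪ U = 0 kills the coefficient. Otherwise the
      -- class of the coefficient is a combination of pivots at or above (i, j), and `e l` is not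
      -- among them.
      have hle : e l < toLex (i, j) := by
        refine lt_of_le_of_ne (not_lt.1 fun h => hlt (wordLT_pair h)) fun h => hne ?_
        rw [h]
        rfl
      have hi : c ≤ (i : ℕ) := by
        refine (hcond l).1.trans ?_
        have := Prod.Lex.monotone_fst _ _ hle.le
        exact this
      have hb : -magnus (ρ l).1 [i, j] = 0 := by
        by_cases hj : c ≤ (j : ℕ)
        · exact (hzero (a i j)).1 (by rw [htr]; exact hUU _ (hBU i hi) _ (hBU j hj)) _ (ρ l).2
        · refine (hexp _ (hprim i j) {k | toLex (i, j) ≤ e k} ?_).1 l (not_le.2 hle)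
          have h1 := hespan (toLex (i, j))
          have h2 : v (toLex (i, j)) = transgress hq (a i j) := by
            rw [htr]
            exact if_pos ⟨hi, not_le.1 hj⟩
          rw [h2] at h1
          exact h1
      refine hw ?_
      rw [NCSeries.sub_apply, neg_eq_zero.1 hb, one_apply]
      simp
    | _ :: _ :: _ :: _, h => simp at h
  · intro k k' h
    apply heinj
    simp only [Prod.mk.injEq] at h
    exact ofLex.injective (Prod.ext h.2 h.1)

end MinimalPresentation

end ProP

namespace ProP

open Finset NCSeries FreeProP

/-! ### The completed group algebra as a quotient of the series. -/

section GroupAlgebra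

variable {p d : ℕ} [Fact p.Prime]

/-- Linear maps on series that vanish in high order are determined by their values on the image of
the Magnus homomorphism. -/
theorem linearMap_ext_magnus {M : Type*} [AddCommGroup M] [Module (ZMod p) M]
    {T T' : NCSeries (ZMod p) d →ₗ[ZMod p] M} (hT : ∃ n, ∀ f ∈ order (ZMod p) d n, T f = 0)
    (hT' : ∃ n, ∀ f ∈ order (ZMod p) d n, T' f = 0)
    (h : ∀ x : FreeProP p d, T (magnus x) = T' (magnus x)) : T = T' := by
  refine LinearMap.ext fun f => sub_eq_zero.1
    ((Module.forall_dual_apply_eq_zero_iff (ZMod p) _).1 fun φ => ?_)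
  obtain ⟨n, hn⟩ := hT
  obtain ⟨n', hn'⟩ := hT'
  have h1 : φ ∘ₗ T = φ ∘ₗ T' := smoothDual_ext_magnus
    ⟨n, fun f hf => by rw [LinearMap.comp_apply, hn f hf, map_zero]⟩
    ⟨n', fun f hf => by rw [LinearMap.comp_apply, hn' f hf, map_zero]⟩
    fun x => by rw [LinearMap.comp_apply, LinearMap.comp_apply, h]
  rw [map_sub, sub_eq_zero]
  exact LinearMap.congr_fun h1 f

variable {Γ : Type*} [Group Γ] [TopologicalSpace Γ] [IsTopologicalGroup Γ]

/-- Functions on the quotient by an open normal subgroup, as locally constant functions. -/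
def pullback (N : OpenNormalSubgroup Γ) (φ : Γ ⧸ N.toSubgroup → ZMod p) :
    LocallyConstant Γ (ZMod p) :=
  ⟨fun y => φ y, (IsLocallyConstant.of_discrete φ).comp_continuous QuotientGroup.continuous_mk⟩

theorem pullback_apply (N : OpenNormalSubgroup Γ) (φ : Γ ⧸ N.toSubgroup → ZMod p) (y : Γ) :
    pullback N φ y = φ y := rfl

variable [CompactSpace Γ] {q : FreeProP p d →* Γ}

open Classical in
/-- The homomorphism from series to the group algebra of a finite quotient that extends `q`. -/
noncomputable def finiteLevel (hq : Continuous q) (N : OpenNormalSubgroup Γ) :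
    NCSeries (ZMod p) d →ₗ[ZMod p] MonoidAlgebra (ZMod p) (Γ ⧸ N.toSubgroup) where
  toFun f := MonoidAlgebra.ofCoeff (Finsupp.equivFunOnFinite.symm fun γ =>
    functional hq (pullback N (Pi.single γ 1)) f)
  map_add' f g := by ext γ; simp
  map_smul' c f := by ext γ; simp

theorem finiteLevel_magnus (hq : Continuous q) (N : OpenNormalSubgroup Γ) (x : FreeProP p d) :
    finiteLevel hq N (magnus x) = MonoidAlgebra.single (q x : Γ ⧸ N.toSubgroup) 1 := by
  classical
  ext γ
  simp only [finiteLevel, LinearMap.coe_mk, AddHom.coe_mk, functional_magnus, pullback_apply]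
  simp [Pi.single_apply, Finsupp.single_apply, eq_comm]

theorem exists_finiteLevel_eq_zero (hq : Continuous q) (N : OpenNormalSubgroup Γ) :
    ∃ n, ∀ f ∈ order (ZMod p) d n, finiteLevel hq N f = 0 := by
  classical
  have := Fintype.ofFinite (Γ ⧸ N.toSubgroup)
  choose n hn using fun γ => functional_mem hq (pullback N (Pi.single γ 1))
  refine ⟨univ.sup n, fun f hf => ?_⟩
  ext γ
  exact hn γ f (order_anti (le_sup (mem_univ γ)) hf)

/-- Multiplicativity holds on Magnus images because `q` is a homomorphism; it extends to all series
in one factor at a time by `linearMap_ext_magnus`. -/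
theorem finiteLevel_mul (hq : Continuous q) (N : OpenNormalSubgroup Γ)
    (f g : NCSeries (ZMod p) d) :
    finiteLevel hq N (f * g) = finiteLevel hq N f * finiteLevel hq N g := by
  obtain ⟨n, hn⟩ := exists_finiteLevel_eq_zero hq N
  have h1 : ∀ x : FreeProP p d, finiteLevel hq N ∘ₗ LinearMap.mulLeft (ZMod p) (magnus x) =
      LinearMap.mulLeft (ZMod p) (finiteLevel hq N (magnus x)) ∘ₗ finiteLevel hq N := by
    intro x
    refine linearMap_ext_magnus ⟨n, fun f hf => hn _ (mul_mem_order_right _ hf)⟩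
      ⟨n, fun f hf => by rw [LinearMap.comp_apply, hn f hf, map_zero]⟩ fun y => ?_
    simp only [LinearMap.comp_apply, LinearMap.mulLeft_apply, ← map_mul magnus, finiteLevel_magnus,
      MonoidAlgebra.single_mul_single]
    simp
  have h2 : finiteLevel hq N ∘ₗ LinearMap.mulRight (ZMod p) g =
      LinearMap.mulRight (ZMod p) (finiteLevel hq N g) ∘ₗ finiteLevel hq N := by
    refine linearMap_ext_magnus ⟨n, fun f hf => hn _ (mul_mem_order_left hf _)⟩
      ⟨n, fun f hf => by rw [LinearMap.comp_apply, hn f hf, map_zero]⟩ fun x => ?_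
    exact LinearMap.congr_fun (h1 x) g
  exact LinearMap.congr_fun h2 f

theorem mapDomain_finiteLevel (hq : Continuous q) (N M : OpenNormalSubgroup Γ)
    (h : N.toSubgroup ≤ M.toSubgroup) (f : NCSeries (ZMod p) d) :
    MonoidAlgebra.mapDomainAlgHom (ZMod p) (ZMod p)
      (QuotientGroup.map N.toSubgroup M.toSubgroup (MonoidHom.id Γ) h) (finiteLevel hq N f) =
      finiteLevel hq M f := by
  obtain ⟨n, hn⟩ := exists_finiteLevel_eq_zero hq N
  have h1 : (MonoidAlgebra.mapDomainAlgHom (ZMod p) (ZMod p) (QuotientGroup.map N.toSubgroup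
      M.toSubgroup (MonoidHom.id Γ) h)).toLinearMap ∘ₗ finiteLevel hq N = finiteLevel hq M := by
    refine linearMap_ext_magnus ⟨n, fun f hf => by rw [LinearMap.comp_apply, hn f hf, map_zero]⟩
      (exists_finiteLevel_eq_zero hq M) fun x => ?_
    rw [LinearMap.comp_apply, finiteLevel_magnus, finiteLevel_magnus, AlgHom.toLinearMap_apply,
      MonoidAlgebra.mapDomainAlgHom_apply, MonoidAlgebra.mapDomain_single]
    rfl
  exact LinearMap.congr_fun h1 f

theorem augmentation_finiteLevel (hq : Continuous q) (N : OpenNormalSubgroup Γ)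
    (f : NCSeries (ZMod p) d) :
    MonoidAlgebra.lift (ZMod p) (ZMod p) (Γ ⧸ N.toSubgroup) 1 (finiteLevel hq N f) = f [] := by
  obtain ⟨n, hn⟩ := exists_finiteLevel_eq_zero hq N
  have h1 : (MonoidAlgebra.lift (ZMod p) (ZMod p) (Γ ⧸ N.toSubgroup) 1).toLinearMap ∘ₗ
      finiteLevel hq N = constCoeffₗ (ZMod p) d := by
    refine linearMap_ext_magnus ⟨n, fun f hf => by rw [LinearMap.comp_apply, hn f hf, map_zero]⟩
      constCoeffₗ_mem fun x => ?_
    rw [LinearMap.comp_apply, finiteLevel_magnus, AlgHom.toLinearMap_apply,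
      MonoidAlgebra.lift_single, constCoeffₗ_apply, magnus_nil]
    simp
  exact LinearMap.congr_fun h1 f

theorem finiteLevel_surjective (hq : Continuous q) (hs : Function.Surjective q)
    (N : OpenNormalSubgroup Γ) : Function.Surjective (finiteLevel hq N) := by
  intro z
  induction z using MonoidAlgebra.induction_linear with
  | zero => exact ⟨0, map_zero _⟩
  | add z z' h h' =>
    obtain ⟨f, rfl⟩ := h
    obtain ⟨g, rfl⟩ := h'
    exact ⟨f + g, map_add _ _ _⟩
  | single γ c =>
    obtain ⟨y, rfl⟩ := QuotientGroup.mk_surjective γ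
    obtain ⟨x, rfl⟩ := hs y
    refine ⟨c • magnus x, ?_⟩
    rw [map_smul, finiteLevel_magnus, MonoidAlgebra.smul_single, smul_eq_mul, mul_one]

/-- The homomorphism from series to the completed group algebra that extends `q`. -/
noncomputable def toGroupAlgebra (hq : Continuous q) :
    NCSeries (ZMod p) d →ₐ[ZMod p] CompletedGroupAlgebra p Γ :=
  AlgHom.ofLinearMap
    ((LinearMap.pi (finiteLevel hq)).codRestrict
      (Subalgebra.toSubmodule (CompletedGroupAlgebra p Γ)) fun f N M h => mapDomain_finiteLevel hq N M h f)
    (Subtype.ext (funext fun N => by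
      change finiteLevel hq N 1 = 1
      rw [← map_one magnus, finiteLevel_magnus, map_one]
      rfl))
    fun f g => Subtype.ext (funext fun N => finiteLevel_mul hq N f g)

theorem toGroupAlgebra_eq_iff (hq : Continuous q) (f : NCSeries (ZMod p) d)
    (z : CompletedGroupAlgebra p Γ) :
    toGroupAlgebra hq f = z ↔ ∀ N, finiteLevel hq N f = z.1 N := by
  rw [← Subtype.coe_inj, funext_iff]
  rfl

/-- The whole group as an open normal subgroup. -/
def topOpenNormal (Γ : Type*) [Group Γ] [TopologicalSpace Γ] : OpenNormalSubgroup Γ :=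
  { toOpenSubgroup := ⊤, isNormal' := inferInstanceAs (⊤ : Subgroup Γ).Normal }

/-- Series form a compact space, a product of finite sets. The solution sets at the finite levels
are nonempty, closed and directed, so they have a common point. -/
theorem toGroupAlgebra_surjective (hq : Continuous q) (hs : Function.Surjective q) :
    Function.Surjective (toGroupAlgebra hq) := by
  intro z
  let _ : TopologicalSpace (NCSeries (ZMod p) d) :=
    inferInstanceAs (TopologicalSpace (List (Fin d) → ZMod p))
  have : CompactSpace (NCSeries (ZMod p) d) :=
    inferInstanceAs (CompactSpace (List (Fin d) → ZMod p))
  have happly : ∀ w, Continuous fun f : NCSeries (ZMod p) d => f w := fun w =>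
    continuous_apply (A := fun _ : List (Fin d) => ZMod p) w
  let t : OpenNormalSubgroup Γ → Set (NCSeries (ZMod p) d) := fun N =>
    {f | finiteLevel hq N f = z.1 N}
  have hclosed : ∀ N, IsClosed (t N) := by
    intro N
    obtain ⟨n, hn⟩ := exists_finiteLevel_eq_zero hq N
    have h1 : IsLocallyConstant (finiteLevel hq N) := by
      rw [IsLocallyConstant.iff_eventually_eq]
      intro f
      have h2 : ∀ᶠ g in nhds f, ∀ w ∈ words d n, g w = f w := by
        rw [Filter.eventually_all_finset]
        exact fun w _ => (happly w).continuousAt ((isOpen_discrete {f w}).mem_nhds rfl)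
      filter_upwards [h2] with g hg
      refine sub_eq_zero.1 ?_
      have h3 := hn (g - f) fun w hw => sub_eq_zero.2 (hg w (mem_words.2 hw))
      rwa [map_sub] at h3
    exact h1.isClosed_fiber (z.1 N)
  have := IsCompact.nonempty_iInter_of_directed_nonempty_isCompact_isClosed
    (hι := ⟨topOpenNormal Γ⟩) t (fun N M => ⟨N ⊓ M, ?_, ?_⟩)
    (fun N => finiteLevel_surjective hq hs N _) (fun N => (hclosed N).isCompact) hclosed
  · obtain ⟨f, hf⟩ := this
    exact ⟨f, (toGroupAlgebra_eq_iff hq f z).2 fun N => Set.mem_iInter.1 hf N⟩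
  · intro f hf
    change finiteLevel hq N f = z.1 N
    rw [← mapDomain_finiteLevel hq (N ⊓ M) N (fun x hx => hx.1), hf]
    exact z.2 _ _ _
  · intro f hf
    change finiteLevel hq M f = z.1 M
    rw [← mapDomain_finiteLevel hq (N ⊓ M) M (fun x hx => hx.2), hf]
    exact z.2 _ _ _

/-- Functionals coming from locally constant functions factor through the group algebra. -/
theorem functional_eq_zero_of_toGroupAlgebra (hq : IsOpenQuotientMap q)
    (h : LocallyConstant Γ (ZMod p)) {f : NCSeries (ZMod p) d}
    (hf : toGroupAlgebra hq.continuous f = 0) : functional hq.continuous h f = 0 := by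
  obtain ⟨M, hM⟩ := exists_factor (h.isLocallyConstant.comp_continuous hq.continuous)
  -- The function factors through a finite quotient of the free pro-`p` group; the image of the
  -- corresponding kernel is open, and the function is constant on its cosets.
  let N : OpenNormalSubgroup Γ :=
    { toSubgroup := (proj M).ker.map q
      isOpen' := hq.isOpenMap _ (isOpen_ker_proj M)
      isNormal' := Subgroup.Normal.map inferInstance q hq.surjective }
  have hN : ∀ x y : Γ, (x : Γ ⧸ N.toSubgroup) = y → h x = h y := by
    intro x y hxy
    obtain ⟨k, hk, hk'⟩ := QuotientGroup.eq.1 hxy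
    obtain ⟨x, rfl⟩ := hq.surjective x
    have h1 : y = q (x * k) := by rw [map_mul, hk', mul_inv_cancel_left]
    rw [h1]
    refine hM x (x * k) ?_
    rw [map_mul, MonoidHom.mem_ker.1 hk, mul_one]
  let φ : MonoidAlgebra (ZMod p) (Γ ⧸ N.toSubgroup) →ₗ[ZMod p] ZMod p :=
    (Finsupp.lift (ZMod p) (ZMod p) (Γ ⧸ N.toSubgroup) fun γ => h γ.out) ∘ₗ
      (MonoidAlgebra.coeffLinearEquiv (ZMod p)).toLinearMap
  obtain ⟨n, hn⟩ := exists_finiteLevel_eq_zero hq.continuous N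
  have h1 : functional hq.continuous h = φ ∘ₗ finiteLevel hq.continuous N := by
    refine eq_functional _ ⟨n, fun f hf => by rw [LinearMap.comp_apply, hn f hf, map_zero]⟩
      fun x => ?_
    rw [LinearMap.comp_apply, finiteLevel_magnus]
    have h2 : φ (MonoidAlgebra.single (q x : Γ ⧸ N.toSubgroup) 1) =
        h (q x : Γ ⧸ N.toSubgroup).out := by
      simp [φ]
    rw [h2]
    exact hN _ _ (Quotient.out_eq' _)
  rw [h1, LinearMap.comp_apply, (toGroupAlgebra_eq_iff _ f 0).1 hf N]
  exact map_zero φ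

theorem toGroupAlgebra_eq_zero_iff (hq : IsOpenQuotientMap q) {f : NCSeries (ZMod p) d} :
    toGroupAlgebra hq.continuous f = 0 ↔ ∀ h, functional hq.continuous h f = 0 := by
  classical
  refine ⟨fun hf h => functional_eq_zero_of_toGroupAlgebra hq h hf, fun hf =>
    (toGroupAlgebra_eq_iff _ f 0).2 fun N => ?_⟩
  ext γ
  exact hf _

theorem toGroupAlgebra_mem_augmentationIdeal (hq : Continuous q) {f : NCSeries (ZMod p) d} :
    toGroupAlgebra hq f ∈ augmentationIdeal p Γ ↔ f ∈ order (ZMod p) d 1 := by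
  have h1 : ∀ N : OpenNormalSubgroup Γ, toGroupAlgebra hq f ∈ RingHom.ker
      ((MonoidAlgebra.lift (ZMod p) (ZMod p) (Γ ⧸ N.toSubgroup) 1).toRingHom.comp
      ((Pi.evalRingHom _ N).comp (CompletedGroupAlgebra p Γ).val.toRingHom)) ↔ f [] = 0 := by
    intro N
    rw [RingHom.mem_ker, ← augmentation_finiteLevel hq N f]
    rfl
  rw [augmentationIdeal, Ideal.mem_iInf, mem_order_one]
  exact ⟨fun h => (h1 (topOpenNormal Γ)).1 (h _), fun h N => (h1 N).2 h⟩

instance : (augmentationIdeal p Γ).IsTwoSided :=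
  ⟨fun {a} b ha => by
    rw [augmentationIdeal, Ideal.mem_iInf] at ha ⊢
    exact fun N => Ideal.mul_mem_right _ _ (ha N)⟩

/-- The powers of the augmentation ideal are the images of the series of given order. -/
theorem mem_augmentationIdeal_pow (hq : Continuous q) (hs : Function.Surjective q) (n : ℕ)
    (z : CompletedGroupAlgebra p Γ) : z ∈ augmentationIdeal p Γ ^ n ↔
      ∃ f ∈ order (ZMod p) d n, toGroupAlgebra hq f = z := by
  induction n generalizing z with
  | zero =>
    obtain ⟨f, rfl⟩ := toGroupAlgebra_surjective hq hs z
    rw [Submodule.pow_zero, Ideal.one_eq_top]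
    exact ⟨fun _ => ⟨f, mem_order_zero f, rfl⟩, fun _ => Submodule.mem_top⟩
  | succ n ih =>
    rw [Ideal.IsTwoSided.pow_succ]
    constructor
    · intro hz
      induction hz using Submodule.mul_induction_on' with
      | mem_mul_mem a ha b hb =>
        obtain ⟨f, rfl⟩ := toGroupAlgebra_surjective hq hs a
        obtain ⟨g, hg, rfl⟩ := (ih b).1 hb
        refine ⟨f * g, ?_, map_mul _ _ _⟩
        rw [add_comm]
        exact mul_mem_order ((toGroupAlgebra_mem_augmentationIdeal hq).1 ha) hg
      | add a _ b _ ha hb =>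
        obtain ⟨f, hf, rfl⟩ := ha
        obtain ⟨g, hg, rfl⟩ := hb
        exact ⟨f + g, Submodule.add_mem _ hf hg, map_add _ _ _⟩
    · rintro ⟨f, hf, rfl⟩
      -- A series of order n + 1 is the finite sum of X_a times series of order n. Hence no closure
      -- of the algebraic powers is needed.
      rw [← sum_X_mul_shift (hf [] (by simp)), map_sum]
      refine Submodule.sum_mem _ fun a _ => ?_
      rw [map_mul]
      refine Ideal.mul_mem_mul ((toGroupAlgebra_mem_augmentationIdeal hq).2 ?_)
        ((ih _).2 ⟨_, shift_mem_order a hf, rfl⟩)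
      rw [mem_order_one, X_apply, if_neg (by simp)]

end GroupAlgebra

end ProP

namespace ProP

open Finset NCSeries FreeProP

/-! ### Counting normal words. -/

section NormalWords

variable {d : ℕ} {K : Type*}

/-- The words of length `n`. -/
noncomputable def wordsOfLength (d n : ℕ) : Finset (List (Fin d)) :=
  (List.finite_length_eq (Fin d) n).toFinset

@[simp]
theorem mem_wordsOfLength {n : ℕ} {w : List (Fin d)} : w ∈ wordsOfLength d n ↔ w.length = n := by
  simp [wordsOfLength]

open Classical in
/-- The normal words of length `n`: those without a factor in the family `m`. -/
noncomputable def normalWords (m : K → List (Fin d)) (n : ℕ) : Finset (List (Fin d)) :=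
  (wordsOfLength d n).filter (IsNormalWord m)

theorem mem_normalWords {m : K → List (Fin d)} {n : ℕ} {w : List (Fin d)} :
    w ∈ normalWords m n ↔ w.length = n ∧ IsNormalWord m w := by
  simp [normalWords]

theorem IsNormalWord.of_append_left {m : K → List (Fin d)} {u w : List (Fin d)}
    (h : IsNormalWord m (u ++ w)) : IsNormalWord m w := fun k x y hw =>
  h k (u ++ x) y (by rw [hw]; simp)

theorem card_normalWords_zero {m : K → List (Fin d)} (hne : ∀ k, m k ≠ []) :
    (normalWords m 0).card = 1 := by
  rw [card_eq_one]
  refine ⟨[], ?_⟩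
  ext w
  rw [mem_normalWords, mem_singleton, List.length_eq_zero_iff]
  refine ⟨fun h => h.1, fun h => ⟨h, fun k x y hw => hne k ?_⟩⟩
  rw [h] at hw
  simp only [List.append_assoc, List.nil_eq, List.append_eq_nil_iff] at hw
  exact hw.2.1

/-- The recursion for the number of normal words: a normal word preceded by a letter is either
normal or starts with a unique member of the family. -/
theorem CombinatoriallyFree.card_normalWords {m : K → List (Fin d)} (hm : CombinatoriallyFree m)
    (hne : ∀ k, m k ≠ []) (n : ℕ) (S : Finset K) (hS : ∀ k, k ∈ S ↔ (m k).length ≤ n + 1) :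
    d * (normalWords m n).card =
      (normalWords m (n + 1)).card + ∑ k ∈ S, (normalWords m (n + 1 - (m k).length)).card := by
  classical
  -- `T` consists of a letter followed by a normal word, `Q k` of `m k` followed by a normal word.
  -- The recursion says that `T` is the disjoint union of the normal words of length n + 1 and the
  -- `Q k`.
  let T : Finset (List (Fin d)) := (univ ×ˢ normalWords m n).image fun a => a.1 :: a.2
  have hT : T.card = d * (normalWords m n).card := by
    rw [card_image_of_injective, card_product, card_univ, Fintype.card_fin]
    rintro ⟨a, u⟩ ⟨b, v⟩ h
    simpa using h
  let Q : K → Finset (List (Fin d)) := fun k =>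
    (normalWords m (n + 1 - (m k).length)).image (m k ++ ·)
  have hQ : ∀ k, (Q k).card = (normalWords m (n + 1 - (m k).length)).card := fun k =>
    card_image_of_injective _ fun _ _ h => List.append_cancel_left h
  have hmemQ : ∀ k w, w ∈ Q k ↔ ∃ y, IsNormalWord m y ∧ y.length = n + 1 - (m k).length ∧
      w = m k ++ y := by
    intro k w
    simp only [Q, mem_image, mem_normalWords]
    exact ⟨fun ⟨y, h, h'⟩ => ⟨y, h.2, h.1, h'.symm⟩, fun ⟨y, h, h', h''⟩ => ⟨y, ⟨h', h⟩, h''.symm⟩⟩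
  have hdisj : (S : Set K).PairwiseDisjoint Q := by
    intro k _ l _ hkl
    refine disjoint_left.2 fun w hw hw' => hkl ?_
    obtain ⟨y, -, -, rfl⟩ := (hmemQ k w).1 hw
    obtain ⟨y', -, -, h⟩ := (hmemQ l _).1 hw'
    rcases hm.occurrence (x := []) (x' := []) (by simpa using h) with h | ⟨z, h, -⟩ | ⟨z, h, -⟩
    · exact h.1
    · exact absurd (List.append_eq_nil_iff.1 (List.append_eq_nil_iff.1 h.symm).1).2 (hne k)
    · exact absurd (List.append_eq_nil_iff.1 (List.append_eq_nil_iff.1 h.symm).1).2 (hne l)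
  have hunion : T = normalWords m (n + 1) ∪ S.biUnion Q := by
    ext w
    rw [mem_union, mem_biUnion]
    constructor
    · intro hw
      obtain ⟨⟨a, u⟩, hu, rfl⟩ := mem_image.1 hw
      obtain ⟨hlen, hnorm⟩ := mem_normalWords.1 (mem_product.1 hu).2
      by_cases h : IsNormalWord m (a :: u)
      · exact Or.inl (mem_normalWords.2 ⟨by simpa using hlen, h⟩)
      · right
        simp only [IsNormalWord, not_forall, not_not] at h
        obtain ⟨k, x, y, h⟩ := h
        cases x with
        | cons b x =>
          simp only [List.cons_append, List.cons.injEq] at h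
          exact absurd h.2 (hnorm k x y)
        | nil =>
          rw [List.nil_append] at h
          have hl := congrArg List.length h
          simp only [List.length_cons, List.length_append] at hl hlen
          refine ⟨k, (hS k).2 (by omega), (hmemQ k _).2 ⟨y, ?_, by omega, h⟩⟩
          obtain ⟨b, v, hbv⟩ := List.exists_cons_of_ne_nil (hne k)
          rw [hbv, List.cons_append, List.cons.injEq] at h
          rw [h.2] at hnorm
          exact hnorm.of_append_left
    · rintro (hw | ⟨k, hk, hw⟩)
      · obtain ⟨hlen, hnorm⟩ := mem_normalWords.1 hw
        cases w with
        | nil => simp at hlen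
        | cons a u =>
          refine mem_image.2 ⟨(a, u), mem_product.2 ⟨mem_univ _, mem_normalWords.2
            ⟨by simpa using hlen, ?_⟩⟩, rfl⟩
          exact IsNormalWord.of_append_left (u := [a]) hnorm
      · obtain ⟨y, hy, hlen, rfl⟩ := (hmemQ k w).1 hw
        have hk' := (hS k).1 hk
        obtain ⟨b, v, hbv⟩ := List.exists_cons_of_ne_nil (hne k)
        refine mem_image.2 ⟨(b, v ++ y), mem_product.2 ⟨mem_univ _, mem_normalWords.2 ⟨?_, ?_⟩⟩, ?_⟩
        · rw [hbv] at hk' hlen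
          simp only [List.length_cons, List.length_append] at hk' hlen ⊢
          omega
        · intro l x' y' h
          -- Dropping the first letter of `m k ++ y` leaves a normal word: any occurrence that does
          -- not start at the beginning is disjoint from `m k`, hence lies in the normal word `y`.
          have h1 : [] ++ m k ++ y = (b :: x') ++ m l ++ y' := by
            rw [hbv]
            simpa using h
          rcases hm.occurrence h1 with ⟨-, h, -⟩ | ⟨z, -, h⟩ | ⟨z, h, -⟩
          · simp at h
          · exact hy l z y' h
          · simp at h
        · simp [hbv]
  have hdisj' : Disjoint (normalWords m (n + 1)) (S.biUnion Q) := by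
    refine disjoint_left.2 fun w hw hw' => ?_
    obtain ⟨k, -, hk⟩ := mem_biUnion.1 hw'
    obtain ⟨y, -, -, rfl⟩ := (hmemQ k w).1 hk
    exact (mem_normalWords.1 hw).2 k [] y rfl
  rw [← hT, hunion, card_union_of_disjoint hdisj', card_biUnion hdisj]
  exact congrArg _ (sum_congr rfl fun k _ => hQ k)

end NormalWords

/-! ### Normal words as bases of the graded pieces. -/

section GradedPieces

variable {p d : ℕ} [Fact p.Prime] {K : Type*} {Γ : Type*} [Group Γ] [TopologicalSpace Γ]
  [IsTopologicalGroup Γ] [CompactSpace Γ] {q : FreeProP p d →* Γ} {ρ : K → FreeProP p d}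
  {m : K → List (Fin d)}

/-- The functionals dual to the normal words of length `n`. -/
theorem CombinatoriallyFree.exists_dual_functional (hm : CombinatoriallyFree m)
    (hρ : ∀ k, HasHighestTerm (ρ k) (m k)) (n : ℕ) (b : List (Fin d)) :
    ∃ l ∈ relDual ρ, (∀ f ∈ order (ZMod p) d (n + 1), l f = 0) ∧
      ∀ w ∈ normalWords m n, l (mono (ZMod p) w) = if w = b then 1 else 0 := by
  classical
  -- With zero prescribed on the relations the compatibility is trivial, and the values on normal
  -- words remain free. Truncation at n + 1 makes the functional kill order n + 1.
  obtain ⟨ψ, h1, h2, h3⟩ := hm.exists_extension hρ (n + 1) (fun _ _ _ => 0) (fun _ _ _ _ => rfl)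
    (fun _ _ _ _ _ => by simp) (fun w => if w = b then 1 else 0)
  have h4 : ∀ f ∈ order (ZMod p) d (n + 1), pairing (n + 1) ψ f = 0 := fun f hf =>
    sum_eq_zero fun w hw => by rw [hf w (by simpa using hw), zero_mul]
  refine ⟨pairing (n + 1) ψ, mem_relDual_of_mono ⟨n + 1, h4⟩ fun k x y => ?_, h4, fun w hw => ?_⟩
  · rw [apply_mono_mul_mul_mono h4]
    simp only [pairing_mono h1]
    exact h3 k x y
  · obtain ⟨hlen, hnorm⟩ := mem_normalWords.1 hw
    rw [pairing_mono h1, h2 w (by omega) hnorm]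

/-- Modulo the relations and higher order terms, monomials are combinations of normal words. -/
theorem mono_mem_sup {R : Type*} [Field R] {Z : K → NCSeries R d}
    (hZ : ∀ k, IsHighestTerm (Z k) (m k)) (n : ℕ) (J : Submodule R (NCSeries R d))
    (hJ : ∀ k x y, mono R x * Z k * mono R y ∈ J) (hJn : order R d (n + 1) ≤ J)
    (w : List (Fin d)) (hw : w.length = n) :
    mono R w ∈ J ⊔ Submodule.span R (mono R '' (normalWords m n : Set (List (Fin d)))) := by
  classical
  -- Reduction along the monomial order: a factor `m k` is replaced by the smaller terms of Z_k;
  -- those of larger degree already lie in `J`.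
  have key : ∀ w : {w : List (Fin d) // w.length < n + 1}, w.1.length = n → mono R w.1 ∈
      J ⊔ Submodule.span R (mono R '' (normalWords m n : Set (List (Fin d)))) := by
    intro w
    induction w using (wordLT_wellFounded (n + 1)).induction with
    | _ w ih =>
    intro hw
    by_cases hnorm : IsNormalWord m w.1
    · exact Submodule.mem_sup_right (Submodule.subset_span
        ⟨w.1, mem_normalWords.2 ⟨hw, hnorm⟩, rfl⟩)
    simp only [IsNormalWord, not_forall, not_not] at hnorm
    obtain ⟨k, x, y, hwk⟩ := hnorm
    set S := J ⊔ Submodule.span R (mono R '' (normalWords m n : Set (List (Fin d))))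
    have hJS : J ≤ S := le_sup_left
    have h1 : mono R x * (∑ v ∈ words d (n + 1), Z k v • mono R v) * mono R y ∈ S := by
      have h2 : mono R x * (Z k - ∑ v ∈ words d (n + 1), Z k v • mono R v) * mono R y ∈ S :=
        hJS (hJn (mul_mem_order_left (mul_mem_order_right _ (sub_sum_mono_mem_order _ _)) _))
      have h3 := S.sub_mem (hJS (hJ k x y)) h2
      rw [mul_sub, sub_mul, sub_sub_cancel] at h3
      exact h3
    have hmk : m k ∈ words d (n + 1) := by
      rw [mem_words]
      rw [hwk] at hw
      simp only [List.length_append] at hw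
      omega
    rw [mul_sum, sum_mul, ← add_sum_erase _ _ hmk] at h1
    have h2 : ∑ v ∈ (words d (n + 1)).erase (m k),
        mono R x * (Z k v • mono R v) * mono R y ∈ S := by
      refine S.sum_mem fun v hv => ?_
      rw [mul_smul_comm, smul_mul_assoc, ← mono_append, ← mono_append]
      by_cases hz : Z k v = 0
      · rw [hz, zero_smul]
        exact S.zero_mem
      refine S.smul_mem _ ?_
      have hlt := (hZ k).wordLT_append hz (mem_erase.1 hv).1 x y
      rw [← hwk] at hlt
      rcases Nat.lt_or_ge (x ++ v ++ y).length (n + 1) with hl | hl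
      · have hlen : (x ++ v ++ y).length = n := by
          have := hlt.length_le
          omega
        exact ih ⟨_, hl⟩ hlt hlen
      · exact hJS (hJn (order_anti hl (mono_mem_order _)))
    have h3 := (Submodule.add_mem_iff_left S h2).1 h1
    rw [mul_smul_comm, smul_mul_assoc, ← mono_append, ← mono_append, ← hwk] at h3
    exact (Submodule.smul_mem_iff S (hZ k).1).1 h3
  exact key ⟨w, by omega⟩ hw

namespace IsPresentation

variable (P : IsPresentation q ρ)

include P

/-- The graded pieces of the completed group algebra have the normal words as a basis. -/
theorem nonempty_gradedPiece_equiv (hm : CombinatoriallyFree m)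
    (hρ : ∀ k, HasHighestTerm (ρ k) (m k)) (n : ℕ) :
    Nonempty (GradedPiece p Γ n ≃ₗ[ZMod p] (normalWords m n → ZMod p)) := by
  classical
  have hq := P.isOpenQuotientMap
  set θ := toGroupAlgebra hq.continuous with hθ
  choose l hlrel hlorder hldual using hm.exists_dual_functional hρ n
  have hlker : ∀ b f, θ f = 0 → l b f = 0 := by
    intro b f hf
    obtain ⟨h, hh⟩ := P.exists_functional_eq (hlrel b)
    rw [← hh]
    exact functional_eq_zero_of_toGroupAlgebra hq h hf
  let L : order (ZMod p) d n →ₗ[ZMod p] (normalWords m n → ZMod p) :=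
    LinearMap.pi fun b => l b.1 ∘ₗ (order (ZMod p) d n).subtype
  have hmem : ∀ k z, z ∈ augmentationFiltration p Γ k ↔ ∃ f ∈ order (ZMod p) d k, θ f = z :=
    fun k z => mem_augmentationIdeal_pow hq.continuous hq.surjective k z
  let Θ : order (ZMod p) d n →ₗ[ZMod p] GradedPiece p Γ n :=
    (Submodule.mkQ _) ∘ₗ ((θ.toLinearMap ∘ₗ (order (ZMod p) d n).subtype).codRestrict
      (augmentationFiltration p Γ n) fun f => (hmem n _).2 ⟨f.1, f.2, rfl⟩)
  have hΘ : Function.Surjective Θ := by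
    refine (Submodule.mkQ_surjective _).comp fun z => ?_
    obtain ⟨f, hf, hfz⟩ := (hmem n _).1 z.2
    exact ⟨⟨f, hf⟩, Subtype.ext hfz⟩
  have hL : Function.Surjective L := by
    intro c
    refine ⟨⟨∑ b : normalWords m n, c b • mono (ZMod p) b.1, Submodule.sum_mem _ fun b _ =>
      Submodule.smul_mem _ _ ?_⟩, ?_⟩
    · have := mono_mem_order (R := ZMod p) b.1
      rwa [(mem_normalWords.1 b.2).1] at this
    · funext b
      change l b.1 (∑ b' : normalWords m n, c b' • mono (ZMod p) b'.1) = c b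
      rw [map_sum, sum_eq_single b]
      · rw [map_smul, hldual _ _ b.2, if_pos rfl, smul_eq_mul, mul_one]
      · intro b' _ hb
        rw [map_smul, hldual _ _ b'.2, if_neg fun h => hb (Subtype.ext h), smul_zero]
      · simp
  -- Both the graded piece and the functions on normal words are quotients of the series of order n.
  -- Equality of the kernels combines the spanning statement with the dual functionals, which vanish
  -- on order n + 1 and on the kernel of `θ`.
  have hker : LinearMap.ker Θ = LinearMap.ker L := by
    ext f
    have h1 : f ∈ LinearMap.ker Θ ↔ θ f.1 ∈ augmentationFiltration p Γ (n + 1) := by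
      rw [LinearMap.mem_ker]
      exact Submodule.Quotient.mk_eq_zero _
    rw [h1, hmem, LinearMap.mem_ker]
    constructor
    · rintro ⟨g, hg, hgf⟩
      funext b
      change l b.1 f.1 = 0
      have h2 := hlker b.1 (f.1 - g) (by rw [map_sub, hgf, sub_self])
      rw [map_sub, hlorder _ g hg, sub_zero] at h2
      exact h2
    · intro hf
      set J := order (ZMod p) d (n + 1) ⊔ LinearMap.ker θ.toLinearMap with hJ
      have hspan : ∀ w : List (Fin d), w.length = n → mono (ZMod p) w ∈ J ⊔
          Submodule.span (ZMod p) (mono (ZMod p) '' (normalWords m n : Set (List (Fin d)))) := by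
        refine mono_mem_sup hρ n J (fun k x y => Submodule.mem_sup_right ?_) le_sup_left
        rw [LinearMap.mem_ker]
        exact (toGroupAlgebra_eq_zero_iff hq).2 fun h =>
          functional_mul_magnusSub_mul _ h (P.map_relation k) _ _
      have hf' : f.1 ∈ J ⊔
          Submodule.span (ZMod p) (mono (ZMod p) '' (normalWords m n : Set (List (Fin d)))) := by
        rw [← sub_add_cancel f.1 (∑ w ∈ words d (n + 1), f.1 w • mono (ZMod p) w)]
        refine Submodule.add_mem _ (Submodule.mem_sup_left (Submodule.mem_sup_left
          (sub_sum_mono_mem_order _ _))) (Submodule.sum_mem _ fun w hw => ?_)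
        rcases Nat.lt_or_ge w.length n with hl | hl
        · rw [f.2 w hl, zero_smul]
          exact Submodule.zero_mem _
        · exact Submodule.smul_mem _ _ (hspan w (by have := mem_words.1 hw; omega))
      obtain ⟨j, hj, s, hs, hjs⟩ := Submodule.mem_sup.1 hf'
      have hlJ : ∀ b, l b j = 0 := by
        intro b
        obtain ⟨u, hu, v, hv, rfl⟩ := Submodule.mem_sup.1 hj
        rw [map_add, hlorder b u hu, hlker b v hv, add_zero]
      have hs0 : s = 0 := by
        rw [Finsupp.mem_span_image_iff_linearCombination] at hs
        obtain ⟨c, hc, rfl⟩ := hs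
        suffices h : c = 0 by rw [h, map_zero]
        ext b
        by_cases hb : b ∈ c.support
        · have h2 : l b f.1 = 0 := congrFun hf ⟨b, hc hb⟩
          rw [← hjs, map_add, hlJ, zero_add, Finsupp.linearCombination_apply, Finsupp.sum,
            map_sum, sum_eq_single_of_mem b hb] at h2
          · rwa [map_smul, hldual _ _ (hc hb), if_pos rfl, smul_eq_mul, mul_one] at h2
          · intro b' hb' hne
            rw [map_smul, hldual _ _ (hc hb'), if_neg hne, smul_zero]
        · exact Finsupp.notMem_support_iff.1 hb
      rw [hs0, add_zero] at hjs
      obtain ⟨u, hu, v, hv, huv⟩ := Submodule.mem_sup.1 hj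
      refine ⟨u, hu, ?_⟩
      have hv' : θ v = 0 := hv
      rw [← hjs, ← huv, map_add, hv', add_zero]
  exact ⟨(Θ.quotKerEquivOfSurjective hΘ).symm.trans
    ((Submodule.quotEquivOfEq _ _ hker).trans (L.quotKerEquivOfSurjective hL))⟩

theorem finite_gradedPiece (hm : CombinatoriallyFree m) (hρ : ∀ k, HasHighestTerm (ρ k) (m k))
    (n : ℕ) : Module.Finite (ZMod p) (GradedPiece p Γ n) := by
  obtain ⟨e⟩ := P.nonempty_gradedPiece_equiv hm hρ n
  exact Module.Finite.equiv e.symm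

theorem finrank_gradedPiece (hm : CombinatoriallyFree m) (hρ : ∀ k, HasHighestTerm (ρ k) (m k))
    (n : ℕ) : Module.finrank (ZMod p) (GradedPiece p Γ n) = (normalWords m n).card := by
  obtain ⟨e⟩ := P.nonempty_gradedPiece_equiv hm hρ n
  rw [e.finrank_eq, Module.finrank_fintype_fun_eq_card, Fintype.card_coe]

end IsPresentation

end GradedPieces

end ProP

namespace ProP

open Finset NCSeries FreeProP

/-! ### Commutators with prescribed highest terms. -/

section ExtraTerms

variable {p d : ℕ} [Fact p.Prime]

theorem length_extraTerm (i₀ j₀ : Fin d) (n : ℕ) : (extraTerm i₀ j₀ n).length = n + 2 := by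
  simp [extraTerm]

/-- The lowest degree part of `Z` has degree `w.length`, involves only words whose first letter is
at most the first letter of `w`, and `w` is the only word with that first letter. -/
structure IsLeading {R : Type*} [CommRing R] (Z : NCSeries R d) (j : Fin d) (w : List (Fin d)) :
    Prop where
  mem_order : Z ∈ order R d (w.length + 1)
  apply_ne_zero : Z (j :: w) ≠ 0
  eq_zero : ∀ (a : Fin d) (v : List (Fin d)), v.length = w.length → j ≤ a → a :: v ≠ j :: w →
    Z (a :: v) = 0

theorem IsLeading.isHighestTerm {R : Type*} [CommRing R] {Z : NCSeries R d} {j : Fin d}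
    {w : List (Fin d)} (h : IsLeading Z j w) : IsHighestTerm Z (j :: w) := by
  refine ⟨h.apply_ne_zero, fun v hv hne => ?_⟩
  rcases lt_trichotomy v.length (w.length + 1) with hl | hl | hl
  · exact absurd (h.mem_order v hl) hv
  · refine Or.inr ⟨by simpa using hl, ?_⟩
    cases v with
    | nil => simp at hl
    | cons a v =>
      refine List.Lex.rel (not_le.1 fun hja => hv (h.eq_zero a v (by simpa using hl) hja hne))
  · exact Or.inl (by simpa using hl)

theorem mul_X_append {R : Type*} [CommRing R] (f : NCSeries R d) (i : Fin d) :
    ∀ (v : List (Fin d)) (b : Fin d), (f * X R i) (v ++ [b]) = if b = i then f v else 0 := by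
  intro v
  induction v generalizing f with
  | nil =>
    intro b
    rw [List.nil_append, mul_cons, mul_nil]
    simp [X_apply]
  | cons a v ih =>
    intro b
    rw [List.cons_append, mul_cons, ih, X_apply, if_neg (by simp), mul_zero, zero_add]
    rfl

/-- Multiplication by a series with constant term one does not change the lowest degree part. -/
theorem mul_apply_of_order {R : Type*} [CommRing R] {f g : NCSeries R d} {w : List (Fin d)}
    (hf : f ∈ order R d w.length) (hg : g [] = 1) : (f * g) w = f w := by
  rw [mul_apply, sum_range_succ, List.take_length, List.drop_length, hg, mul_one, sum_eq_zero,
    zero_add]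
  intro i hi
  rw [hf _ (by rw [List.length_take]; have := mem_range.1 hi; omega), zero_mul]

/-- From zxz⁻¹x⁻¹ - 1 = (zx - xz) z⁻¹x⁻¹. The lowest degree part of a commutator is thus governed by
the bracket of z - 1 and x - 1, as the last factor has constant term 1. -/
theorem magnusSub_commutator (z x : FreeProP p d) : magnusSub (z * x * z⁻¹ * x⁻¹) =
    (magnusSub z * magnusSub x - magnusSub x * magnusSub z) * magnus (z⁻¹ * x⁻¹) := by
  have h : magnus x * magnus z * magnus (z⁻¹ * x⁻¹) = 1 := by
    rw [← map_mul, ← map_mul, ← map_one magnus]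
    congr 1
    group
  have h1 : magnusSub z * magnusSub x - magnusSub x * magnusSub z =
      magnus z * magnus x - magnus x * magnus z := by
    simp only [magnusSub]
    noncomm_ring
  rw [h1, sub_mul, h, magnusSub, mul_assoc _ z⁻¹ x⁻¹, map_mul, map_mul]

/-- Commutation with a smaller generator appends a letter to the leading word. -/
theorem IsLeading.commutator {z : FreeProP p d} {j i : Fin d} {w : List (Fin d)}
    (h : IsLeading (magnusSub z) j w) (hij : i < j) :
    IsLeading (magnusSub (z * of i * z⁻¹ * (of i)⁻¹)) j (w ++ [i]) := by
  have hX : magnusSub (of i : FreeProP p d) = X (ZMod p) i := by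
    rw [magnusSub, magnus_of, add_sub_cancel_left]
  have hXo : X (ZMod p) i ∈ order (ZMod p) d 1 := by
    rw [mem_order_one, X_apply, if_neg (by simp)]
  have hord : magnusSub z * X (ZMod p) i - X (ZMod p) i * magnusSub z ∈
      order (ZMod p) d (w.length + 2) := by
    have h1 := mul_mem_order h.mem_order hXo
    have h2 := mul_mem_order hXo h.mem_order
    rw [add_comm 1] at h2
    exact Submodule.sub_mem _ h1 h2
  have hlen : (w ++ [i]).length = w.length + 1 := by simp
  -- Words whose first letter is at least `j > i` receive no contribution from X_i Z, so only Z X_i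
  -- matters, and it appends the letter `i`.
  have hval : ∀ a v b, (a :: (v ++ [b])).length = w.length + 2 → j ≤ a →
      magnusSub (z * of i * z⁻¹ * (of i)⁻¹) (a :: (v ++ [b])) =
        if b = i then magnusSub z (a :: v) else 0 := by
    intro a v b hl hja
    rw [magnusSub_commutator, hX, mul_apply_of_order (by rw [hl]; exact hord) (magnus_nil _),
      NCSeries.sub_apply, X_mul_cons, if_neg (hij.trans_le hja).ne', sub_zero, ← List.cons_append,
      mul_X_append]
  refine ⟨?_, ?_, ?_⟩
  · rw [hlen, magnusSub_commutator, hX]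
    exact mul_mem_order_left hord _
  · rw [hval j w i (by simp) le_rfl, if_pos rfl]
    exact h.apply_ne_zero
  · intro a v hl hja hne
    rcases List.eq_nil_or_concat v with rfl | ⟨v, b, rfl⟩
    · simp at hl
    · rw [List.concat_eq_append] at *
      simp only [List.length_append, List.length_singleton, Nat.add_right_cancel_iff] at hl
      rw [hval a v b (by simp [hl]) hja]
      split_ifs with hb
      · subst hb
        refine h.eq_zero a v hl hja fun h' => hne ?_
        rw [List.cons.injEq] at h' ⊢
        exact ⟨h'.1, by rw [h'.2]⟩
      · rfl

theorem isLeading_of (j : Fin d) : IsLeading (magnusSub (of j : FreeProP p d)) j [] := by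
  have hX : magnusSub (of j : FreeProP p d) = X (ZMod p) j := by
    rw [magnusSub, magnus_of, add_sub_cancel_left]
  rw [hX]
  refine ⟨?_, by simp [X_apply], fun a v hv _ hne => ?_⟩
  · rw [List.length_nil, zero_add, mem_order_one, X_apply, if_neg (by simp)]
  · rw [X_apply, if_neg]
    exact hne

/-- Iterated commutators have the highest terms `X_j X_i^n X_1`. -/
theorem exists_hasHighestTerm_extraTerm {i₀ j₀ : Fin d} (h : i₀ < j₀) (n : ℕ) :
    ∃ x : FreeProP p d, HasHighestTerm x (extraTerm i₀ j₀ n) := by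
  have h1 : ∀ n : ℕ, ∃ z : FreeProP p d, IsLeading (magnusSub z) j₀ (List.replicate n i₀) := by
    intro n
    induction n with
    | zero => exact ⟨of j₀, isLeading_of j₀⟩
    | succ n ih =>
      obtain ⟨z, hz⟩ := ih
      exact ⟨_, List.replicate_succ' ▸ hz.commutator h⟩
  obtain ⟨z, hz⟩ := h1 n
  refine ⟨_, (hz.commutator (i := ⟨0, j₀.pos⟩) ?_).isHighestTerm⟩
  exact Fin.lt_def.2 (by have := Fin.lt_def.1 h; simp only; omega)

end ExtraTerms

/-! ### The family of highest terms and its Hilbert series. -/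

section TermFamily

variable {d r c : ℕ} {s t : Fin r → Fin d} {i₀ j₀ : Fin d}

theorem length_termFamily_inl (i : Fin r) : (termFamily s t i₀ j₀ (Sum.inl i)).length = 2 := rfl

theorem length_termFamily_inr (n : ℕ+) :
    (termFamily s t i₀ j₀ (Sum.inr n)).length = n + 2 := length_extraTerm i₀ j₀ n

/-- The members of the family start with a large letter that is followed by small letters only. -/
theorem exists_termFamily_eq (hs : ∀ i, (s i : ℕ) < c) (ht : ∀ i, c ≤ (t i : ℕ))
    (hi : (i₀ : ℕ) < c) (hj : c ≤ (j₀ : ℕ)) (k : Fin r ⊕ ℕ+) :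
    ∃ a v, termFamily s t i₀ j₀ k = a :: v ∧ c ≤ (a : ℕ) ∧ v ≠ [] ∧ ∀ b ∈ v, (b : ℕ) < c := by
  rcases k with k | n
  · exact ⟨t k, [s k], rfl, ht k, by simp, by simpa using hs k⟩
  · refine ⟨j₀, _, rfl, hj, by simp, fun b hb => ?_⟩
    simp only [List.mem_append, List.mem_singleton] at hb
    rcases hb with hb | rfl
    · rw [List.eq_of_mem_replicate hb]
      exact hi
    · simp only
      omega

/-- A large letter occurs in a member only in first position. This excludes overlaps and forces a
factor to be a prefix. Two quadratic members agree only if their pairs do; a quadratic prefix of an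
extra term would be the excluded pair (i₀, j₀); an extra term that is a prefix of a longer one would
have its final X_1 where the other has X_{i₀}, and i₀ is not the first letter. -/
theorem combinatoriallyFree_termFamily (hs : ∀ i, (s i : ℕ) < c) (ht : ∀ i, c ≤ (t i : ℕ))
    (hinj : Function.Injective fun i => (s i, t i)) (hi0 : 0 < (i₀ : ℕ)) (hi : (i₀ : ℕ) < c)
    (hj : c ≤ (j₀ : ℕ)) (hne : ∀ i, (s i, t i) ≠ (i₀, j₀)) :
    CombinatoriallyFree (termFamily s t i₀ j₀) := by
  have hform := exists_termFamily_eq hs ht hi hj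
  constructor
  · rintro k l hkl ⟨x, y, hxy⟩
    obtain ⟨a, v, hk, ha, hv, hv'⟩ := hform k
    obtain ⟨b, u, hl, hb, hu, hu'⟩ := hform l
    -- the occurrence is at the start
    have hx : x = [] := by
      cases x with
      | nil => rfl
      | cons e x =>
        rw [hk, hl, List.cons_append, List.cons_append, List.cons.injEq] at hxy
        have := hu' a (by rw [← hxy.2]; simp)
        omega
    subst hx
    rw [List.nil_append] at hxy
    rcases k with k | n <;> rcases l with l | n'
    · simp only [termFamily, Sum.elim_inl, List.cons_append, List.nil_append,
        List.cons.injEq] at hxy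
      exact hkl (congrArg _ (hinj (Prod.ext hxy.2.1 hxy.1)))
    · obtain ⟨n', rfl⟩ : ∃ e, n' = Nat.succPNat e := ⟨_, (PNat.succPNat_natPred n').symm⟩
      simp only [termFamily, Sum.elim_inl, Sum.elim_inr, extraTerm, Nat.succPNat_coe,
        List.replicate_succ, List.cons_append, List.nil_append, List.cons.injEq] at hxy
      exact hne k (Prod.ext hxy.2.1 hxy.1)
    · have h1 := congrArg List.length hxy
      rw [List.length_append, length_termFamily_inl, length_termFamily_inr] at h1
      have := n.pos
      omega
    · have h0 : ((⟨0, j₀.pos⟩ : Fin d)) ≠ i₀ := fun h => by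
        rw [← h] at hi0
        simp at hi0
      have h1 := congrArg List.length hxy
      rw [List.length_append, length_termFamily_inr, length_termFamily_inr] at h1
      have hn : (n : ℕ) < n' := by
        refine lt_of_le_of_ne (by omega) fun h => hkl (congrArg _ (PNat.eq h))
      have h2 := congrArg (fun w => w[(n : ℕ) + 1]?) hxy
      simp only [termFamily, Sum.elim_inr, extraTerm, List.cons_append, List.getElem?_cons_succ,
        List.append_assoc] at h2
      rw [List.getElem?_append_right (by simp), List.getElem?_append_left (by simpa using hn)] at h2
      simp [hn] at h2
      exact h0 h2
  · intro k l a b a' b' ha hb ha' hb' hk hl hab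
    obtain ⟨e, v, hk', he, -, -⟩ := hform k
    obtain ⟨e', v', hl', -, -, hv'⟩ := hform l
    obtain ⟨u, a₁, rfl⟩ := List.exists_cons_of_ne_nil ha
    obtain ⟨u', a₂, rfl⟩ := List.exists_cons_of_ne_nil ha'
    rw [hk', List.cons_append, List.cons.injEq] at hk
    rw [hl', List.cons_append, List.cons.injEq] at hl
    have := hv' u (by rw [hl.2, ← hab]; simp)
    rw [hk.1] at he
    omega

/-- If there are few relations, some pair of letters is not the highest term of a relation. -/
theorem exists_pair_notMem (hcd : r < (d - c) * (c - 1)) :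
    ∃ i₀ j₀ : Fin d, 0 < (i₀ : ℕ) ∧ (i₀ : ℕ) < c ∧ c ≤ (j₀ : ℕ) ∧
      ∀ i, (s i, t i) ≠ (i₀, j₀) := by
  classical
  have hd : c < d := by
    by_contra h
    rw [Nat.sub_eq_zero_of_le (by omega), zero_mul] at hcd
    omega
  -- The small letter is shifted by one to avoid X_1, leaving (d - c)(c - 1) admissible pairs.
  let g : Fin (d - c) × Fin (c - 1) → Fin d × Fin d := fun x =>
    (⟨x.2 + 1, by have := x.2.2; omega⟩, ⟨c + x.1, by have := x.1.2; omega⟩)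
  have hg : Function.Injective g := by
    rintro ⟨a, b⟩ ⟨a', b'⟩ h
    simp only [g, Prod.mk.injEq, Fin.mk.injEq] at h
    rw [Prod.mk.injEq, Fin.ext_iff, Fin.ext_iff]
    omega
  obtain ⟨x, hx, hx'⟩ := Finset.exists_mem_notMem_of_card_lt_card
    (s := univ.image fun i => (s i, t i)) (t := univ.image g) (by
      rw [card_image_of_injective _ hg, card_univ, Fintype.card_prod, Fintype.card_fin,
        Fintype.card_fin]
      exact (card_image_le.trans (by simp)).trans_lt hcd)
  obtain ⟨y, -, rfl⟩ := mem_image.1 hx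
  refine ⟨(g y).1, (g y).2, by simp [g], ?_, by simp [g], fun i hi => ?_⟩
  · have := y.2.2
    simp only [g]
    omega
  · exact hx' (mem_image.2 ⟨i, mem_univ _, hi⟩)

/-- The Hilbert series of the normal words. -/
theorem mk_card_normalWords (hm : CombinatoriallyFree (termFamily s t i₀ j₀)) :
    (PowerSeries.mk fun n => ((normalWords (termFamily s t i₀ j₀) n).card : ℚ)) =
      (1 - (d : PowerSeries ℚ) * PowerSeries.X + (r : PowerSeries ℚ) * PowerSeries.X ^ 2 +
        PowerSeries.X ^ 3 * PowerSeries.mk fun _ => (1 : ℚ))⁻¹ := by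
  classical
  set m := termFamily s t i₀ j₀
  set b : ℕ → ℕ := fun n => (normalWords m n).card
  have hne : ∀ k, m k ≠ [] := by
    rintro (k | n) <;> exact List.cons_ne_nil _ _
  have hb0 : b 0 = 1 := card_normalWords_zero hne
  have hb1 : d * b 0 = b 1 := by
    have := hm.card_normalWords hne 0 ∅ (by
      rintro (k | n)
      · simp [m, length_termFamily_inl]
      · simp [m, length_termFamily_inr])
    simpa using this
  have hb2 : ∀ n, d * b (n + 1) = b (n + 2) + r * b n + ∑ i ∈ range n, b (n - 1 - i) := by
    intro n
    -- The members of length at most n + 2 are all `r` quadratic words and the extra terms with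
    -- exponent i + 1 for i < n, of length i + 3.
    let S : Finset (Fin r ⊕ ℕ+) := univ.disjSum ((range n).image Nat.succPNat)
    have := hm.card_normalWords hne (n + 1) S (by
      rintro (k | e)
      · simp [S, m, length_termFamily_inl]
      · simp only [S, m, length_termFamily_inr, inr_mem_disjSum, mem_image, mem_range]
        constructor
        · rintro ⟨a, ha, rfl⟩
          rw [Nat.succPNat_coe]
          omega
        · intro h
          refine ⟨e.natPred, ?_, PNat.succPNat_natPred e⟩
          have := PNat.natPred_add_one e
          omega)
    rw [sum_disjSum, sum_image fun _ _ _ _ h => Nat.succPNat_injective h] at this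
    simp only [m, length_termFamily_inl, length_termFamily_inr, Nat.succPNat_coe, sum_const,
      card_univ, Fintype.card_fin, smul_eq_mul] at this
    rw [← add_assoc] at this
    rw [show d * b (n + 1) = _ from this]
    refine congrArg₂ _ rfl (sum_congr rfl fun i hi => ?_)
    have := mem_range.1 hi
    change b _ = b _
    congr 1
    omega
  rw [PowerSeries.eq_inv_iff_mul_eq_one (by simp)]
  have hX : ∀ n, PowerSeries.coeff n ((PowerSeries.mk fun n => (b n : ℚ)) *
      PowerSeries.mk fun _ => (1 : ℚ)) = ∑ i ∈ range (n + 1), (b (n - i) : ℚ) := by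
    intro n
    rw [PowerSeries.coeff_mul, Finset.Nat.sum_antidiagonal_eq_sum_range_succ_mk,
      ← sum_range_reflect]
    simp only [PowerSeries.coeff_mk, mul_one]
    refine sum_congr rfl fun i _ => ?_
    congr 2
  have hrw : (PowerSeries.mk fun n => (b n : ℚ)) *
      (1 - (d : PowerSeries ℚ) * PowerSeries.X + (r : PowerSeries ℚ) * PowerSeries.X ^ 2 +
        PowerSeries.X ^ 3 * PowerSeries.mk fun _ => (1 : ℚ)) =
      (PowerSeries.mk fun n => (b n : ℚ)) -
        PowerSeries.C (d : ℚ) * (PowerSeries.X * PowerSeries.mk fun n => (b n : ℚ)) +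
        PowerSeries.C (r : ℚ) * (PowerSeries.X ^ 2 * PowerSeries.mk fun n => (b n : ℚ)) +
        PowerSeries.X ^ 3 * ((PowerSeries.mk fun n => (b n : ℚ)) *
          PowerSeries.mk fun _ => (1 : ℚ)) := by
    rw [map_natCast, map_natCast]
    ring
  rw [hrw]
  ext n
  simp only [map_add, map_sub, PowerSeries.coeff_C_mul, PowerSeries.coeff_mk,
    PowerSeries.coeff_X_pow_mul']
  match n with
  | 0 => simp [hb0]
  | 1 =>
    have : (d : ℚ) * b 0 = b 1 := by exact_mod_cast hb1
    simp [PowerSeries.coeff_one, ← this]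
  | 2 =>
    have h : (d : ℚ) * b 1 = b 2 + r * b 0 := by
      have h' := hb2 0
      simp only [range_zero, sum_empty, add_zero, zero_add] at h'
      exact_mod_cast h'
    rw [PowerSeries.coeff_succ_X_mul, PowerSeries.coeff_mk, h]
    simp [PowerSeries.coeff_one]
  | n + 3 =>
    have h : (d : ℚ) * b (n + 2) = b (n + 3) + r * b (n + 1) +
        ∑ i ∈ range (n + 1), (b (n - i) : ℚ) := by
      have h' := hb2 (n + 1)
      rw [Nat.add_sub_cancel] at h'
      exact_mod_cast h'
    rw [PowerSeries.coeff_succ_X_mul, PowerSeries.coeff_mk, h, if_pos (by omega),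
      if_pos (by omega), show n + 3 - 2 = n + 1 by omega, show n + 3 - 3 = n by omega, hX,
      PowerSeries.coeff_one, if_neg (by omega)]
    ring

end TermFamily

end ProP

namespace ProP

open Finset NCSeries FreeProP

/-! ### Assembling the properties of the quotient Γ. -/

section CutQuotient

variable {p d : ℕ} [Fact p.Prime]

theorem IsHighestTerm.mem_order {R : Type*} [CommRing R] {Z : NCSeries R d} {w : List (Fin d)}
    (h : IsHighestTerm Z w) : Z ∈ order R d w.length := by
  intro v hv
  by_contra hne
  have h1 := (h.2 v hne (by rintro rfl; omega)).length_le
  omega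

namespace IsPresentation

variable {K : Type*} {Γ : Type} [Group Γ] [TopologicalSpace Γ]
  {q : FreeProP p d →* Γ} {ρ : K → FreeProP p d} (P : IsPresentation q ρ) {m : K → List (Fin d)}

include P

/-- Homomorphisms to `𝔽_p` vanish on relations without linear terms. -/
theorem hom_eq_zero_of_mem_ker (hρ : ∀ k, magnusSub (ρ k) ∈ order (ZMod p) d 2)
    (χ : FreeProP p d → ZMod p) (hχ : IsLocallyConstant χ) (hmul : ∀ x y, χ (x * y) = χ x + χ y) :
    ∀ n ∈ q.ker, χ n = 0 := by
  let T : Subgroup (FreeProP p d) :=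
    (MonoidHom.mk' (fun x => Multiplicative.ofAdd (χ x)) fun x y => by
      rw [hmul, ofAdd_add]).ker
  have hT : ∀ x, x ∈ T ↔ χ x = 0 := fun x => Iff.rfl
  have hclosed : IsClosed (T : Set (FreeProP p d)) := hχ.isClosed_fiber 0
  intro n hn
  rw [P.ker_eq] at hn
  refine (hT n).1 (closedNormalClosure_le hclosed ?_ hn)
  rintro _ ⟨k, rfl⟩
  refine (hT _).2 ?_
  rw [hom_eq_sum hχ hmul]
  refine sum_eq_zero fun i _ => ?_
  have h1 := hρ k [i] (by simp)
  rw [magnusSub, NCSeries.sub_apply, one_apply, if_neg (by simp), sub_zero] at h1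
  rw [h1, mul_zero]

/-- The relations are separated by functions that are additive along the relation subgroup. -/
theorem exists_primitive [DecidableEq K] (hm : CombinatoriallyFree m)
    (hρ : ∀ k, HasHighestTerm (ρ k) (m k)) (k : K) :
    ∃ a ∈ primitives q, ∀ j, a (ρ j) = if k = j then 1 else 0 := by
  -- The constant coefficient kills the relations because they have no constant term; placing it at
  -- the index `k` alone gives the functional separating `ρ k` from the others.
  have hc : constCoeffₗ (ZMod p) d ∈ relDual ρ := ⟨constCoeffₗ_mem, fun j f g => by
    rw [constCoeffₗ_apply, mul_nil, mul_nil, magnusSub_nil, mul_zero, zero_mul]⟩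
  obtain ⟨l, hl, hlρ⟩ := hm.exists_functional hρ (Finsupp.single k ⟨_, hc⟩)
  have h1 : ∀ j f g, l (f * magnusSub (ρ j) * g) = f [] * if k = j then g [] else 0 := by
    intro j f g
    rw [hlρ, Finsupp.single_apply]
    split_ifs <;> rfl
  have h2 : ∀ j, l (magnusSub (ρ j)) = if k = j then 1 else 0 := by
    intro j
    have := h1 j 1 1
    rwa [one_mul, mul_one, one_apply, if_pos rfl, one_mul] at this
  -- Multiplicativity extends from the relations to the whole kernel. With one factor trivial and
  -- the other a Magnus image, it becomes additivity of x ↦ l(φ(x) - 1) along the kernel.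
  have h3 : ∀ x ∈ q.ker, ∀ f g, l (f * magnusSub x * g) = f [] * g [] * l (magnusSub x) := by
    intro x hx
    rw [P.ker_eq] at hx
    refine apply_mul_magnusSub_mul hl (fun j f g => ?_) hx
    rw [h1, h2]
    split_ifs <;> ring
  refine ⟨fun x => l (magnusSub x), ⟨?_, fun n hn x => ⟨?_, ?_⟩⟩, h2⟩
  · simpa using isLocallyConstant_mul_magnusSub_mul hl 1 1
  · have h4 := h3 n hn 1 (magnus x)
    rw [one_mul, one_apply, if_pos rfl, one_mul, magnus_nil, one_mul] at h4
    simp only [magnusSub_mul, map_add, h4]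
  · have h4 := h3 n hn (magnus x) 1
    rw [mul_one, one_apply, if_pos rfl, mul_one, magnus_nil, one_mul] at h4
    have h5 : magnusSub (x * n) = magnusSub x + magnus x * magnusSub n := by
      rw [← magnus_mul_sub, magnusSub, magnusSub]
      abel
    simp only [h5, map_add, h4]

theorem not_finite_cohomology [Infinite K] (hm : CombinatoriallyFree m)
    (hρ : ∀ k, HasHighestTerm (ρ k) (m k)) (hlen : ∀ k, 2 ≤ (m k).length) :
    ¬ Module.Finite (ZMod p) (Cohomology p Γ 2) := by
  classical
  refine not_finite_cohomology_two P.isOpenQuotientMap (fun k => P.map_relation k)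
    (P.hom_eq_zero_of_mem_ker fun k => order_anti (hlen k) (IsHighestTerm.mem_order (hρ k)))
    (P.exists_primitive hm hρ)

/-- The upper bound comes from the resolution, where `hfin` makes the orders of the relations tend
to infinity. The lower bound holds because an infinite-dimensional H² is not zero. -/
theorem cohomologicalDimension_eq_two [IsTopologicalGroup Γ] [CompactSpace Γ]
    (hm : CombinatoriallyFree m) (hρ : ∀ k, HasHighestTerm (ρ k) (m k))
    (hfin : ∀ n, {k | (m k).length < n}.Finite)
    (hne : ¬ Module.Finite (ZMod p) (Cohomology p Γ 2)) : cohomologicalDimension p Γ = 2 := by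
  refine le_antisymm (sInf_le fun i hi => ?_) (le_sInf fun n hn => ?_)
  · obtain ⟨n, rfl⟩ : ∃ n, i = n + 2 + 1 := ⟨i - 3, by
      have : 2 < i := by exact_mod_cast hi
      omega⟩
    have h1 := P.cohomologyVanishes hm hρ (fun N => (hfin N).subset fun k hk => by
      by_contra h
      exact hk (order_anti (not_lt.1 h) (IsHighestTerm.mem_order (hρ k)))) n
    rw [Submodule.Quotient.subsingleton_iff, eq_top_iff]
    intro f _
    exact h1.mem_coboundaries f.2
  · by_contra h
    have := hn 2 (not_le.1 h)
    exact hne inferInstance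

end IsPresentation

theorem isPresentation_mk {r : ℕ} (ρ : Fin r → FreeProP p d) (x : ℕ+ → FreeProP p d) :
    IsPresentation (QuotientGroup.mk' (closedNormalClosure (Set.range ρ ∪ Set.range x)))
      (Sum.elim ρ x) where
  isOpenQuotientMap := QuotientGroup.isOpenQuotientMap_mk
  ker_eq := by rw [QuotientGroup.ker_mk', Set.Sum.elim_range]

theorem finite_length_termFamily_lt {r : ℕ} (s t : Fin r → Fin d) (i₀ j₀ : Fin d) (n : ℕ) :
    {k | (termFamily s t i₀ j₀ k).length < n}.Finite := by
  refine ((Set.finite_range Sum.inl).union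
    ((Set.finite_Iio n.succPNat).image Sum.inr)).subset ?_
  rintro (k | e) hk
  · exact Or.inl ⟨k, rfl⟩
  · refine Or.inr ⟨e, ?_, rfl⟩
    have hk' : ((e : ℕ) + 2) < n := (length_termFamily_inr e).symm.trans_lt hk
    rw [Set.mem_Iio, ← PNat.coe_lt_coe, Nat.succPNat_coe]
    omega

theorem IsForrePresentation.exists_hom_cutQuotient {G : Type*} [Group G] [TopologicalSpace G]
    (hG : IsProP p G) {r c : ℕ} {π : FreeProP p d →* G} {ρ : Fin r → FreeProP p d}
    {s t : Fin r → Fin d} (h : IsForrePresentation c π ρ s t) (x : ℕ+ → FreeProP p d) :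
    ∃ q : G →* CutQuotient ρ x, Continuous q ∧ Function.Surjective q ∧
      ∀ y, q (π y) = QuotientGroup.mk y := by
  have hle : π.ker ≤ (QuotientGroup.mk'
      (closedNormalClosure (Set.range ρ ∪ Set.range x))).ker := by
    rw [h.ker_eq, QuotientGroup.ker_mk']
    exact closedNormalClosure_le (isClosed_closedNormalClosure _)
      (Set.subset_union_left.trans (subset_closedNormalClosure _))
  let q : G →* CutQuotient ρ x := π.liftOfSurjective h.surjective ⟨QuotientGroup.mk' _, hle⟩
  have hq : ∀ y, q (π y) = QuotientGroup.mk y := fun y =>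
    π.liftOfRightInverse_comp_apply _ _ ⟨QuotientGroup.mk' _, hle⟩ y
  refine ⟨q, ?_, fun z => ?_, hq⟩
  · rw [(hG.isOpenQuotientMap h.continuous h.surjective).isQuotientMap.continuous_iff]
    exact (funext hq : q ∘ π = QuotientGroup.mk) ▸ QuotientGroup.continuous_mk
  · obtain ⟨y, rfl⟩ := QuotientGroup.mk_surjective z
    exact ⟨π y, hq y⟩

end CutQuotient

end ProP

/-! ### The main theorem. -/

open ProP in
theorem mainTheorem3 (p : ℕ) [Fact p.Prime] (hp : 2 < p)
    {G : Type*} [Group G] [TopologicalSpace G] (hG : IsProP p G)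
    (hfp : IsFinitelyPresentedProP p G) (hfree : ¬ IsFreeProPOfFiniteRank p G)
    (U V : Submodule (ZMod p) (Cohomology p G 1)) (hUV : IsCompl U V)
    (hUU : ∀ u ∈ U, ∀ u' ∈ U, cup p G u u' = 0)
    (hcup : Submodule.map₂ (cup p G) U V = ⊤)
    (d r c : ℕ) (hd : Module.finrank (ZMod p) (Cohomology p G 1) = d)
    (hr : Module.finrank (ZMod p) (Cohomology p G 2) = r)
    (hc : Module.finrank (ZMod p) V = c) (hc2 : 2 ≤ c) (hrlt : r < (d - c) * (c - 1)) :
    -- there are relations with the prescribed highest terms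
    (∃ (π : FreeProP p d →* G) (ρ : Fin r → FreeProP p d) (s t : Fin r → Fin d),
      IsForrePresentation c π ρ s t) ∧
    -- and for all such relations the following holds
    ∀ (π : FreeProP p d →* G) (ρ : Fin r → FreeProP p d) (s t : Fin r → Fin d),
      IsForrePresentation c π ρ s t →
      (∃ i₀ j₀ : Fin d, 0 < (i₀ : ℕ) ∧ (i₀ : ℕ) < c ∧ c ≤ (j₀ : ℕ) ∧
        CombinatoriallyFree (termFamily s t i₀ j₀) ∧
        ∃ x : ℕ+ → FreeProP p d, ∀ n, HasHighestTerm (x n) (extraTerm i₀ j₀ n)) ∧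
      ∀ i₀ j₀ : Fin d, 0 < (i₀ : ℕ) → (i₀ : ℕ) < c → c ≤ (j₀ : ℕ) →
        CombinatoriallyFree (termFamily s t i₀ j₀) →
        ∀ x : ℕ+ → FreeProP p d, (∀ n, HasHighestTerm (x n) (extraTerm i₀ j₀ n)) →
          (∃ q : G →* CutQuotient ρ x, Continuous q ∧ Function.Surjective q ∧
            ∀ y, q (π y) = QuotientGroup.mk y) ∧
          cohomologicalDimension p (CutQuotient ρ x) = 2 ∧
          ¬ Module.Finite (ZMod p) (Cohomology p (CutQuotient ρ x) 2) ∧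
          (∀ n, Module.Finite (ZMod p) (GradedPiece p (CutQuotient ρ x) n)) ∧
          poincareSeries p (CutQuotient ρ x) =
            (1 - (d : PowerSeries ℚ) * PowerSeries.X + (r : PowerSeries ℚ) * PowerSeries.X ^ 2 +
              PowerSeries.X ^ 3 * PowerSeries.mk fun _ => (1 : ℚ))⁻¹ := by
  -- Since `finrank` is also zero for infinite-dimensional spaces, positivity of `d` is what
  -- guarantees that H¹ is finite-dimensional.
  have hd0 : 0 < d := by
    rcases Nat.eq_zero_or_pos d with rfl | h
    · simp at hrlt
    · exact h
  refine ⟨exists_isForrePresentation hG hfp U V hUV hUU hcup d r c hd hd0 hr hc,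
    fun π ρ s t hF => ⟨?_, fun i₀ j₀ _ hi hj hm x hx => ?_⟩⟩
  · obtain ⟨i₀, j₀, hi0, hi, hj, hne⟩ := exists_pair_notMem (s := s) (t := t) hrlt
    choose x hx using exists_hasHighestTerm_extraTerm (p := p) (i₀ := i₀) (j₀ := j₀)
      (Fin.lt_def.2 (hi.trans_le hj))
    exact ⟨i₀, j₀, hi0, hi, hj,
      combinatoriallyFree_termFamily hF.s_lt hF.le_t hF.injective hi0 hi hj hne,
      fun n => x n, fun n => hx n⟩
  · have P := isPresentation_mk ρ x
    have hρ : ∀ k, HasHighestTerm (Sum.elim ρ x k) (termFamily s t i₀ j₀ k) := by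
      rintro (k | n)
      exacts [hF.highestTerm k, hx n]
    have hlen : ∀ k, 2 ≤ (termFamily s t i₀ j₀ k).length := by
      rintro (k | n)
      · rw [length_termFamily_inl]
      · rw [length_termFamily_inr]
        omega
    have hH2 := P.not_finite_cohomology hm hρ hlen
    refine ⟨hF.exists_hom_cutQuotient hG x,
      P.cohomologicalDimension_eq_two hm hρ (finite_length_termFamily_lt s t i₀ j₀) hH2, hH2,
      P.finite_gradedPiece hm hρ, ?_⟩
    rw [← mk_card_normalWords hm, poincareSeries]
    simp only [P.finrank_gradedPiece hm hρ]
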